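/- **Setting.** Let $m_1,m_2,m_3>0$, $m=m_1+m_2+m_3$, and $\mu\in\mathbb R$. Elements of $\mathbb C^3$ and of $\mathbb C^{3*}\simeq\mathbb C^3$ that are called $Q,P,X,Y$ have components indexed by the pairs $12,31,23$. Put $\langle P,Q\rangle=\bar P_{12}Q_{12}+\bar P_{31}Q_{31}+\bar P_{23}Q_{23}$. Position-momentum spaces carry the canonical symplectic forms $\omega=-d\,\mathrm{Re}\langle p,dq\rangle$, $-d\,\mathrm{Re}\langle P,dQ\rangle$ and $-d\,(p_r\,dr+\mathrm{Re}\langle Y,dX\rangle)$. The Hamiltonian vector field $v$ of $H$ is given by $\omega(v,\cdot)=dH$. Collisions are removed from all phase spaces, so $q_i\ne q_j$ for $i\neq j$, $Q_{ij}\neq0$ and $X_{ij}\ne0$, and $r>0$. Set $$H(q,p)=\sum_i\frac{|p_i|^2}{2m_i}-\frac{m_1m_2}{|q_1-q_2|}-\frac{m_3m_1}{|q_3-q_1|}-\frac{m_2m_3}{|q_2-q_3|},$$ $$K(P)=\frac{|P_{12}-P_{31}|^2}{2m_1}+\frac{|P_{23}-P_{12}|^2}{2m_2}+\frac{|P_{31}-P_{23}|^2}{2m_3},\qquad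 U(Q)=\frac{m_1m_2}{|Q_{12}|}+\frac{m_3m_1}{|Q_{31}|}+\frac{m_2m_3}{|Q_{23}|},$$ $$H_{rel}(Q,P)=K(P)-U(Q),\qquad |X|^2=\tfrac1m\left(m_1m_2|X_{12}|^2+m_3m_1|X_{31}|^2+m_2m_3|X_{23}|^2\right),$$ $$X^*=\tfrac1m(m_1m_2X_{12},\,m_3m_1X_{31},\,m_2m_3X_{23}),$$ $$H_{sph}(r,p_r,X,Y)=H_{rel}\Big(\frac{r}{|X|}X,\ \frac{p_r}{|X|}X^*+\frac{|X|}{r}Y\Big).$$ The angular momentum is $\sum_j\mathrm{Im}(\bar q_jp_j)$ for $(q,p)$, and $-\mathrm{Im}\langle P,Q\rangle$ for $(Q,P)$. **Equivalence.** Suppose that two Hamiltonian systems $H_1,H_2$ have levels $J_1,J_2$ which are invariant under the flows and are unions of orbits of symmetry groups $G_1,G_2$, and that the flows take orbits in the levels to orbits. The quotient flows on $J_1/G_1$ and $J_2/G_2$ are called *equivalent* (or *conjugate*) if there are maps $F:J_1\to J_2$ and $G:J_2\to J_1$ with the following properties. They are smooth, take orbits into orbits, pull back the restricted symplectic form to the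 restricted symplectic form, satisfy $H_2\circ F=H_1$ and $H_1\circ G=H_2$, and satisfy $G\circ F=\mathrm{id}$ mod $G_1$ and $F\circ G=\mathrm{id}$ mod $G_2$. Moreover, the mutually inverse homeomorphisms that they induce between $J_1/G_1$ and $J_2/G_2$ conjugate the quotient flows, with the same time parameter and including the domains of definition. **Theorem.** 1. The set $\{\langle Y,X\rangle=-i\mu\}$ is invariant under the Hamiltonian flow of $H_{sph}$. It is a union of orbits of the complex scalings $(r,p_r,X,Y)\mapsto(r,p_r,kX,Y/\bar k)$, $k\in\mathbb C\setminus0$, and the flow takes orbits in it to orbits. The same holds for the flow of $H_{rel}$ on the angular momentum level $\{\mathrm{Im}\langle P,Q\rangle=-\mu\}$ of $T^*(\mathbb C^3\setminus 0)$ and the rotations $(Q,P)\mapsto(uQ,uP)$, $|u|=1$. The quotient flow of $H_{sph}$ on $\{\langle Y,X\rangle=-i\mu\}/(\mathbb C\setminus0)$ is equivalent to the quotient flow of $H_{rel}$ on $\{\mathrm{Im}\langle P,Q\rangle=-\mu\}/\mathbf S^1$. 2. The set $\{\langle Y,X\rangle=-i\mu,\ X_{12}+X_{31}+X_{23}=0\}$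 is invariant under the Hamiltonian flow of $H_{sph}$. It is a union of orbits of the complex scalings and translations $(r,p_r,X,Y)\mapsto(r,p_r,kX,Y/\bar k+(c,c,c))$, $k\in\mathbb C\setminus 0$, $c\in\mathbb C$, and the flow takes orbits in it to orbits. The same holds for the flow of $H$ on $\{p_1+p_2+p_3=0,\ \text{angular momentum}=\mu\}$ and the translations and rotations $(q,p)\mapsto(uq+(c,c,c),up)$, $|u|=1$, $c\in\mathbb C$. The quotient flow of $H_{sph}$ is conjugate to this quotient flow of the three-body problem with zero total momentum and angular momentum $\mu$, reduced by translations and rotations. 3. On the set in part 2, $H_{sph}=\tfrac12p_r^2+\frac{|X|^2}{r^2}K(Y)-\frac1rV(X)$ with $V(X)=|X|\,U(X)$. If $H_{sph}$ is replaced by this expression on the whole phase space, part 2 and the assertions of part 1 about $\{\langle Y,X\rangle=-i\mu\}$ (invariance, union of orbits, orbits to orbits) remain true. -/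

import Mathlib

/-! ## Hamiltonian systems with symmetry and their reductions -/

noncomputable section

namespace PlanarThreeBody

/-- The data of a symplectic reduction inside a real normed space `E`: a constant symplectic form,
an open phase space, a Hamiltonian, the level set of the momentum map that is to be reduced, and
the equivalence relation "in the same orbit of the symmetry group". -/
structure ReductionData (E : Type) where
  /-- the symplectic form `ω` -/
  form : E → E → ℝ
  /-- the phase space -/
  phase : Set E
  /-- the Hamiltonian -/
  ham : E → ℝ
  /-- the momentum level -/
  level : Set E
  /-- the orbit relation of the symmetry group -/
  orbit : Setoid E

namespace ReductionData

variable {E E₁ E₂ : Type}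
  [NormedAddCommGroup E] [NormedSpace ℝ E]
  [NormedAddCommGroup E₁] [NormedSpace ℝ E₁]
  [NormedAddCommGroup E₂] [NormedSpace ℝ E₂]

/-- `v` is the value at `x` of the Hamiltonian vector field: `ω(v, ·) = dH(x)`. -/
def IsHamiltonianVector (S : ReductionData E) (x v : E) : Prop :=
  ∀ w : E, S.form v w = fderiv ℝ S.ham x w

/-- `γ` solves Hamilton's equations on the set of times `I`, inside the phase space. -/
def IsSolutionOn (S : ReductionData E) (γ : ℝ → E) (I : Set ℝ) : Prop :=
  ∀ s ∈ I, γ s ∈ S.phase ∧ ∃ v : E, HasDerivAt γ v s ∧ S.IsHamiltonianVector (γ s) v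

/-- The graph of the (local) Hamiltonian flow: the time-`t` flow is defined at `x` and takes `x`
to `y`. -/
def Flow (S : ReductionData E) (t : ℝ) (x y : E) : Prop :=
  ∃ (γ : ℝ → E) (I : Set ℝ), IsOpen I ∧ I.OrdConnected ∧ 0 ∈ I ∧ t ∈ I ∧
    S.IsSolutionOn γ I ∧ γ 0 = x ∧ γ t = y

/-- The level set is a union of orbits, it is invariant under the Hamiltonian flow, and the flow
takes orbits in the level set to orbits: the restricted flow has a well-defined quotient flow. -/
structure HasQuotientFlow (S : ReductionData E) : Prop where
  level_subset : S.level ⊆ S.phase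
  saturated : ∀ x y : E, x ∈ S.level → S.orbit x y → y ∈ S.level
  invariant : ∀ (t : ℝ) (x y : E), x ∈ S.level → S.Flow t x y → y ∈ S.level
  orbits : ∀ (t : ℝ) (x x' y : E), x ∈ S.level → S.orbit x x' → S.Flow t x y →
    ∃ y' : E, S.orbit y y' ∧ S.Flow t x' y'

/-- The reduced phase space: the orbit space of the level set, with the quotient topology. -/
abbrev ReducedSpace (S : ReductionData E) : Type :=
  Quotient (S.orbit.comap (Subtype.val : S.level → E))

/-- The point of the reduced phase space represented by `x`. -/
def proj (S : ReductionData E) (x : S.level) : S.ReducedSpace :=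
  Quotient.mk _ x

/-- The graph of the quotient flow on the reduced phase space. -/
def ReducedFlow (S : ReductionData E) (t : ℝ) (a b : S.ReducedSpace) : Prop :=
  ∃ x y : S.level, S.proj x = a ∧ S.proj y = b ∧ S.Flow t x y

/-- `v` is tangent at `x` to the level set (velocity at `x` of a curve in the level set). -/
def IsTangent (S : ReductionData E) (x v : E) : Prop :=
  ∃ γ : ℝ → E, (∀ t, γ t ∈ S.level) ∧ γ 0 = x ∧ HasDerivAt γ v 0

/-- `F` restricts to a partially symplectic, equivariant map from the level set of `S₁` to that of
`S₂`: it is smooth near the level set, maps level to level and orbits into orbits, and pulls the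
restriction of `ω₂` back to the restriction of `ω₁`. -/
structure IsPartiallySymplectic (S₁ : ReductionData E₁) (S₂ : ReductionData E₂)
    (F : E₁ → E₂) : Prop where
  smooth : ∃ U : Set E₁, IsOpen U ∧ S₁.level ⊆ U ∧ ContDiffOn ℝ (⊤ : ℕ∞) F U
  mapsTo : Set.MapsTo F S₁.level S₂.level
  equivariant : ∀ x ∈ S₁.level, ∀ y ∈ S₁.level, S₁.orbit x y → S₂.orbit (F x) (F y)
  symplectic : ∀ x ∈ S₁.level, ∀ v w : E₁, S₁.IsTangent x v → S₁.IsTangent x w →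
    S₂.form (fderiv ℝ F x v) (fderiv ℝ F x w) = S₁.form v w

/-- The two reduced Hamiltonian flows are equivalent (conjugate): there are partially symplectic
equivariant maps `F`, `G` between the levels that are inverse to each other modulo the groups and
intertwine the Hamiltonians, so that they induce mutually inverse symplectic diffeomorphisms of the
reduced phase spaces, and the induced homeomorphism conjugates the quotient flows, with the same
time and including the domains of definition. -/
def Equivalent (S₁ : ReductionData E₁) (S₂ : ReductionData E₂) : Prop :=
  ∃ (F : E₁ → E₂) (G : E₂ → E₁),
    IsPartiallySymplectic S₁ S₂ F ∧ IsPartiallySymplectic S₂ S₁ G ∧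
    (∀ x ∈ S₁.level, S₁.orbit (G (F x)) x) ∧
    (∀ y ∈ S₂.level, S₂.orbit (F (G y)) y) ∧
    (∀ x ∈ S₁.level, S₂.ham (F x) = S₁.ham x) ∧
    (∀ y ∈ S₂.level, S₁.ham (G y) = S₂.ham y) ∧
    ∃ Φ : S₁.ReducedSpace ≃ₜ S₂.ReducedSpace,
      (∀ (x : S₁.level) (y : S₂.level), F x = y → Φ (S₁.proj x) = S₂.proj y) ∧
      (∀ (y : S₂.level) (x : S₁.level), G y = x → Φ.symm (S₂.proj y) = S₁.proj x) ∧
      ∀ (t : ℝ) (a b : S₁.ReducedSpace),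
        S₁.ReducedFlow t a b ↔ S₂.ReducedFlow t (Φ a) (Φ b)

end ReductionData

/-! ## The planar three-body problem

Bodies `1, 2, 3` have the indices `0, 1, 2`.  Relative vectors (such as `Q`, `P`, `X`, `Y`) are
indexed by the pairs `12, 31, 23`, in this order.  Covectors are written as complex vectors. -/

/-- `ℂ³`; its norm is used only as a source of topology and derivatives. -/
abbrev C3 : Type := Fin 3 → ℂ

/-- The phase space `ℂ³ × ℂ³*`. -/
abbrev E6 : Type := C3 × C3

/-- Coordinates `((r, p_r), (X, Y))`. -/
abbrev ESph : Type := (ℝ × ℝ) × (C3 × C3)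

/-- Hermitian evaluation pairing `⟨P, Q⟩`, antilinear in the covector `P`. -/
def pairing (P Q : C3) : ℂ := ∑ j, (starRingEnd ℂ) (P j) * Q j

/-- Sum of the components. -/
def tot (Q : C3) : ℂ := ∑ j, Q j

/-- Angular momentum `∑ q_j ∧ p_j`. -/
def angMom (q p : C3) : ℝ := ∑ j, ((q j).re * (p j).im - (q j).im * (p j).re)

/-- The canonical symplectic form `dQ ∧ dP = - d Re⟨P, dQ⟩`. -/
def canonicalForm (v w : E6) : ℝ := (pairing w.2 v.1).re - (pairing v.2 w.1).re

/-- The canonical symplectic form `dr ∧ dp_r + dX ∧ dY`. -/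
def canonicalFormSph (v w : ESph) : ℝ :=
  (v.1.1 * w.1.2 - v.1.2 * w.1.1) + canonicalForm v.2 w.2

/-- The mass products `m₁m₂, m₃m₁, m₂m₃`. -/
def pairMass (m : Fin 3 → ℝ) : Fin 3 → ℝ := ![m 0 * m 1, m 2 * m 0, m 1 * m 2]

/-- Total mass. -/
def totalMass (m : Fin 3 → ℝ) : ℝ := ∑ i, m i

/-- The three-body Hamiltonian. -/
def hamBody (m : Fin 3 → ℝ) (x : E6) : ℝ :=
  (‖x.2 0‖ ^ 2 / (2 * m 0) + ‖x.2 1‖ ^ 2 / (2 * m 1) + ‖x.2 2‖ ^ 2 / (2 * m 2)) -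
  (m 0 * m 1 / ‖x.1 0 - x.1 1‖ + m 2 * m 0 / ‖x.1 2 - x.1 0‖ + m 1 * m 2 / ‖x.1 1 - x.1 2‖)

/-- Kinetic energy `K(P)` in relative momenta. -/
def kinRel (m : Fin 3 → ℝ) (P : C3) : ℝ :=
  ‖P 0 - P 1‖ ^ 2 / (2 * m 0) + ‖P 2 - P 0‖ ^ 2 / (2 * m 1) + ‖P 1 - P 2‖ ^ 2 / (2 * m 2)

/-- Potential `U(Q)` in relative positions. -/
def potRel (m : Fin 3 → ℝ) (Q : C3) : ℝ := ∑ j, pairMass m j / ‖Q j‖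

/-- The Hamiltonian `H_rel(Q, P) = K(P) - U(Q)`. -/
def hamRel (m : Fin 3 → ℝ) (x : E6) : ℝ := kinRel m x.2 - potRel m x.1

/-- The mass norm `|Q|`. -/
def massNorm (m : Fin 3 → ℝ) (Q : C3) : ℝ :=
  Real.sqrt ((∑ j, pairMass m j * ‖Q j‖ ^ 2) / totalMass m)

/-- The covector `X*` dual to `X` for the mass metric. -/
def massDual (m : Fin 3 → ℝ) (X : C3) : C3 := fun j => ((pairMass m j / totalMass m : ℝ) : ℂ) * X j

/-- The map `(r, p_r, X, Y) ↦ (Q, P)`, with `Q = r X / |X|`,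
`P = (p_r / |X|) X* + (|X| / r) Y`. -/
def sphToRel (m : Fin 3 → ℝ) (z : ESph) : E6 :=
  ((z.1.1 / massNorm m z.2.1) • z.2.1,
    (z.1.2 / massNorm m z.2.1) • massDual m z.2.1 + (massNorm m z.2.1 / z.1.1) • z.2.2)

/-- The spherical-homogeneous Hamiltonian `H_sph`, which is `H_rel` in the variables
`(r, p_r, X, Y)`. -/
def hamSph (m : Fin 3 → ℝ) (z : ESph) : ℝ := hamRel m (sphToRel m z)

/-- The shape potential `V(X) = |X| U(X)`. -/
def shapePot (m : Fin 3 → ℝ) (X : C3) : ℝ := massNorm m X * potRel m X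

/-- The expression `p_r² / 2 + (|X|² / r²) K(Y) - V(X) / r`. -/
def hamSphExplicit (m : Fin 3 → ℝ) (z : ESph) : ℝ :=
  z.1.2 ^ 2 / 2 + massNorm m z.2.1 ^ 2 / z.1.1 ^ 2 * kinRel m z.2.2 - shapePot m z.2.1 / z.1.1

/-! ## Orbit relations -/

/-- Translations and rotations of the three bodies: `(q, p) ↦ (u q + c, u p)` with `|u| = 1`. -/
def orbitBody : Setoid E6 where
  r x y := ∃ u c : ℂ, ‖u‖ = 1 ∧ y = (fun j => u * x.1 j + c, fun j => u * x.2 j)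
  iseqv := by
    refine ⟨fun x => ⟨1, 0, by simp, by simp⟩, ?_, ?_⟩
    · rintro x y ⟨u, c, hu, rfl⟩
      have h0 : u ≠ 0 := by rintro rfl; simp at hu
      refine ⟨u⁻¹, -(u⁻¹ * c), by simp [hu], ?_⟩
      ext j
      · simp only; field_simp; ring
      · simp only; field_simp
    · rintro x y z ⟨u, c, hu, rfl⟩ ⟨v, d, hv, rfl⟩
      refine ⟨v * u, v * c + d, by simp [hu, hv], ?_⟩
      ext j <;> simp only <;> ring

/-- Rotations of the relative vectors: `(Q, P) ↦ (u Q, u P)` with `|u| = 1`. -/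
def orbitRel : Setoid E6 where
  r x y := ∃ u : ℂ, ‖u‖ = 1 ∧ y = (fun j => u * x.1 j, fun j => u * x.2 j)
  iseqv := by
    refine ⟨fun x => ⟨1, by simp, by simp⟩, ?_, ?_⟩
    · rintro x y ⟨u, hu, rfl⟩
      have h0 : u ≠ 0 := by rintro rfl; simp at hu
      refine ⟨u⁻¹, by simp [hu], ?_⟩
      ext j <;> simp only <;> field_simp
    · rintro x y z ⟨u, hu, rfl⟩ ⟨v, hv, rfl⟩
      refine ⟨v * u, by simp [hu, hv], ?_⟩
      ext j <;> simp only <;> ring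

/-- Complex scaling: `(r, p_r, X, Y) ↦ (r, p_r, k X, Y / k̄)` with `k ≠ 0`. -/
def orbitScaling : Setoid ESph where
  r x y := ∃ k : ℂ, k ≠ 0 ∧
    y = (x.1, (fun j => k * x.2.1 j, fun j => x.2.2 j / (starRingEnd ℂ) k))
  iseqv := by
    refine ⟨fun x => ⟨1, by simp, by simp⟩, ?_, ?_⟩
    · rintro x y ⟨k, hk, rfl⟩
      have hk' : (starRingEnd ℂ) k ≠ 0 := by simpa using hk
      refine ⟨k⁻¹, inv_ne_zero hk, ?_⟩
      ext j
      · rfl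
      · rfl
      · simp only; field_simp
      · simp only [map_inv₀]; field_simp
    · rintro x y z ⟨k, hk, rfl⟩ ⟨l, hl, rfl⟩
      have hk' : (starRingEnd ℂ) k ≠ 0 := by simpa using hk
      have hl' : (starRingEnd ℂ) l ≠ 0 := by simpa using hl
      refine ⟨l * k, mul_ne_zero hl hk, ?_⟩
      ext j
      · rfl
      · rfl
      · simp only; ring
      · simp only [map_mul]; field_simp

/-- Complex scaling together with translations of the `Y_ij`:
`(r, p_r, X, Y) ↦ (r, p_r, k X, Y / k̄ + (c, c, c))` with `k ≠ 0`. -/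
def orbitScalingTranslation : Setoid ESph where
  r x y := ∃ k c : ℂ, k ≠ 0 ∧
    y = (x.1, (fun j => k * x.2.1 j, fun j => x.2.2 j / (starRingEnd ℂ) k + c))
  iseqv := by
    refine ⟨fun x => ⟨1, 0, by simp, by simp⟩, ?_, ?_⟩
    · rintro x y ⟨k, c, hk, rfl⟩
      have hk' : (starRingEnd ℂ) k ≠ 0 := by simpa using hk
      refine ⟨k⁻¹, -(c * (starRingEnd ℂ) k), inv_ne_zero hk, ?_⟩
      ext j
      · rfl
      · rfl
      · simp only; field_simp
      · simp only [map_inv₀]; field_simp; ring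
    · rintro x y z ⟨k, c, hk, rfl⟩ ⟨l, d, hl, rfl⟩
      have hk' : (starRingEnd ℂ) k ≠ 0 := by simpa using hk
      have hl' : (starRingEnd ℂ) l ≠ 0 := by simpa using hl
      refine ⟨l * k, c / (starRingEnd ℂ) l + d, mul_ne_zero hl hk, ?_⟩
      ext j
      · rfl
      · rfl
      · simp only; ring
      · simp only [map_mul]; field_simp; ring

/-! ## The systems to be reduced (collisions are always removed) -/

/-- The three-body problem with zero total momentum and angular momentum `μ`, to be reduced by
translations and rotations. -/
def bodySystem (m : Fin 3 → ℝ) (μ : ℝ) : ReductionData E6 where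
  form := canonicalForm
  phase := {x | ∀ i j, i ≠ j → x.1 i ≠ x.1 j}
  ham := hamBody m
  level := {x | (∀ i j, i ≠ j → x.1 i ≠ x.1 j) ∧ tot x.2 = 0 ∧ angMom x.1 x.2 = μ}
  orbit := orbitBody

/-- The Hamiltonian `H_rel` on `T*ℂ³₀`, at angular momentum `μ`, to be reduced by rotations. -/
def relSystem (m : Fin 3 → ℝ) (μ : ℝ) : ReductionData E6 where
  form := canonicalForm
  phase := {x | ∀ j, x.1 j ≠ 0}
  ham := hamRel m
  level := {x | (∀ j, x.1 j ≠ 0) ∧ angMom x.1 x.2 = μ}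
  orbit := orbitRel

/-- A Hamiltonian `h` on `T*ℝ⁺ × T*ℂ³₀`, at the level `⟨Y, X⟩ = -iμ`, to be reduced by complex
scaling. -/
def sphSystem (h : ESph → ℝ) (μ : ℝ) : ReductionData ESph where
  form := canonicalFormSph
  phase := {z | 0 < z.1.1 ∧ ∀ j, z.2.1 j ≠ 0}
  ham := h
  level := {z | (0 < z.1.1 ∧ ∀ j, z.2.1 j ≠ 0) ∧ pairing z.2.2 z.2.1 = -(Complex.I * μ)}
  orbit := orbitScaling

/-- A Hamiltonian `h` on `T*ℝ⁺ × T*ℂ³₀`, at the level `⟨Y, X⟩ = -iμ`, `X₁₂ + X₃₁ + X₂₃ = 0`, to be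
reduced by complex scaling and translations of the `Y_ij`. -/
def sphTransSystem (h : ESph → ℝ) (μ : ℝ) : ReductionData ESph where
  form := canonicalFormSph
  phase := {z | 0 < z.1.1 ∧ ∀ j, z.2.1 j ≠ 0}
  ham := h
  level := {z | (0 < z.1.1 ∧ ∀ j, z.2.1 j ≠ 0) ∧ pairing z.2.2 z.2.1 = -(Complex.I * μ) ∧
    tot z.2.1 = 0}
  orbit := orbitScalingTranslation

end PlanarThreeBody

end

/-! The Hamiltonian `hamSph` is the pull-back of `hamRel` by F = `sphToRel`, so everything depends
on what F does to the symplectic form. By `canonicalForm_fderiv_sphToRel`, F*ω = ω + d log(r/|X|) ∧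
d Re⟨Y,X⟩. The real part of ⟨Y,X⟩ is the momentum of the real dilations, which F does not see; the
imaginary part goes over to Im⟨P,Q⟩. On Re⟨Y,X⟩ = 0 the correction vanishes on tangent vectors, and
F divides out exactly the real scalings; the remaining phase k/|k| acts as a rotation of (Q,P). The
section `relToSph`, normalized by |X| = r, inverts F modulo scaling. This gives part 1.

For part 2, K depends only on differences of momenta. Hence the translations by (c,c,c) are
symmetries, and the sum of the relative positions is their momentum. The intermediate system
`relTransSystem` is `hamRel` on the zero-sum level modulo rotations and these translations. It is
compared with the three bodies through two linear maps, `relToBody` and `bodyToRel`, which are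
adjoint for the symplectic forms and inverse to each other modulo translations on the zero-sum
levels. Transitivity (`Equivalent.trans`) finishes.

For part 3, `hamSph_eq` shows that `hamSph` and `hamSphExplicit` differ by terms that vanish on the
constraint set. There their differentials differ by multiples of the differentials of the
constraints, so the Hamiltonian fields differ by infinitesimal scalings and translations. The
scaling part disappears under F; in the other direction it is matched by the section `relToSphUnit`,
normalized by |X| = 1. The translation part is a gauge.

The flows are conjugated by solution curves. A map that sends Hamiltonian vectors to Hamiltonian
vectors up to a translation sends solutions to solutions after a translation by the integral of the
discrepancy (`Flow.map_gauge`); `equivalent_of_flow` passes to the quotients. Invariance of the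
levels is Noether's theorem, obtained by testing ω(v,·) = dH on the generators of the symmetries. -/

noncomputable section

namespace PlanarThreeBody

namespace ReductionData

variable {E E₁ E₂ E₃ : Type}
  [NormedAddCommGroup E] [NormedSpace ℝ E]
  [NormedAddCommGroup E₁] [NormedSpace ℝ E₁]
  [NormedAddCommGroup E₂] [NormedSpace ℝ E₂]
  [NormedAddCommGroup E₃] [NormedSpace ℝ E₃]

/-! ### Conserved quantities and symmetries -/

/-- A function whose derivative vanishes on Hamiltonian vectors is conserved by the flow. -/
theorem Flow.conserved {S : ReductionData E} {f : E → ℝ}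
    (hf : ∀ x ∈ S.phase, ∀ v, S.IsHamiltonianVector x v →
      ∀ γ : ℝ → E, ∀ s, γ s = x → HasDerivAt γ v s → HasDerivAt (fun t => f (γ t)) 0 s)
    {t : ℝ} {x y : E} (h : S.Flow t x y) : f y = f x := by
  obtain ⟨γ, I, hI, hc, h0, ht, hsol, rfl, rfl⟩ := h
  have hd : ∀ s ∈ I, HasDerivAt (fun t => f (γ t)) 0 s := by
    intro s hs
    obtain ⟨hp, v, hv, hH⟩ := hsol s hs
    exact hf _ hp v hH γ s rfl hv
  exact hI.is_const_of_deriv_eq_zero hc.isPreconnected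
    (fun s hs => (hd s hs).differentiableAt.differentiableWithinAt)
    (fun s hs => (hd s hs).deriv) ht h0

/-- The derivative of the Hamiltonian vanishes in the direction of a curve on which the
Hamiltonian is constant. -/
theorem fderiv_ham_eq_zero {S : ReductionData E} {x : E} {c : ℝ → E} {w : E}
    (hd : DifferentiableAt ℝ S.ham x) (hc : HasDerivAt c w 0) (h0 : c 0 = x)
    (hinv : ∀ t, S.ham (c t) = S.ham x) : fderiv ℝ S.ham x w = 0 := by
  subst h0
  have h1 := hd.hasFDerivAt.comp_hasDerivAt (0 : ℝ) hc
  have h2 : S.ham ∘ c = fun _ => S.ham (c 0) := funext hinv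
  rw [h2] at h1
  exact h1.unique (hasDerivAt_const _ _)

/-- An affine symplectic symmetry of the Hamiltonian maps Hamiltonian vectors to Hamiltonian
vectors. -/
theorem IsHamiltonianVector.map_symmetry {S : ReductionData E} {T : E → E} (L : E →L[ℝ] E)
    (hT : ∀ x, HasFDerivAt T L x) (hsurj : Function.Surjective L)
    (hform : ∀ v w, S.form (L v) (L w) = S.form v w) (hham : ∀ x, S.ham (T x) = S.ham x)
    {x v : E} (hd : DifferentiableAt ℝ S.ham (T x)) (h : S.IsHamiltonianVector x v) :
    S.IsHamiltonianVector (T x) (L v) := by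
  intro w
  -- Surjectivity of `L` makes every test vector at `T x` the image of one at `x`.
  obtain ⟨w, rfl⟩ := hsurj w
  rw [hform, h w]
  have h1 := (hd.hasFDerivAt.comp x (hT x)).fderiv
  have h2 : S.ham ∘ T = S.ham := funext hham
  rw [h2] at h1
  rw [h1]; rfl

/-- An affine symplectic symmetry of the Hamiltonian commutes with the flow. -/
theorem Flow.map_symmetry {S : ReductionData E} {T : E → E} (L : E →L[ℝ] E)
    (hT : ∀ x, HasFDerivAt T L x) (hsurj : Function.Surjective L)
    (hform : ∀ v w, S.form (L v) (L w) = S.form v w) (hham : ∀ x, S.ham (T x) = S.ham x)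
    (hphase : ∀ x ∈ S.phase, T x ∈ S.phase)
    (hd : ∀ x ∈ S.phase, DifferentiableAt ℝ S.ham x) {t : ℝ} {x y : E} (h : S.Flow t x y) :
    S.Flow t (T x) (T y) := by
  obtain ⟨γ, I, hI, hc, h0, ht, hsol, rfl, rfl⟩ := h
  refine ⟨fun s => T (γ s), I, hI, hc, h0, ht, fun s hs => ?_, rfl, rfl⟩
  obtain ⟨hp, v, hv, hH⟩ := hsol s hs
  exact ⟨hphase _ hp, L v, (hT _).comp_hasDerivAt s hv,
    hH.map_symmetry L hT hsurj hform hham (hd _ (hphase _ hp))⟩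

/-! ### Transport of the flow by a map, up to a translation gauge -/

theorem hasDerivAt_integral_of_continuousOn {I : Set ℝ} (hI : IsOpen I) (hc : I.OrdConnected)
    {b : ℝ → ℂ} (hb : ContinuousOn b I) {t₀ s : ℝ} (h0 : t₀ ∈ I) (hs : s ∈ I) :
    HasDerivAt (fun u => ∫ x in t₀..u, b x) (b s) s :=
  intervalIntegral.integral_hasDerivAt_right
    (hb.mono (hc.uIcc_subset h0 hs)).intervalIntegrable
    (hb.stronglyMeasurableAtFilter hI s hs) (hb.continuousAt (hI.mem_nhds hs))

/-- If the derivative of `Φ` maps Hamiltonian vectors to Hamiltonian vectors up to infinitesimal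
translations `τ (b x)`, and the second system is invariant under the translations `τ c`, then
`Φ` maps the flow to the flow up to translations. -/
theorem Flow.map_gauge {S₁ : ReductionData E₁} {S₂ : ReductionData E₂} {Φ : E₁ → E₂}
    (τ : ℂ →L[ℝ] E₂) (b : E₁ → ℂ) (hS : S₁.HasQuotientFlow)
    (hd : ∀ x ∈ S₁.level, DifferentiableAt ℝ Φ x) (hphase : ∀ x ∈ S₁.level, Φ x ∈ S₂.phase)
    (hb : ContinuousOn b S₁.level)
    (hv : ∀ x ∈ S₁.level, ∀ v, S₁.IsHamiltonianVector x v →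
      S₂.IsHamiltonianVector (Φ x) (fderiv ℝ Φ x v + τ (b x)))
    (hτ : ∀ x ∈ S₂.phase, ∀ c, x + τ c ∈ S₂.phase)
    (hτv : ∀ x ∈ S₂.phase, ∀ c v, S₂.IsHamiltonianVector x v →
      S₂.IsHamiltonianVector (x + τ c) v)
    {t : ℝ} {x y : E₁} (hx : x ∈ S₁.level) (h : S₁.Flow t x y) :
    ∃ c, S₂.Flow t (Φ x) (Φ y + τ c) := by
  obtain ⟨γ, I, hI, hc, h0, ht, hsol, rfl, rfl⟩ := h
  -- The hypotheses on `Φ` hold only on the level, so the whole solution has to stay there.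
  have hlev : ∀ s ∈ I, γ s ∈ S₁.level := fun s hs =>
    hS.invariant s (γ 0) (γ s) hx ⟨γ, I, hI, hc, h0, hs, hsol, rfl, rfl⟩
  have hcont : ContinuousOn γ I := fun s hs => by
    obtain ⟨_, v, hv, _⟩ := hsol s hs
    exact hv.continuousAt.continuousWithinAt
  have hbc : ContinuousOn (fun s => b (γ s)) I := hb.comp hcont hlev
  -- The velocity of `Φ ∘ γ` misses being Hamiltonian by `τ (b (γ s))`. Adding `τ` of the primitive
  -- of `b ∘ γ` repairs the velocity, and translation invariance of the second system carries the
  -- Hamiltonian condition to the shifted point.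
  refine ⟨∫ u in (0 : ℝ)..t, b (γ u), fun s => Φ (γ s) + τ (∫ u in (0 : ℝ)..s, b (γ u)), I, hI,
    hc, h0, ht, fun s hs => ?_, by simp, rfl⟩
  obtain ⟨_, v, hv', hH⟩ := hsol s hs
  refine ⟨hτ _ (hphase _ (hlev s hs)) _, fderiv ℝ Φ (γ s) v + τ (b (γ s)), ?_,
    hτv _ (hphase _ (hlev s hs)) _ _ (hv _ (hlev s hs) v hH)⟩
  exact ((hd _ (hlev s hs)).hasFDerivAt.comp_hasDerivAt s hv').add
    (τ.hasFDerivAt.comp_hasDerivAt s (hasDerivAt_integral_of_continuousOn hI hc hbc h0 hs))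

/-- If the derivative of `Φ` maps Hamiltonian vectors to Hamiltonian vectors, then `Φ` maps the
flow to the flow. -/
theorem Flow.map_of_level {S₁ : ReductionData E₁} {S₂ : ReductionData E₂} {Φ : E₁ → E₂}
    (hS : S₁.HasQuotientFlow)
    (hd : ∀ x ∈ S₁.level, DifferentiableAt ℝ Φ x) (hphase : ∀ x ∈ S₁.level, Φ x ∈ S₂.phase)
    (hv : ∀ x ∈ S₁.level, ∀ v, S₁.IsHamiltonianVector x v →
      S₂.IsHamiltonianVector (Φ x) (fderiv ℝ Φ x v))
    {t : ℝ} {x y : E₁} (hx : x ∈ S₁.level) (h : S₁.Flow t x y) :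
    S₂.Flow t (Φ x) (Φ y) := by
  obtain ⟨c, hc⟩ := Flow.map_gauge (S₁ := S₁) (S₂ := S₂) (Φ := Φ) 0 (fun _ => 0) hS hd hphase
    continuousOn_const (by simpa using hv) (by simp) (by simp) hx h
  simpa using hc

/-! ### Equivalence of reduced flows -/

theorem IsPartiallySymplectic.differentiableAt {S₁ : ReductionData E₁} {S₂ : ReductionData E₂}
    {F : E₁ → E₂} (hF : IsPartiallySymplectic S₁ S₂ F) {x : E₁} (hx : x ∈ S₁.level) :
    DifferentiableAt ℝ F x := by
  obtain ⟨U, hU, hsub, hc⟩ := hF.smooth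
  exact (hc.contDiffAt (hU.mem_nhds (hsub hx))).differentiableAt (by simp)

theorem IsPartiallySymplectic.continuousOn {S₁ : ReductionData E₁} {S₂ : ReductionData E₂}
    {F : E₁ → E₂} (hF : IsPartiallySymplectic S₁ S₂ F) : ContinuousOn F S₁.level :=
  fun _ hx => (hF.differentiableAt hx).continuousAt.continuousWithinAt

theorem IsPartiallySymplectic.isTangent {S₁ : ReductionData E₁} {S₂ : ReductionData E₂}
    {F : E₁ → E₂} (hF : IsPartiallySymplectic S₁ S₂ F) {x v : E₁} (hx : x ∈ S₁.level)
    (hv : S₁.IsTangent x v) : S₂.IsTangent (F x) (fderiv ℝ F x v) := by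
  obtain ⟨γ, hγ, rfl, hd⟩ := hv
  exact ⟨fun t => F (γ t), fun t => hF.mapsTo (hγ t), rfl,
    (hF.differentiableAt hx).hasFDerivAt.comp_hasDerivAt 0 hd⟩

theorem IsPartiallySymplectic.comp {S₁ : ReductionData E₁} {S₂ : ReductionData E₂}
    {S₃ : ReductionData E₃} {F : E₁ → E₂} {F' : E₂ → E₃}
    (hF' : IsPartiallySymplectic S₂ S₃ F') (hF : IsPartiallySymplectic S₁ S₂ F) :
    IsPartiallySymplectic S₁ S₃ (F' ∘ F) where
  smooth := by
    obtain ⟨U, hU, hsub, hc⟩ := hF.smooth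
    obtain ⟨V, hV, hsub', hc'⟩ := hF'.smooth
    refine ⟨U ∩ F ⁻¹' V, hc.continuousOn.isOpen_inter_preimage hU hV,
      fun x hx => ⟨hsub hx, hsub' (hF.mapsTo hx)⟩, ?_⟩
    exact hc'.comp (hc.mono Set.inter_subset_left) fun x hx => hx.2
  mapsTo := hF'.mapsTo.comp hF.mapsTo
  equivariant x hx y hy h :=
    hF'.equivariant _ (hF.mapsTo hx) _ (hF.mapsTo hy) (hF.equivariant x hx y hy h)
  symplectic x hx v w hv hw := by
    rw [fderiv_comp x (hF'.differentiableAt (hF.mapsTo hx)) (hF.differentiableAt hx)]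
    exact (hF'.symplectic _ (hF.mapsTo hx) _ _ (hF.isTangent hx hv) (hF.isTangent hx hw)).trans
      (hF.symplectic x hx v w hv hw)

/-- Equivalence of reduced flows is transitive. -/
theorem Equivalent.trans {S₁ : ReductionData E₁} {S₂ : ReductionData E₂} {S₃ : ReductionData E₃}
    (h : S₁.Equivalent S₂) (h' : S₂.Equivalent S₃) : S₁.Equivalent S₃ := by
  obtain ⟨F, G, hF, hG, hGF, hFG, hFh, hGh, Φ, hΦ, hΦs, hflow⟩ := h
  obtain ⟨F', G', hF', hG', hGF', hFG', hFh', hGh', Φ', hΦ', hΦs', hflow'⟩ := h'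
  refine ⟨F' ∘ F, G ∘ G', hF'.comp hF, hG.comp hG', fun x hx => ?_, fun y hy => ?_,
    fun x hx => ?_, fun y hy => ?_, Φ.trans Φ', fun x y hxy => ?_, fun y x hxy => ?_,
    fun t a b => ?_⟩
  · have h1 := hGF' _ (hF.mapsTo hx)
    have h2 := hG.equivariant _ (hG'.mapsTo (hF'.mapsTo (hF.mapsTo hx))) _ (hF.mapsTo hx) h1
    exact S₁.orbit.trans h2 (hGF x hx)
  · have h1 := hFG _ (hG'.mapsTo hy)
    have h2 := hF'.equivariant _ (hF.mapsTo (hG.mapsTo (hG'.mapsTo hy))) _ (hG'.mapsTo hy) h1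
    exact S₃.orbit.trans h2 (hFG' y hy)
  · exact (hFh' _ (hF.mapsTo hx)).trans (hFh x hx)
  · exact (hGh _ (hG'.mapsTo hy)).trans (hGh' y hy)
  · rw [Homeomorph.trans_apply, hΦ x ⟨F x, hF.mapsTo x.2⟩ rfl]
    exact hΦ' ⟨F x, hF.mapsTo x.2⟩ y hxy
  · rw [Homeomorph.symm_trans_apply, hΦs' y ⟨G' y, hG'.mapsTo y.2⟩ rfl]
    exact hΦs ⟨G' y, hG'.mapsTo y.2⟩ x hxy
  · exact (hflow t a b).trans (hflow' t (Φ a) (Φ b))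

/-- Partially symplectic maps which are inverse to each other modulo the groups and which map the
flow to the flow modulo the groups define an equivalence of the reduced flows. -/
theorem equivalent_of_flow {S₁ : ReductionData E₁} {S₂ : ReductionData E₂}
    {F : E₁ → E₂} {G : E₂ → E₁} (hS₁ : S₁.HasQuotientFlow) (hS₂ : S₂.HasQuotientFlow)
    (hF : IsPartiallySymplectic S₁ S₂ F) (hG : IsPartiallySymplectic S₂ S₁ G)
    (hGF : ∀ x ∈ S₁.level, S₁.orbit (G (F x)) x) (hFG : ∀ y ∈ S₂.level, S₂.orbit (F (G y)) y)
    (hham : ∀ x ∈ S₁.level, S₂.ham (F x) = S₁.ham x)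
    (hham' : ∀ y ∈ S₂.level, S₁.ham (G y) = S₂.ham y)
    (hFflow : ∀ t, ∀ x ∈ S₁.level, ∀ y, S₁.Flow t x y →
      ∃ y', S₂.orbit (F y) y' ∧ S₂.Flow t (F x) y')
    (hGflow : ∀ t, ∀ x ∈ S₂.level, ∀ y, S₂.Flow t x y →
      ∃ y', S₁.orbit (G y) y' ∧ S₁.Flow t (G x) y') : S₁.Equivalent S₂ := by
  let f : S₁.level → S₂.level := fun x => ⟨F x, hF.mapsTo x.2⟩
  let g : S₂.level → S₁.level := fun y => ⟨G y, hG.mapsTo y.2⟩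
  have hfc : Continuous f := (continuousOn_iff_continuous_domRestrict.1 hF.continuousOn).subtype_mk _
  have hgc : Continuous g := (continuousOn_iff_continuous_domRestrict.1 hG.continuousOn).subtype_mk _
  have hfe : ∀ x y : S₁.level, S₁.orbit.comap Subtype.val x y →
      S₂.orbit.comap Subtype.val (f x) (f y) := fun x y h => hF.equivariant x x.2 y y.2 h
  have hge : ∀ x y : S₂.level, S₂.orbit.comap Subtype.val x y →
      S₁.orbit.comap Subtype.val (g x) (g y) := fun x y h => hG.equivariant x x.2 y y.2 h
  let Φ : S₁.ReducedSpace ≃ₜ S₂.ReducedSpace :=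
    { toFun := Quotient.map f hfe
      invFun := Quotient.map g hge
      left_inv := by
        rintro ⟨x⟩
        exact Quotient.sound (hGF x x.2)
      right_inv := by
        rintro ⟨y⟩
        exact Quotient.sound (hFG y y.2)
      continuous_toFun := hfc.quotient_map' hfe
      continuous_invFun := hgc.quotient_map' hge }
  have hΦ : ∀ x, Φ (S₁.proj x) = S₂.proj (f x) := fun _ => rfl
  have hΦs : ∀ y, Φ.symm (S₂.proj y) = S₁.proj (g y) := fun _ => rfl
  refine ⟨F, G, hF, hG, hGF, hFG, hham, hham', Φ, ?_, ?_, fun t a b => ⟨?_, ?_⟩⟩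
  · intro x y h
    rw [hΦ]; congr 1; exact Subtype.ext h
  · intro y x h
    rw [hΦs]; congr 1; exact Subtype.ext h
  · rintro ⟨x, y, rfl, rfl, h⟩
    obtain ⟨y', ho, hy'⟩ := hFflow t x x.2 y h
    refine ⟨f x, ⟨y', hS₂.invariant t _ _ (hF.mapsTo x.2) hy'⟩, (hΦ x).symm, ?_, hy'⟩
    rw [hΦ]
    exact Quotient.sound (S₂.orbit.symm ho)
  -- Solutions of the second system are carried back by `G`; its endpoints lie over `a` and `b`
  -- because `G` induces `Φ.symm`.
  · rintro ⟨x, y, hx, hy, h⟩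
    obtain ⟨y', ho, hy'⟩ := hGflow t x x.2 y h
    refine ⟨g x, ⟨y', hS₁.invariant t _ _ (hG.mapsTo x.2) hy'⟩, ?_, ?_, hy'⟩
    · rw [← hΦs, hx, Φ.symm_apply_apply]
    · rw [← Φ.symm_apply_apply b, ← hy, hΦs]
      exact Quotient.sound (S₁.orbit.symm ho)

end ReductionData

/-! ### The Hermitian pairing -/

theorem pairing_add_left (P P' Q : C3) : pairing (P + P') Q = pairing P Q + pairing P' Q := by
  simp [pairing, add_mul, Finset.sum_add_distrib]

theorem pairing_add_right (P Q Q' : C3) : pairing P (Q + Q') = pairing P Q + pairing P Q' := by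
  simp [pairing, mul_add, Finset.sum_add_distrib]

theorem pairing_smul_left (a : ℝ) (P Q : C3) : pairing (a • P) Q = a * pairing P Q := by
  simp [pairing, Finset.mul_sum, mul_assoc]

theorem pairing_smul_right (a : ℝ) (P Q : C3) : pairing P (a • Q) = a * pairing P Q := by
  simp only [pairing, Finset.mul_sum, Pi.smul_apply, Complex.real_smul]
  exact Finset.sum_congr rfl fun _ _ => by ring

theorem pairing_massDual_re_comm (m : Fin 3 → ℝ) (X Y : C3) :
    (pairing (massDual m X) Y).re = (pairing (massDual m Y) X).re := by
  simp only [pairing, massDual, Complex.re_sum]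
  refine Finset.sum_congr rfl fun j _ => ?_
  simp; ring

theorem angMom_eq (Q P : C3) : angMom Q P = -(pairing P Q).im := by
  simp only [pairing, angMom, Complex.im_sum, ← Finset.sum_neg_distrib]
  refine Finset.sum_congr rfl fun j _ => ?_
  simp; ring

/-- The level splits into the momentum of real dilations (real part) and that of rotations
(imaginary part). Only the first has no counterpart in the relative variables. -/
theorem pairing_eq_iff (μ : ℝ) (Y X : C3) :
    pairing Y X = -(Complex.I * μ) ↔ (pairing Y X).re = 0 ∧ (pairing Y X).im = -μ := by
  rw [Complex.ext_iff]; simp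

theorem _root_.HasDerivAt.pairing {P Q : ℝ → C3} {P' Q' : C3} {s : ℝ} (hP : HasDerivAt P P' s)
    (hQ : HasDerivAt Q Q' s) :
    HasDerivAt (fun t => PlanarThreeBody.pairing (P t) (Q t))
      (PlanarThreeBody.pairing P' (Q s) + PlanarThreeBody.pairing (P s) Q') s := by
  simp only [PlanarThreeBody.pairing, ← Finset.sum_add_distrib]
  refine HasDerivAt.fun_sum fun j _ => ?_
  have h1 := Complex.conjCLE.hasFDerivAt.comp_hasDerivAt s (hasDerivAt_pi.1 hP j)
  exact h1.mul (hasDerivAt_pi.1 hQ j)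

theorem hasDerivAt_re {f : ℝ → ℂ} {f' : ℂ} {s : ℝ} (h : HasDerivAt f f' s) :
    HasDerivAt (fun t => (f t).re) f'.re s :=
  Complex.reCLM.hasFDerivAt.comp_hasDerivAt s h

theorem hasDerivAt_im {f : ℝ → ℂ} {f' : ℂ} {s : ℝ} (h : HasDerivAt f f' s) :
    HasDerivAt (fun t => (f t).im) f'.im s :=
  Complex.imCLM.hasFDerivAt.comp_hasDerivAt s h

theorem hasDerivAt_fst {E E' : Type*} [NormedAddCommGroup E] [NormedSpace ℝ E]
    [NormedAddCommGroup E'] [NormedSpace ℝ E'] {f : ℝ → E × E'} {f' : E × E'} {s : ℝ}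
    (h : HasDerivAt f f' s) : HasDerivAt (fun t => (f t).1) f'.1 s :=
  (ContinuousLinearMap.fst ℝ E E').hasFDerivAt.comp_hasDerivAt s h

theorem hasDerivAt_snd {E E' : Type*} [NormedAddCommGroup E] [NormedSpace ℝ E]
    [NormedAddCommGroup E'] [NormedSpace ℝ E'] {f : ℝ → E × E'} {f' : E × E'} {s : ℝ}
    (h : HasDerivAt f f' s) : HasDerivAt (fun t => (f t).2) f'.2 s :=
  (ContinuousLinearMap.snd ℝ E E').hasFDerivAt.comp_hasDerivAt s h

theorem contDiff_pairing_re {k : WithTop ℕ∞} :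
    ContDiff ℝ k fun x : C3 × C3 => (pairing x.1 x.2).re := by
  have h : ContDiff ℝ k fun x : C3 × C3 => pairing x.1 x.2 := by
    unfold pairing
    refine ContDiff.sum fun j _ => ContDiff.mul ?_ (by fun_prop)
    exact Complex.conjCLE.contDiff.comp (f := fun x : C3 × C3 => x.1 j) (by fun_prop)
  exact Complex.reCLM.contDiff.comp h

theorem _root_.ContDiffAt.pairing_re {E : Type*} [NormedAddCommGroup E] [NormedSpace ℝ E]
    {k : WithTop ℕ∞} {P Q : E → C3} {x : E} (hP : ContDiffAt ℝ k P x) (hQ : ContDiffAt ℝ k Q x) :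
    ContDiffAt ℝ k (fun y => (PlanarThreeBody.pairing (P y) (Q y)).re) x :=
  contDiff_pairing_re.contDiffAt.comp x (hP.prodMk hQ)

/-! ### The mass metric -/

section Mass

variable {m : Fin 3 → ℝ}

theorem totalMass_pos (hm : ∀ i, 0 < m i) : 0 < totalMass m :=
  Finset.sum_pos (fun i _ => hm i) Finset.univ_nonempty

theorem pairMass_pos (hm : ∀ i, 0 < m i) (j : Fin 3) : 0 < pairMass m j := by
  fin_cases j <;> simp [pairMass, hm]

/-- The duality `X ↦ X*` as a continuous linear map. -/
def massDualL (m : Fin 3 → ℝ) : C3 →L[ℝ] C3 :=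
  LinearMap.toContinuousLinearMap
    { toFun := massDual m
      map_add' := fun X Y => by ext j; simp [massDual, mul_add]
      map_smul' := fun a X => by ext j; simp [massDual]; ring }

theorem massDualL_apply (X : C3) : massDualL m X = massDual m X := rfl

theorem massDual_smul (a : ℝ) (X : C3) : massDual m (a • X) = a • massDual m X :=
  (massDualL m).map_smul a X

theorem pairing_massDual_self (X : C3) :
    (pairing (massDual m X) X).re = (∑ j, pairMass m j * ‖X j‖ ^ 2) / totalMass m := by
  simp only [pairing, massDual, Complex.re_sum, Finset.sum_div]
  refine Finset.sum_congr rfl fun j _ => ?_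
  rw [← Complex.normSq_eq_norm_sq, Complex.normSq_apply]
  simp; ring

theorem massNorm_eq_sqrt (X : C3) : massNorm m X = √(pairing (massDual m X) X).re := by
  rw [pairing_massDual_self]; rfl

theorem pairing_massDual_pos (hm : ∀ i, 0 < m i) {X : C3} (hX : ∀ j, X j ≠ 0) :
    0 < (pairing (massDual m X) X).re := by
  rw [pairing_massDual_self]
  refine div_pos (Finset.sum_pos (fun j _ => ?_) Finset.univ_nonempty) (totalMass_pos hm)
  exact mul_pos (pairMass_pos hm j) (pow_pos (norm_pos_iff.2 (hX j)) 2)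

theorem massNorm_pos (hm : ∀ i, 0 < m i) {X : C3} (hX : ∀ j, X j ≠ 0) : 0 < massNorm m X := by
  rw [massNorm_eq_sqrt]; exact Real.sqrt_pos.2 (pairing_massDual_pos hm hX)

theorem massNorm_sq (hm : ∀ i, 0 < m i) (X : C3) :
    massNorm m X ^ 2 = (pairing (massDual m X) X).re := by
  rw [massNorm_eq_sqrt, Real.sq_sqrt]
  rw [pairing_massDual_self]
  exact div_nonneg (Finset.sum_nonneg fun j _ => mul_nonneg (pairMass_pos hm j).le (sq_nonneg _))
    (totalMass_pos hm).le

theorem massNorm_mul (k : ℂ) (X : C3) : massNorm m (fun j => k * X j) = ‖k‖ * massNorm m X := by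
  unfold massNorm
  rw [← Real.sqrt_sq (norm_nonneg k), ← Real.sqrt_mul (sq_nonneg _)]
  congr 1
  simp only [norm_mul, mul_pow]
  rw [mul_div_assoc', Finset.mul_sum]
  congr 1
  exact Finset.sum_congr rfl fun j _ => by ring

theorem massNorm_smul {a : ℝ} (ha : 0 ≤ a) (X : C3) : massNorm m (a • X) = a * massNorm m X := by
  have := massNorm_mul (m := m) a X
  rw [Complex.norm_real, Real.norm_of_nonneg ha] at this
  rw [← this]; rfl

theorem hasDerivAt_massNorm (hm : ∀ i, 0 < m i) {X : ℝ → C3} {X' : C3} {s : ℝ}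
    (hX : ∀ j, X s j ≠ 0) (h : HasDerivAt X X' s) :
    HasDerivAt (fun t => massNorm m (X t))
      ((pairing (massDual m (X s)) X').re / massNorm m (X s)) s := by
  have h1 := hasDerivAt_re (((massDualL m).hasFDerivAt.comp_hasDerivAt s h).pairing h)
  have h2 := h1.sqrt (pairing_massDual_pos hm hX).ne'
  have h3 : (fun t => massNorm m (X t)) = fun t => √(pairing (massDual m (X t)) (X t)).re :=
    funext fun t => massNorm_eq_sqrt _
  rw [h3]
  refine h2.congr_deriv ?_
  rw [Complex.add_re, massDualL_apply, pairing_massDual_re_comm, massNorm_eq_sqrt]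
  simp only [Function.comp, massDualL_apply]
  field_simp
  ring

theorem contDiffAt_massNorm (hm : ∀ i, 0 < m i) {k : WithTop ℕ∞} {X : C3} (hX : ∀ j, X j ≠ 0) :
    ContDiffAt ℝ k (massNorm m) X := by
  have h3 : massNorm m = fun X => √(pairing (massDualL m X) X).re :=
    funext fun t => massNorm_eq_sqrt _
  rw [h3]
  exact ((massDualL m).contDiff.contDiffAt.pairing_re contDiffAt_id).sqrt
    (pairing_massDual_pos hm hX).ne'

end Mass

/-! ### The maps between spherical and relative variables -/

section Maps

variable {m : Fin 3 → ℝ}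

/-- The derivative of `sphToRel`. -/
def sphToRelDeriv (m : Fin 3 → ℝ) (z w : ESph) : E6 :=
  ((w.1.1 / massNorm m z.2.1 -
      z.1.1 * ((pairing (massDual m z.2.1) w.2.1).re / massNorm m z.2.1) / massNorm m z.2.1 ^ 2) •
        z.2.1 + (z.1.1 / massNorm m z.2.1) • w.2.1,
    (w.1.2 / massNorm m z.2.1 -
      z.1.2 * ((pairing (massDual m z.2.1) w.2.1).re / massNorm m z.2.1) / massNorm m z.2.1 ^ 2) •
        massDual m z.2.1 + (z.1.2 / massNorm m z.2.1) • massDual m w.2.1 +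
    (((pairing (massDual m z.2.1) w.2.1).re / massNorm m z.2.1) / z.1.1 -
      massNorm m z.2.1 * w.1.1 / z.1.1 ^ 2) • z.2.2 + (massNorm m z.2.1 / z.1.1) • w.2.2)

/-- The differential of `Re ⟨Y, X⟩`. -/
def dilationDeriv (z w : ESph) : ℝ := (pairing w.2.2 z.2.1).re + (pairing z.2.2 w.2.1).re

/-- The differential of `log (r / |X|)`. -/
def logRatioDeriv (m : Fin 3 → ℝ) (z w : ESph) : ℝ :=
  w.1.1 / z.1.1 - (pairing (massDual m z.2.1) w.2.1).re / massNorm m z.2.1 ^ 2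

/-- Collision-free points of `T*ℝ⁺ × T*ℂ³`. -/
def sphPhase : Set ESph := {z | 0 < z.1.1 ∧ ∀ j, z.2.1 j ≠ 0}

/-- Collision-free points of `T*ℂ³`. -/
def relPhase : Set E6 := {x | ∀ j, x.1 j ≠ 0}

theorem isOpen_sphPhase : IsOpen sphPhase := by
  refine (isOpen_lt (f := fun _ : ESph => (0 : ℝ)) (g := fun z => z.1.1) continuous_const
    (by fun_prop)).inter ?_
  have : {z : ESph | ∀ j, z.2.1 j ≠ 0} = ⋂ j, {z | z.2.1 j ≠ 0} := by ext; simp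
  rw [show (fun z : ESph => ∀ j, z.2.1 j ≠ 0) = {z : ESph | ∀ j, z.2.1 j ≠ 0} from rfl, this]
  exact isOpen_iInter_of_finite fun j => isOpen_ne_fun (by fun_prop) continuous_const

theorem isOpen_relPhase : IsOpen relPhase := by
  have : relPhase = ⋂ j, {z | z.1 j ≠ 0} := by ext; simp [relPhase]
  rw [this]
  exact isOpen_iInter_of_finite fun j => isOpen_ne_fun (by fun_prop) continuous_const

theorem contDiffAt_sphToRel (hm : ∀ i, 0 < m i) {k : WithTop ℕ∞} {z : ESph} (hz : z ∈ sphPhase) :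
    ContDiffAt ℝ k (sphToRel m) z := by
  have hn : ContDiffAt ℝ k (fun z : ESph => massNorm m z.2.1) z :=
    (contDiffAt_massNorm hm hz.2).comp z (f := fun z : ESph => z.2.1) (by fun_prop)
  have hn0 := (massNorm_pos hm hz.2).ne'
  have hr0 : z.1.1 ≠ 0 := hz.1.ne'
  have hd : ContDiffAt ℝ k (fun z : ESph => massDual m z.2.1) z :=
    (massDualL m).contDiff.contDiffAt.comp z (f := fun z : ESph => z.2.1) (by fun_prop)
  have hr : ContDiffAt ℝ k (fun z : ESph => z.1.1) z := by fun_prop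
  have hp : ContDiffAt ℝ k (fun z : ESph => z.1.2) z := by fun_prop
  have hX : ContDiffAt ℝ k (fun z : ESph => z.2.1) z := by fun_prop
  have hY : ContDiffAt ℝ k (fun z : ESph => z.2.2) z := by fun_prop
  exact ((hr.div hn hn0).smul hX).prodMk (((hp.div hn hn0).smul hd).add ((hn.div hr hr0).smul hY))

/-- Since differentiability is already known, it is enough to differentiate along the line z + t w
and to use uniqueness of derivatives. -/
theorem fderiv_sphToRel (hm : ∀ i, 0 < m i) {z : ESph} (hz : z ∈ sphPhase) (w : ESph) :
    fderiv ℝ (sphToRel m) z w = sphToRelDeriv m z w := by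
  have hF := ((contDiffAt_sphToRel hm (k := 1) hz).differentiableAt (by simp)).hasFDerivAt
  have hn0 := (massNorm_pos hm hz.2).ne'
  have hr0 : z.1.1 ≠ 0 := hz.1.ne'
  have hc : HasDerivAt (fun t : ℝ => z + t • w) w 0 := by
    simpa using ((hasDerivAt_id (0 : ℝ)).smul_const w).const_add z
  have h0 : z + (0 : ℝ) • w = z := by simp
  have hF' : HasFDerivAt (sphToRel m) (fderiv ℝ (sphToRel m) z) (z + (0 : ℝ) • w) := by
    rwa [h0]
  have h1 := hF'.comp_hasDerivAt (0 : ℝ) hc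
  have hr : HasDerivAt (fun t : ℝ => (z + t • w).1.1) w.1.1 0 := hasDerivAt_fst (hasDerivAt_fst hc)
  have hp : HasDerivAt (fun t : ℝ => (z + t • w).1.2) w.1.2 0 := hasDerivAt_snd (hasDerivAt_fst hc)
  have hX : HasDerivAt (fun t : ℝ => (z + t • w).2.1) w.2.1 0 := hasDerivAt_fst (hasDerivAt_snd hc)
  have hY : HasDerivAt (fun t : ℝ => (z + t • w).2.2) w.2.2 0 := hasDerivAt_snd (hasDerivAt_snd hc)
  have hn := hasDerivAt_massNorm hm (by rw [h0]; exact hz.2) hX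
  have hd := (massDualL m).hasFDerivAt.comp_hasDerivAt (0 : ℝ) hX
  have h2 := ((hr.div hn (by rwa [h0])).smul hX).prodMk
    (((hp.div hn (by rwa [h0])).smul hd).add ((hn.div hr (by rwa [h0])).smul hY))
  refine (h1.unique h2).trans ?_
  simp only [h0, Function.comp_def, massDualL_apply, sphToRelDeriv, Pi.div_apply]
  refine Prod.ext ?_ ?_ <;> dsimp only
  · rw [add_comm]; congr 2; field_simp
  · have e1 : (w.1.2 * massNorm m z.2.1 -
        z.1.2 * ((pairing (massDual m z.2.1) w.2.1).re / massNorm m z.2.1)) /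
        massNorm m z.2.1 ^ 2 = w.1.2 / massNorm m z.2.1 -
      z.1.2 * ((pairing (massDual m z.2.1) w.2.1).re / massNorm m z.2.1) / massNorm m z.2.1 ^ 2 := by
      field_simp
    have e2 : (((pairing (massDual m z.2.1) w.2.1).re / massNorm m z.2.1) * z.1.1 -
        massNorm m z.2.1 * w.1.1) / z.1.1 ^ 2 =
        ((pairing (massDual m z.2.1) w.2.1).re / massNorm m z.2.1) / z.1.1 -
      massNorm m z.2.1 * w.1.1 / z.1.1 ^ 2 := by field_simp
    rw [e1, e2]; abel

/-- The pull-back of the symplectic form by `sphToRel` is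
`ω + d log (r / |X|) ∧ d Re ⟨Y, X⟩`. -/
theorem canonicalForm_fderiv_sphToRel (hm : ∀ i, 0 < m i) {z : ESph} (hz : z ∈ sphPhase)
    (v w : ESph) :
    canonicalForm (fderiv ℝ (sphToRel m) z v) (fderiv ℝ (sphToRel m) z w) =
      canonicalFormSph v w + logRatioDeriv m z v * dilationDeriv z w -
        dilationDeriv z v * logRatioDeriv m z w := by
  rw [fderiv_sphToRel hm hz, fderiv_sphToRel hm hz]
  have hn0 := (massNorm_pos hm hz.2).ne'
  have hr0 : z.1.1 ≠ 0 := hz.1.ne'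
  have hsq := massNorm_sq hm z.2.1
  -- Symmetry of the mass metric identifies the pairings that occur in both orders, and Re⟨X*,X⟩
  -- becomes |X|². What remains is a rational identity in r, |X| and a few real pairings.
  simp only [canonicalFormSph, canonicalForm, sphToRelDeriv, logRatioDeriv, dilationDeriv,
    pairing_add_left, pairing_add_right, pairing_smul_left, pairing_smul_right, Complex.add_re,
    Complex.re_ofReal_mul, ← hsq, pairing_massDual_re_comm m v.2.1 z.2.1,
    pairing_massDual_re_comm m w.2.1 z.2.1, pairing_massDual_re_comm m w.2.1 v.2.1]
  field_simp
  ring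

/-- ⟨X*,X⟩ = |X|² is real and the factors |X|/r and r/|X| cancel. So the imaginary part, the angular
momentum, is unchanged, and Re⟨P,Q⟩ = r p_r exactly where Re⟨Y,X⟩ = 0. -/
theorem pairing_sphToRel (hm : ∀ i, 0 < m i) {z : ESph} (hz : z ∈ sphPhase) :
    pairing (sphToRel m z).2 (sphToRel m z).1 = (z.1.1 * z.1.2 : ℝ) + pairing z.2.2 z.2.1 := by
  have hn0 := (massNorm_pos hm hz.2).ne'
  have hr0 : z.1.1 ≠ 0 := hz.1.ne'
  have hsq := massNorm_sq hm z.2.1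
  have him : (pairing (massDual m z.2.1) z.2.1).im = 0 := by
    simp only [pairing, massDual, Complex.im_sum]
    refine Finset.sum_eq_zero fun j _ => ?_
    simp; ring
  have h : pairing (massDual m z.2.1) z.2.1 = (massNorm m z.2.1 ^ 2 : ℝ) :=
    Complex.ext (by rw [Complex.ofReal_re, hsq]) (by rw [him, Complex.ofReal_im])
  simp only [sphToRel, pairing_add_left, pairing_smul_left, pairing_smul_right, h]
  push_cast
  have hn1 : (massNorm m z.2.1 : ℂ) ≠ 0 := by exact_mod_cast hn0
  have hr1 : (z.1.1 : ℂ) ≠ 0 := by exact_mod_cast hr0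
  field_simp

/-- The section `(Q, P) ↦ (|Q|, Re ⟨P, Q⟩ / |Q|, Q, P - Re ⟨P, Q⟩ / |Q|² Q*)` of `sphToRel`. -/
def relToSph (m : Fin 3 → ℝ) (y : E6) : ESph :=
  ((massNorm m y.1, (pairing y.2 y.1).re / massNorm m y.1),
    (y.1, y.2 - ((pairing y.2 y.1).re / massNorm m y.1 ^ 2) • massDual m y.1))

/-- Real scaling of the variables `(X, Y)`. -/
def realScaling (a : ℝ) (z : ESph) : ESph := (z.1, (a • z.2.1, a⁻¹ • z.2.2))

/-- The section of `sphToRel` with `|X| = 1`. -/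
def relToSphUnit (m : Fin 3 → ℝ) (y : E6) : ESph :=
  realScaling (massNorm m y.1)⁻¹ (relToSph m y)

theorem contDiffAt_relToSph (hm : ∀ i, 0 < m i) {k : WithTop ℕ∞} {y : E6} (hy : y ∈ relPhase) :
    ContDiffAt ℝ k (relToSph m) y := by
  have hn : ContDiffAt ℝ k (fun z : E6 => massNorm m z.1) y :=
    (contDiffAt_massNorm hm hy).comp y (f := fun z : E6 => z.1) (by fun_prop)
  have hn0 := (massNorm_pos hm hy).ne'
  have hd : ContDiffAt ℝ k (fun z : E6 => massDual m z.1) y :=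
    (massDualL m).contDiff.contDiffAt.comp y (f := fun z : E6 => z.1) (by fun_prop)
  have hX : ContDiffAt ℝ k (fun z : E6 => z.1) y := by fun_prop
  have hY : ContDiffAt ℝ k (fun z : E6 => z.2) y := by fun_prop
  have hp := hY.pairing_re hX
  exact (hn.prodMk (hp.div hn hn0)).prodMk
    (hX.prodMk (hY.sub ((hp.div (hn.pow 2) (pow_ne_zero 2 hn0)).smul hd)))

theorem contDiffAt_relToSphUnit (hm : ∀ i, 0 < m i) {k : WithTop ℕ∞} {y : E6}
    (hy : y ∈ relPhase) : ContDiffAt ℝ k (relToSphUnit m) y := by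
  have hn : ContDiffAt ℝ k (fun z : E6 => massNorm m z.1) y :=
    (contDiffAt_massNorm hm hy).comp y (f := fun z : E6 => z.1) (by fun_prop)
  have hn0 := (massNorm_pos hm hy).ne'
  have hG := contDiffAt_relToSph hm (k := k) hy
  have hni := hn.inv hn0
  exact hG.fst.prodMk
    ((hni.smul hG.snd.fst).prodMk ((hni.inv (inv_ne_zero hn0)).smul hG.snd.snd))

/-- This freedom allows a section to be renormalized at will: |X| = r in `relToSph`, |X| = 1 in
`relToSphUnit`, or passing through a prescribed point. -/
theorem sphToRel_realScaling {a : ℝ} (ha : 0 < a) (z : ESph) :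
    sphToRel m (realScaling a z) = sphToRel m z := by
  simp only [sphToRel, realScaling, massNorm_smul ha.le, massDual_smul, smul_smul]
  refine Prod.ext ?_ ?_ <;> dsimp only
  · congr 1
    field_simp
  · congr 2 <;> field_simp

theorem sphToRel_relToSph (hm : ∀ i, 0 < m i) {y : E6} (hy : y ∈ relPhase) :
    sphToRel m (relToSph m y) = y := by
  have hn0 := (massNorm_pos hm hy).ne'
  simp only [sphToRel, relToSph, div_self hn0, one_smul, div_div, ← sq]
  refine Prod.ext rfl ?_
  simp

theorem sphToRel_relToSphUnit (hm : ∀ i, 0 < m i) {y : E6} (hy : y ∈ relPhase) :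
    sphToRel m (relToSphUnit m y) = y := by
  rw [relToSphUnit, sphToRel_realScaling (inv_pos.2 (massNorm_pos hm hy)), sphToRel_relToSph hm hy]

theorem massNorm_relToSphUnit (hm : ∀ i, 0 < m i) {y : E6} (hy : y ∈ relPhase) :
    massNorm m (relToSphUnit m y).2.1 = 1 := by
  have hn0 := massNorm_pos hm hy
  simp only [relToSphUnit, relToSph, realScaling]
  rw [massNorm_smul (inv_nonneg.2 hn0.le), inv_mul_cancel₀ hn0.ne']

theorem realScaling_mem {a : ℝ} (ha : a ≠ 0) {z : ESph} (hz : z ∈ sphPhase) :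
    realScaling a z ∈ sphPhase :=
  ⟨hz.1, fun j => by simpa [realScaling, ha] using hz.2 j⟩

theorem relToSph_mem (hm : ∀ i, 0 < m i) {y : E6} (hy : y ∈ relPhase) :
    relToSph m y ∈ sphPhase := ⟨massNorm_pos hm hy, hy⟩

theorem relToSphUnit_mem (hm : ∀ i, 0 < m i) {y : E6} (hy : y ∈ relPhase) :
    relToSphUnit m y ∈ sphPhase :=
  realScaling_mem (inv_ne_zero (massNorm_pos hm hy).ne') (relToSph_mem hm hy)

theorem sphToRel_mem (hm : ∀ i, 0 < m i) {z : ESph} (hz : z ∈ sphPhase) :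
    sphToRel m z ∈ relPhase := fun j => by
  simp [sphToRel, hz.1.ne', (massNorm_pos hm hz.2).ne', hz.2 j]

theorem pairing_realScaling {a : ℝ} (ha : a ≠ 0) (z : ESph) :
    pairing (realScaling a z).2.2 (realScaling a z).2.1 = pairing z.2.2 z.2.1 := by
  have : (a : ℂ) ≠ 0 := by exact_mod_cast ha
  simp only [realScaling, pairing_smul_left, pairing_smul_right]
  push_cast; field_simp

/-- Apply `pairing_sphToRel` on the section: r p_r already accounts for all of Re⟨P,Q⟩, so nothing
is left for Re⟨Y,X⟩. -/
theorem pairing_relToSph (hm : ∀ i, 0 < m i) {y : E6} (hy : y ∈ relPhase) :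
    (pairing (relToSph m y).2.2 (relToSph m y).2.1).re = 0 ∧
      (pairing (relToSph m y).2.2 (relToSph m y).2.1).im = (pairing y.2 y.1).im := by
  have h := pairing_sphToRel hm (relToSph_mem hm hy)
  rw [sphToRel_relToSph hm hy] at h
  have hn0 := (massNorm_pos hm hy).ne'
  rw [Complex.ext_iff] at h
  simp only [Complex.add_re, Complex.ofReal_re, Complex.add_im, Complex.ofReal_im] at h
  refine ⟨?_, by linarith [h.2]⟩
  have : (relToSph m y).1.1 * (relToSph m y).1.2 = (pairing y.2 y.1).re := by
    simp only [relToSph]; field_simp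
  linarith [h.1]

theorem pairing_relToSphUnit (hm : ∀ i, 0 < m i) {y : E6} (hy : y ∈ relPhase) :
    (pairing (relToSphUnit m y).2.2 (relToSphUnit m y).2.1).re = 0 ∧
      (pairing (relToSphUnit m y).2.2 (relToSphUnit m y).2.1).im = (pairing y.2 y.1).im := by
  rw [relToSphUnit, pairing_realScaling (inv_ne_zero (massNorm_pos hm hy).ne')]
  exact pairing_relToSph hm hy

/-- On Re⟨Y,X⟩ = 0 one has |Q| = r and Re⟨P,Q⟩ = r p_r. Subtracting the dilation part of P therefore
removes exactly the X* term and leaves a multiple of Y. -/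
theorem relToSph_sphToRel (hm : ∀ i, 0 < m i) {z : ESph} (hz : z ∈ sphPhase)
    (h0 : (pairing z.2.2 z.2.1).re = 0) :
    relToSph m (sphToRel m z) = realScaling (z.1.1 / massNorm m z.2.1) z := by
  have hn := massNorm_pos hm hz.2
  have hr := hz.1
  have hp : (pairing (sphToRel m z).2 (sphToRel m z).1).re = z.1.1 * z.1.2 := by
    rw [pairing_sphToRel hm hz, Complex.add_re, h0, Complex.ofReal_re, add_zero]
  have hN : massNorm m (sphToRel m z).1 = z.1.1 := by
    simp only [sphToRel, massNorm_smul (div_pos hr hn).le]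
    field_simp
  have hN' := hr.ne'
  have hn' := hn.ne'
  simp only [relToSph, hp, hN, realScaling]
  refine Prod.ext (Prod.ext rfl ?_) (Prod.ext rfl ?_) <;> dsimp only
  · field_simp
  · simp only [sphToRel, massDual_smul, smul_smul, inv_div]
    have : z.1.1 * z.1.2 / z.1.1 ^ 2 * (z.1.1 / massNorm m z.2.1) = z.1.2 / massNorm m z.2.1 := by
      field_simp
    rw [this, add_sub_cancel_left]

theorem realScaling_realScaling (a b : ℝ) (z : ESph) :
    realScaling a (realScaling b z) = realScaling (a * b) z := by
  simp [realScaling, smul_smul, mul_comm]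

theorem realScaling_one (z : ESph) : realScaling 1 z = z := by
  simp [realScaling]

/-- A differentiable local right inverse of `sphToRel` at `y` on which `Re ⟨Y, X⟩` vanishes. -/
structure IsLocalSection (m : Fin 3 → ℝ) (H : E6 → ESph) (y : E6) : Prop where
  mem : H y ∈ sphPhase
  differentiableAt : DifferentiableAt ℝ H y
  right_inv : ∀ y' ∈ relPhase, sphToRel m (H y') = y'
  dilation : ∀ y' ∈ relPhase, (pairing (H y').2.2 (H y').2.1).re = 0

theorem isLocalSection_relToSph (hm : ∀ i, 0 < m i) {y : E6} (hy : y ∈ relPhase) :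
    IsLocalSection m (relToSph m) y :=
  ⟨relToSph_mem hm hy, (contDiffAt_relToSph hm (k := 1) hy).differentiableAt (by simp),
    fun _ h => sphToRel_relToSph hm h, fun _ h => (pairing_relToSph hm h).1⟩

theorem isLocalSection_relToSphUnit (hm : ∀ i, 0 < m i) {y : E6} (hy : y ∈ relPhase) :
    IsLocalSection m (relToSphUnit m) y :=
  ⟨relToSphUnit_mem hm hy, (contDiffAt_relToSphUnit hm (k := 1) hy).differentiableAt (by simp),
    fun _ h => sphToRel_relToSphUnit hm h, fun _ h => (pairing_relToSphUnit hm h).1⟩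

theorem contDiff_realScaling (a : ℝ) {k : WithTop ℕ∞} : ContDiff ℝ k (realScaling a) := by
  unfold realScaling; fun_prop

theorem isLocalSection_realScaling {a : ℝ} (ha : 0 < a) {H : E6 → ESph} {y : E6}
    (h : IsLocalSection m H y) : IsLocalSection m (fun y => realScaling a (H y)) y :=
  ⟨realScaling_mem ha.ne' h.mem,
    ((contDiff_realScaling a (k := 1)).differentiable (by simp) _).comp y h.differentiableAt,
    fun y' hy' => by rw [sphToRel_realScaling ha, h.right_inv y' hy'],
    fun y' hy' => by rw [pairing_realScaling ha.ne', h.dilation y' hy']⟩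

theorem hasDerivAt_line {E : Type*} [NormedAddCommGroup E] [NormedSpace ℝ E] (y v : E) :
    HasDerivAt (fun t : ℝ => y + t • v) v 0 := by
  simpa using ((hasDerivAt_id (0 : ℝ)).smul_const v).const_add y

/-- The derivative of a map along a straight line. -/
theorem hasDerivAt_comp_line {E E' : Type*} [NormedAddCommGroup E] [NormedSpace ℝ E]
    [NormedAddCommGroup E'] [NormedSpace ℝ E'] {f : E → E'} {y : E}
    (hf : DifferentiableAt ℝ f y) (v : E) :
    HasDerivAt (fun t : ℝ => f (y + t • v)) (fderiv ℝ f y v) 0 := by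
  have h0 : y + (0 : ℝ) • v = y := by simp
  have : HasFDerivAt f (fderiv ℝ f y) (y + (0 : ℝ) • v) := by rw [h0]; exact hf.hasFDerivAt
  exact this.comp_hasDerivAt (0 : ℝ) (hasDerivAt_line y v)

theorem eventually_line_mem {E : Type*} [NormedAddCommGroup E] [NormedSpace ℝ E] {U : Set E}
    (hU : IsOpen U) {y : E} (hy : y ∈ U) (v : E) : ∀ᶠ t : ℝ in nhds 0, y + t • v ∈ U :=
  (hasDerivAt_line y v).continuousAt.eventually_mem (hU.mem_nhds (by simpa using hy))

theorem IsLocalSection.fderiv_right_inv (hm : ∀ i, 0 < m i) {H : E6 → ESph} {y : E6}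
    (hy : y ∈ relPhase) (h : IsLocalSection m H y) (v : E6) :
    fderiv ℝ (sphToRel m) (H y) (fderiv ℝ H y v) = v := by
  have hF := (contDiffAt_sphToRel hm (k := 1) h.mem).differentiableAt (by simp)
  have h1 := (hF.hasFDerivAt.comp y h.differentiableAt.hasFDerivAt)
  have h2 : HasFDerivAt (sphToRel m ∘ H) (ContinuousLinearMap.id ℝ E6) y :=
    (hasFDerivAt_id y).congr_of_eventuallyEq
      (Filter.eventually_of_mem (isOpen_relPhase.mem_nhds hy) fun y' hy' => h.right_inv y' hy')
  exact congrArg (fun L => L v) (h1.unique h2)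

theorem IsLocalSection.dilationDeriv_eq_zero {H : E6 → ESph} {y : E6}
    (hy : y ∈ relPhase) (h : IsLocalSection m H y) (v : E6) :
    dilationDeriv (H y) (fderiv ℝ H y v) = 0 := by
  have h1 := hasDerivAt_comp_line h.differentiableAt v
  have h2 := hasDerivAt_re ((hasDerivAt_snd (hasDerivAt_snd h1)).pairing (hasDerivAt_fst (hasDerivAt_snd h1)))
  have h3 : HasDerivAt (fun t : ℝ => (pairing (H (y + t • v)).2.2 (H (y + t • v)).2.1).re) 0 0 :=
    (hasDerivAt_const (0 : ℝ) (0 : ℝ)).congr_of_eventuallyEq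
      ((eventually_line_mem isOpen_relPhase hy v).mono fun t ht => h.dilation _ ht)
  have h4 := h2.unique h3
  simpa [dilationDeriv] using h4

/-- Symplectic form on the image of a section. -/
theorem IsLocalSection.canonicalFormSph_fderiv (hm : ∀ i, 0 < m i) {H : E6 → ESph} {y : E6}
    (hy : y ∈ relPhase) (h : IsLocalSection m H y) (v : E6) (w : ESph) :
    canonicalFormSph (fderiv ℝ H y v) w = canonicalForm v (fderiv ℝ (sphToRel m) (H y) w) -
      logRatioDeriv m (H y) (fderiv ℝ H y v) * dilationDeriv (H y) w := by
  have h1 := canonicalForm_fderiv_sphToRel hm h.mem (fderiv ℝ H y v) w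
  -- One of the two correction terms vanishes because the section stays in Re⟨Y,X⟩ = 0. The other
  -- survives, since `w` need not be tangent to that set.
  rw [h.fderiv_right_inv hm hy, h.dilationDeriv_eq_zero hy] at h1
  linarith

theorem IsLocalSection.canonicalFormSph_fderiv_fderiv (hm : ∀ i, 0 < m i) {H : E6 → ESph} {y : E6}
    (hy : y ∈ relPhase) (h : IsLocalSection m H y) (v w : E6) :
    canonicalFormSph (fderiv ℝ H y v) (fderiv ℝ H y w) = canonicalForm v w := by
  rw [h.canonicalFormSph_fderiv hm hy, h.fderiv_right_inv hm hy, h.dilationDeriv_eq_zero hy,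
    mul_zero, sub_zero]

/-- Here r = |X| on the whole section, so log(r/|X|) is constant. This removes the surviving
correction in `IsLocalSection.canonicalFormSph_fderiv`. -/
theorem logRatioDeriv_relToSph (hm : ∀ i, 0 < m i) {y : E6} (hy : y ∈ relPhase) (v : E6) :
    logRatioDeriv m (relToSph m y) (fderiv ℝ (relToSph m) y v) = 0 := by
  have hn0 := (massNorm_pos hm hy).ne'
  have h1 := hasDerivAt_comp_line (isLocalSection_relToSph hm hy).differentiableAt v
  have hX := hasDerivAt_fst (hasDerivAt_snd h1)
  have h2 := hasDerivAt_massNorm hm (by simpa using (relToSph_mem hm hy).2) hX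
  have h3 := (hasDerivAt_fst (hasDerivAt_fst h1)).unique h2
  simp only [zero_smul, add_zero] at h3
  simp only [logRatioDeriv, h3]
  simp only [relToSph] at hn0 ⊢
  field_simp
  simp

/-- Here |X| = 1, so the differential is that of log r. This nonzero value is the one that the
explicit Hamiltonian requires. -/
theorem logRatioDeriv_relToSphUnit (hm : ∀ i, 0 < m i) {y : E6} (hy : y ∈ relPhase) (v : E6) :
    logRatioDeriv m (relToSphUnit m y) (fderiv ℝ (relToSphUnit m) y v) =
      (fderiv ℝ (relToSphUnit m) y v).1.1 / (relToSphUnit m y).1.1 := by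
  have h1 := hasDerivAt_comp_line (isLocalSection_relToSphUnit hm hy).differentiableAt v
  have hX := hasDerivAt_fst (hasDerivAt_snd h1)
  have h2 := hasDerivAt_massNorm hm (by simpa using (relToSphUnit_mem hm hy).2) hX
  have h3 : HasDerivAt (fun t : ℝ => massNorm m (relToSphUnit m (y + t • v)).2.1) 0 0 :=
    (hasDerivAt_const (0 : ℝ) (1 : ℝ)).congr_of_eventuallyEq
      ((eventually_line_mem isOpen_relPhase hy v).mono fun t ht => massNorm_relToSphUnit hm ht)
  have h4 := h2.unique h3
  simp only [zero_smul, add_zero, massNorm_relToSphUnit hm hy, div_one] at h4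
  simp [logRatioDeriv, h4]

end Maps

open ReductionData

variable {m : Fin 3 → ℝ}

/-! ### Smoothness of the Hamiltonians -/

theorem contDiff_kinRel {k : WithTop ℕ∞} : ContDiff ℝ k (kinRel m) := by
  have h : ∀ i j : Fin 3, ContDiff ℝ k fun P : C3 => ‖P i - P j‖ ^ 2 := fun i j =>
    (contDiff_norm_sq ℝ).comp (f := fun P : C3 => P i - P j) (by fun_prop)
  exact (((h 0 1).div_const _).add ((h 2 0).div_const _)).add ((h 1 2).div_const _)

theorem contDiffAt_potRel {k : WithTop ℕ∞} {Q : C3} (hQ : ∀ j, Q j ≠ 0) :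
    ContDiffAt ℝ k (potRel m) Q := by
  unfold potRel
  refine ContDiffAt.sum fun j _ => contDiffAt_const.div ?_ (norm_ne_zero_iff.2 (hQ j))
  exact (contDiffAt_norm ℝ (hQ j)).comp Q (f := fun Q : C3 => Q j) (by fun_prop)

theorem contDiffAt_hamRel {k : WithTop ℕ∞} {y : E6} (hy : y ∈ relPhase) :
    ContDiffAt ℝ k (hamRel m) y :=
  (contDiff_kinRel.contDiffAt.comp y (f := fun y : E6 => y.2) (by fun_prop)).sub
    ((contDiffAt_potRel hy).comp y (f := fun y : E6 => y.1) (by fun_prop))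

theorem contDiffAt_hamSph (hm : ∀ i, 0 < m i) {k : WithTop ℕ∞} {z : ESph} (hz : z ∈ sphPhase) :
    ContDiffAt ℝ k (hamSph m) z :=
  (contDiffAt_hamRel (sphToRel_mem hm hz)).comp z (contDiffAt_sphToRel hm hz)

theorem contDiffAt_hamSphExplicit (hm : ∀ i, 0 < m i) {k : WithTop ℕ∞} {z : ESph}
    (hz : z ∈ sphPhase) : ContDiffAt ℝ k (hamSphExplicit m) z := by
  have hn : ContDiffAt ℝ k (fun z : ESph => massNorm m z.2.1) z :=
    (contDiffAt_massNorm hm hz.2).comp z (f := fun z : ESph => z.2.1) (by fun_prop)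
  have hr : ContDiffAt ℝ k (fun z : ESph => z.1.1) z := by fun_prop
  have hp : ContDiffAt ℝ k (fun z : ESph => z.1.2) z := by fun_prop
  have hK : ContDiffAt ℝ k (fun z : ESph => kinRel m z.2.2) z :=
    contDiff_kinRel.contDiffAt.comp z (f := fun z : ESph => z.2.2) (by fun_prop)
  have hU : ContDiffAt ℝ k (fun z : ESph => potRel m z.2.1) z :=
    (contDiffAt_potRel hz.2).comp z (f := fun z : ESph => z.2.1) (by fun_prop)
  have hr0 : z.1.1 ≠ 0 := hz.1.ne'
  exact (((hp.pow 2).div_const 2).add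
    (((hn.pow 2).div (hr.pow 2) (pow_ne_zero 2 hr0)).mul hK)).sub ((hn.mul hU).div hr hr0)

/-- Collision-free points of `T*ℂ³` for the positions of three bodies. -/
def bodyPhase : Set E6 := {x | ∀ i j, i ≠ j → x.1 i ≠ x.1 j}

theorem contDiffAt_hamBody {k : WithTop ℕ∞} {y : E6} (hy : y ∈ bodyPhase) :
    ContDiffAt ℝ k (hamBody m) y := by
  have h : ∀ i : Fin 3, ContDiffAt ℝ k (fun y : E6 => ‖y.2 i‖ ^ 2) y := fun i =>
    ((contDiff_norm_sq ℝ).comp (f := fun y : E6 => y.2 i) (by fun_prop)).contDiffAt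
  have h' : ∀ i j : Fin 3, i ≠ j → ContDiffAt ℝ k (fun y : E6 => ‖y.1 i - y.1 j‖) y :=
    fun i j hij => (contDiffAt_norm ℝ (sub_ne_zero.2 (hy i j hij))).comp y
      (f := fun y : E6 => y.1 i - y.1 j) (by fun_prop)
  have h0 : ∀ i j : Fin 3, i ≠ j → ‖y.1 i - y.1 j‖ ≠ 0 := fun i j hij =>
    norm_ne_zero_iff.2 (sub_ne_zero.2 (hy i j hij))
  have n01 : (0 : Fin 3) ≠ 1 := by decide
  have n20 : (2 : Fin 3) ≠ 0 := by decide
  have n12 : (1 : Fin 3) ≠ 2 := by decide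
  exact ((((h 0).div_const _).add ((h 1).div_const _)).add ((h 2).div_const _)).sub
    (((contDiffAt_const.div (h' 0 1 n01) (h0 0 1 n01)).add
      (contDiffAt_const.div (h' 2 0 n20) (h0 2 0 n20))).add
      (contDiffAt_const.div (h' 1 2 n12) (h0 1 2 n12)))

/-! ### The group actions -/

/-- Rotation and translation of the positions. -/
def bodyAction (u c : ℂ) (x : E6) : E6 := (fun j => u * x.1 j + c, fun j => u * x.2 j)

/-- Rotation of the relative vectors and translation of the relative momenta. -/
def relAction (u c : ℂ) (x : E6) : E6 := (fun j => u * x.1 j, fun j => u * x.2 j + c)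

/-- Complex scaling and translation of the momenta `Y_ij`. -/
def sphAction (k c : ℂ) (z : ESph) : ESph :=
  (z.1, (fun j => k * z.2.1 j, fun j => z.2.2 j / (starRingEnd ℂ) k + c))

/-- Multiplication by a complex number as a real linear map. -/
def mulL (u : ℂ) : C3 →L[ℝ] C3 :=
  LinearMap.toContinuousLinearMap
    { toFun := fun X j => u * X j
      map_add' := fun X Y => by ext j; simp [mul_add]
      map_smul' := fun a X => by ext j; simp; ring }

theorem mulL_apply (u : ℂ) (X : C3) (j : Fin 3) : mulL u X j = u * X j := rfl

/-- The vector `(c, c, c)`. -/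
def diagL : ℂ →L[ℝ] C3 := ContinuousLinearMap.pi fun _ => ContinuousLinearMap.id ℝ ℂ

theorem diagL_apply (c : ℂ) (j : Fin 3) : diagL c j = c := rfl

theorem hasFDerivAt_bodyAction (u c : ℂ) (x : E6) :
    HasFDerivAt (bodyAction u c) ((mulL u).prodMap (mulL u)) x := by
  have h := ((mulL u).prodMap (mulL u)).hasFDerivAt (x := x)
  exact h.add_const (diagL c, 0) |>.congr_of_eventuallyEq (Filter.Eventually.of_forall fun y =>
    Prod.ext rfl (add_zero _).symm)

theorem hasFDerivAt_relAction (u c : ℂ) (x : E6) :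
    HasFDerivAt (relAction u c) ((mulL u).prodMap (mulL u)) x := by
  have h := ((mulL u).prodMap (mulL u)).hasFDerivAt (x := x)
  exact h.add_const (0, diagL c) |>.congr_of_eventuallyEq (Filter.Eventually.of_forall fun y =>
    Prod.ext (add_zero _).symm rfl)

theorem hasFDerivAt_sphAction (k c : ℂ) (x : ESph) :
    HasFDerivAt (sphAction k c) ((ContinuousLinearMap.id ℝ (ℝ × ℝ)).prodMap
      ((mulL k).prodMap (mulL ((starRingEnd ℂ) k)⁻¹))) x := by
  have h := ((ContinuousLinearMap.id ℝ (ℝ × ℝ)).prodMap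
      ((mulL k).prodMap (mulL ((starRingEnd ℂ) k)⁻¹))).hasFDerivAt (x := x)
  refine h.add_const (0, (0, diagL c)) |>.congr_of_eventuallyEq
    (Filter.Eventually.of_forall fun y => ?_)
  refine Prod.ext (add_zero _).symm (Prod.ext (add_zero _).symm ?_)
  funext j
  simp [sphAction, mulL_apply, diagL_apply, div_eq_inv_mul]

theorem mulL_surjective {u : ℂ} (hu : u ≠ 0) : Function.Surjective (mulL u) := fun X =>
  ⟨fun j => u⁻¹ * X j, funext fun j => by rw [mulL_apply, mul_inv_cancel_left₀ hu]⟩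

theorem pairing_mulL_left (u : ℂ) (P Q : C3) :
    pairing (mulL u P) Q = (starRingEnd ℂ) u * pairing P Q := by
  simp [pairing, mulL_apply, Finset.mul_sum, mul_assoc]

theorem pairing_mulL_right (u : ℂ) (P Q : C3) : pairing P (mulL u Q) = u * pairing P Q := by
  simp only [pairing, mulL_apply, Finset.mul_sum]
  exact Finset.sum_congr rfl fun _ _ => by ring

theorem pairing_diagL_left (c : ℂ) (Q : C3) : pairing (diagL c) Q = (starRingEnd ℂ) c * tot Q := by
  simp [pairing, diagL_apply, tot, Finset.mul_sum]

theorem pairing_diagL_right (c : ℂ) (P : C3) :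
    pairing P (diagL c) = (starRingEnd ℂ) (tot P) * c := by
  simp [pairing, diagL_apply, tot, Finset.sum_mul]

theorem conj_mul_self_of_norm_one {u : ℂ} (hu : ‖u‖ = 1) : (starRingEnd ℂ) u * u = 1 := by
  rw [← Complex.normSq_eq_conj_mul_self, Complex.normSq_eq_norm_sq, hu]; simp

theorem canonicalForm_rotation {u : ℂ} (hu : ‖u‖ = 1) (v w : E6) :
    canonicalForm ((mulL u).prodMap (mulL u) v) ((mulL u).prodMap (mulL u) w) =
      canonicalForm v w := by
  change (pairing (mulL u w.2) (mulL u v.1)).re - (pairing (mulL u v.2) (mulL u w.1)).re = _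
  simp only [canonicalForm, pairing_mulL_left, pairing_mulL_right]
  rw [← mul_assoc, ← mul_assoc, mul_comm u, conj_mul_self_of_norm_one hu, one_mul, one_mul]

theorem canonicalFormSph_scaling {k : ℂ} (hk : k ≠ 0) (v w : ESph) :
    canonicalFormSph ((ContinuousLinearMap.id ℝ (ℝ × ℝ)).prodMap
      ((mulL k).prodMap (mulL ((starRingEnd ℂ) k)⁻¹)) v)
      ((ContinuousLinearMap.id ℝ (ℝ × ℝ)).prodMap
      ((mulL k).prodMap (mulL ((starRingEnd ℂ) k)⁻¹)) w) = canonicalFormSph v w := by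
  have h : ∀ P Q, pairing (mulL ((starRingEnd ℂ) k)⁻¹ P) (mulL k Q) = pairing P Q := fun P Q => by
    rw [pairing_mulL_left, pairing_mulL_right, map_inv₀, Complex.conj_conj, inv_mul_cancel_left₀ hk]
  simp [canonicalFormSph, canonicalForm, h]

/-! ### Invariance of the Hamiltonians -/

theorem hamBody_bodyAction {u : ℂ} (hu : ‖u‖ = 1) (c : ℂ) (x : E6) :
    hamBody m (bodyAction u c x) = hamBody m x := by
  have h : ∀ i j, u * x.1 i + c - (u * x.1 j + c) = u * (x.1 i - x.1 j) := fun i j => by ring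
  simp [hamBody, bodyAction, h, hu]

theorem kinRel_mul_add (u c : ℂ) (P : C3) :
    kinRel m (fun j => u * P j + c) = ‖u‖ ^ 2 * kinRel m P := by
  have h : ∀ i j, u * P i + c - (u * P j + c) = u * (P i - P j) := fun i j => by ring
  simp only [kinRel, h, norm_mul]
  ring

theorem potRel_mul (k : ℂ) (Q : C3) : potRel m (fun j => k * Q j) = ‖k‖⁻¹ * potRel m Q := by
  simp only [potRel, norm_mul, Finset.mul_sum]
  exact Finset.sum_congr rfl fun j _ => by rw [div_eq_mul_inv, mul_inv]; ring

theorem hamRel_relAction {u : ℂ} (hu : ‖u‖ = 1) (c : ℂ) (x : E6) :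
    hamRel m (relAction u c x) = hamRel m x := by
  simp [hamRel, relAction, kinRel_mul_add, potRel_mul, hu]

theorem norm_phase {k : ℂ} (hk : k ≠ 0) : ‖k / ‖k‖‖ = 1 := by
  rw [norm_div, Complex.norm_real, norm_norm, div_self (norm_ne_zero_iff.2 hk)]

/-- Since |k|/k̄ = k/|k|, only the phase of k survives. The translation c picks up the factor |kX|/r
with which Y enters P. -/
theorem sphToRel_sphAction {k : ℂ} (hk : k ≠ 0) (c : ℂ) (z : ESph) :
    sphToRel m (sphAction k c z) =
      relAction (k / ‖k‖) (‖k‖ * massNorm m z.2.1 / z.1.1 * c) (sphToRel m z) := by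
  have hn : (‖k‖ : ℂ) ≠ 0 := by exact_mod_cast norm_ne_zero_iff.2 hk
  have hk' : (starRingEnd ℂ) k ≠ 0 := by simpa using hk
  have hs : (starRingEnd ℂ) k * k = ‖k‖ * ‖k‖ := by
    rw [← Complex.normSq_eq_conj_mul_self, Complex.normSq_eq_norm_sq]; push_cast; ring
  simp only [sphToRel, sphAction, relAction, massNorm_mul]
  refine Prod.ext (funext fun j => ?_) (funext fun j => ?_)
  · simp only [Pi.smul_apply, Complex.real_smul]
    push_cast
    rw [div_eq_mul_inv, mul_inv, div_eq_mul_inv, div_eq_mul_inv]; ring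
  · simp only [Pi.add_apply, Pi.smul_apply, Complex.real_smul, massDual]
    push_cast
    have e : (‖k‖ : ℂ) / (starRingEnd ℂ) k = k / ‖k‖ := by
      rw [div_eq_div_iff hk' hn, ← hs]; ring
    have e' : z.2.2 j / (starRingEnd ℂ) k * ‖k‖ = k / ‖k‖ * z.2.2 j := by rw [← e]; ring
    have e'' : (z.1.2 / (‖k‖ * massNorm m z.2.1) : ℂ) = z.1.2 / massNorm m z.2.1 / ‖k‖ := by
      rw [div_div, mul_comm]
    rw [e'']
    linear_combination ((massNorm m z.2.1 : ℂ) / z.1.1) * e'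

theorem hamSph_sphAction {k : ℂ} (hk : k ≠ 0) (c : ℂ) (z : ESph) :
    hamSph m (sphAction k c z) = hamSph m z := by
  rw [hamSph, sphToRel_sphAction hk, hamRel_relAction (norm_phase hk), hamSph]

/-- The products |X|² K(Y) and |X| U(X) are homogeneous of degree 0 under scaling, on the whole
space and not only on the level. -/
theorem hamSphExplicit_sphAction {k : ℂ} (hk : k ≠ 0) (c : ℂ) (z : ESph) :
    hamSphExplicit m (sphAction k c z) = hamSphExplicit m z := by
  have hn : ‖k‖ ≠ 0 := norm_ne_zero_iff.2 hk
  have h : (fun j => z.2.2 j / (starRingEnd ℂ) k + c) =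
    fun j => ((starRingEnd ℂ) k)⁻¹ * z.2.2 j + c := by
    funext j; rw [div_eq_inv_mul]
  simp only [hamSphExplicit, sphAction, shapePot, massNorm_mul, potRel_mul, h, kinRel_mul_add,
    norm_inv, RCLike.norm_conj]
  field_simp

/-! ### Conservation laws -/

theorem hasDerivAt_cexp_smul (a : ℂ) : HasDerivAt (fun t : ℝ => Complex.exp (t * a)) a 0 := by
  have h : HasDerivAt (fun t : ℝ => (t : ℂ) * a) (1 * a) 0 :=
    (Complex.ofRealCLM.hasDerivAt (x := (0 : ℝ))).mul_const a
  simpa using h.cexp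

theorem fderiv_rotation_eq_zero {S : ReductionData E6} {x : E6}
    (hd : DifferentiableAt ℝ S.ham x)
    (hinv : ∀ u : ℂ, ‖u‖ = 1 → S.ham ((mulL u).prodMap (mulL u) x) = S.ham x) :
    fderiv ℝ S.ham x (mulL Complex.I x.1, mulL Complex.I x.2) = 0 := by
  have h : ∀ X : C3,
      HasDerivAt (fun t : ℝ => mulL (Complex.exp (t * Complex.I)) X) (mulL Complex.I X) 0 :=
    fun X => hasDerivAt_pi.2 fun j => (hasDerivAt_cexp_smul Complex.I).mul_const (X j)
  refine fderiv_ham_eq_zero hd ((h x.1).prodMk (h x.2)) ?_ fun t => ?_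
  · refine Prod.ext (funext fun j => ?_) (funext fun j => ?_) <;> simp [mulL_apply]
  · exact hinv _ (Complex.norm_exp_ofReal_mul_I t)

/-- Noether's theorem: evaluating ω(v,·) = dH on the rotation generator (iQ, iP) gives the
derivative of Im⟨P,Q⟩ along v. -/
theorem Flow.angMom_eq {S : ReductionData E6} (hform : S.form = canonicalForm)
    (hd : ∀ x ∈ S.phase, DifferentiableAt ℝ S.ham x)
    (hinv : ∀ u : ℂ, ‖u‖ = 1 → ∀ x, S.ham ((mulL u).prodMap (mulL u) x) = S.ham x)
    {t : ℝ} {x y : E6} (h : S.Flow t x y) : angMom y.1 y.2 = angMom x.1 x.2 := by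
  have := Flow.conserved (f := fun x : E6 => (pairing x.2 x.1).im) ?_ h
  · rw [PlanarThreeBody.angMom_eq, PlanarThreeBody.angMom_eq, this]
  · rintro _ hx v hv γ s rfl hγ
    refine (hasDerivAt_im ((hasDerivAt_snd hγ).pairing (hasDerivAt_fst hγ))).congr_deriv ?_
    have h1 := hv (mulL Complex.I (γ s).1, mulL Complex.I (γ s).2)
    rw [fderiv_rotation_eq_zero (hd _ hx) fun u hu => hinv u hu _, hform] at h1
    simp only [canonicalForm, pairing_mulL_left, pairing_mulL_right] at h1
    simp at h1 ⊢
    linarith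

theorem eq_zero_of_forall_re_mul {z : ℂ} (h : ∀ a : ℂ, (a * z).re = 0) : z = 0 := by
  refine Complex.ext ?_ ?_
  · simpa using h 1
  · simpa using h (-Complex.I)

theorem hasDerivAt_tot {X : ℝ → C3} {X' : C3} {s : ℝ} (h : HasDerivAt X X' s) :
    HasDerivAt (fun t => tot (X t)) (tot X') s :=
  HasDerivAt.fun_sum fun j _ => hasDerivAt_pi.1 h j

/-- A complex function with vanishing derivative on Hamiltonian vectors is conserved. -/
theorem Flow.conserved_complex {E : Type} [NormedAddCommGroup E] [NormedSpace ℝ E]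
    {S : ReductionData E} {f : E → ℂ}
    (hf : ∀ x ∈ S.phase, ∀ v, S.IsHamiltonianVector x v →
      ∀ γ : ℝ → E, ∀ s, γ s = x → HasDerivAt γ v s → HasDerivAt (fun t => f (γ t)) 0 s)
    {t : ℝ} {x y : E} (h : S.Flow t x y) : f y = f x :=
  Complex.ext
    (Flow.conserved (f := fun x => (f x).re)
      (fun x hx v hv γ s h1 h2 => hasDerivAt_re (hf x hx v hv γ s h1 h2)) h)
    (Flow.conserved (f := fun x => (f x).im)
      (fun x hx v hv γ s h1 h2 => hasDerivAt_im (hf x hx v hv γ s h1 h2)) h)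

/-- Noether's theorem for translations of the positions; letting the real identities run over all
complex c recovers the complex total momentum. -/
theorem bodySystem_tot_eq (μ : ℝ) {t : ℝ} {x y : E6} (h : (bodySystem m μ).Flow t x y) :
    tot y.2 = tot x.2 := by
  refine Flow.conserved_complex (f := fun x : E6 => tot x.2) ?_ h
  rintro _ hx v hv γ s rfl hγ
  refine (hasDerivAt_tot (hasDerivAt_snd hγ)).congr_deriv ?_
  have h0 : ∀ c, (c * (starRingEnd ℂ) (tot v.2)).re = 0 := fun c => by
    have h1 := hv (diagL c, 0)
    have hc : HasDerivAt (fun t : ℝ => γ s + t • ((diagL c, 0) : E6)) (diagL c, 0) 0 :=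
      hasDerivAt_line _ _
    rw [fderiv_ham_eq_zero
      ((contDiffAt_hamBody (k := 1) hx).differentiableAt (by simp)) hc (by simp) fun t => ?_] at h1
    · have h2 : canonicalForm v (diagL c, 0) = 0 := h1
      simp only [canonicalForm, pairing_diagL_right] at h2
      rw [mul_comm]
      simp [pairing] at h2 ⊢
      linarith
    · have h3 := hamBody_bodyAction (m := m) (u := 1) (by simp) (t * c) (γ s)
      refine Eq.trans ?_ h3
      change hamBody m _ = _
      congr 1
      refine Prod.ext (funext fun j => ?_) (funext fun j => ?_) <;>
        simp [bodyAction, diagL_apply]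
  simpa using eq_zero_of_forall_re_mul h0

theorem tot_eq_zero_of_pairing {Q : C3} (h : ∀ c, (pairing (diagL c) Q).re = 0) : tot Q = 0 := by
  refine eq_zero_of_forall_re_mul fun a => ?_
  have := h ((starRingEnd ℂ) a)
  rwa [pairing_diagL_left, Complex.conj_conj] at this

/-- K depends only on differences of the P's. So translations of the momenta are symmetries, and the
sum of the Q's is their conserved quantity. -/
theorem relSystem_tot_eq (μ : ℝ) {t : ℝ} {x y : E6} (h : (relSystem m μ).Flow t x y) :
    tot y.1 = tot x.1 := by
  refine Flow.conserved_complex (f := fun x : E6 => tot x.1) ?_ h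
  rintro _ hx v hv γ s rfl hγ
  refine (hasDerivAt_tot (hasDerivAt_fst hγ)).congr_deriv ?_
  refine tot_eq_zero_of_pairing fun c => ?_
  have h1 := hv (0, diagL c)
  have hc : HasDerivAt (fun t : ℝ => γ s + t • ((0, diagL c) : E6)) (0, diagL c) 0 :=
    hasDerivAt_line _ _
  rw [fderiv_ham_eq_zero
    ((contDiffAt_hamRel (k := 1) hx).differentiableAt (by simp)) hc (by simp) fun t => ?_] at h1
  · have h2 : canonicalForm v (0, diagL c) = 0 := h1
    simpa [canonicalForm, pairing] using h2
  · have h3 := hamRel_relAction (m := m) (u := 1) (by simp) (t * c) (γ s)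
    refine Eq.trans ?_ h3
    change hamRel m _ = _
    congr 1
    refine Prod.ext (funext fun j => ?_) (funext fun j => ?_) <;>
      simp [relAction, diagL_apply]

/-! ### Conservation laws and symmetries for Hamiltonians invariant under scaling and translation -/

section Sph

variable {h : ESph → ℝ} (hd : ∀ z ∈ sphPhase, DifferentiableAt ℝ h z)
  (hinv : ∀ k : ℂ, k ≠ 0 → ∀ c z, h (sphAction k c z) = h z)

include hd hinv

/-- The test vector (aX, -āY) generates the scalings by exp(ta), along which h is constant. Real a
gives the real part of the identity and imaginary a the imaginary part. -/
theorem sphSystem_dilation {μ : ℝ} {z : ESph} (hz : z ∈ sphPhase) {v : ESph}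
    (hv : (sphSystem h μ).IsHamiltonianVector z v) :
    pairing v.2.2 z.2.1 + pairing z.2.2 v.2.1 = 0 := by
  refine eq_zero_of_forall_re_mul fun a => ?_
  have h1 := hv (0, (mulL a z.2.1, mulL (-(starRingEnd ℂ) a) z.2.2))
  have hX : HasDerivAt (fun t : ℝ => mulL (Complex.exp (t * a)) z.2.1) (mulL a z.2.1) 0 :=
    hasDerivAt_pi.2 fun j => (hasDerivAt_cexp_smul a).mul_const _
  have hY : HasDerivAt (fun t : ℝ => mulL (Complex.exp (t * (-(starRingEnd ℂ) a))) z.2.2)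
      (mulL (-(starRingEnd ℂ) a) z.2.2) 0 :=
    hasDerivAt_pi.2 fun j => (hasDerivAt_cexp_smul _).mul_const _
  have hc := (hasDerivAt_const (0 : ℝ) z.1).prodMk (hX.prodMk hY)
  rw [fderiv_ham_eq_zero (S := sphSystem h μ) (hd z hz) hc ?_ fun t => ?_] at h1
  · have h2 : canonicalFormSph v (0, (mulL a z.2.1, mulL (-(starRingEnd ℂ) a) z.2.2)) = 0 := h1
    simp only [canonicalFormSph, canonicalForm, pairing_mulL_left, pairing_mulL_right] at h2
    simp at h2 ⊢
    linarith
  · refine Prod.ext rfl (Prod.ext (funext fun j => ?_) (funext fun j => ?_)) <;> simp [mulL_apply]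
  · refine Eq.trans ?_ (hinv (Complex.exp (t * a)) (Complex.exp_ne_zero _) 0 z)
    change h _ = _
    congr 1
    refine Prod.ext rfl (Prod.ext rfl (funext fun j => ?_))
    simp [mulL_apply, sphAction, ← Complex.exp_conj, Complex.exp_neg, div_eq_inv_mul]

theorem sphSystem_pairing_eq {μ : ℝ} {t : ℝ} {x y : ESph} (hf : (sphSystem h μ).Flow t x y) :
    pairing y.2.2 y.2.1 = pairing x.2.2 x.2.1 := by
  refine Flow.conserved_complex (f := fun x : ESph => pairing x.2.2 x.2.1) ?_ hf
  rintro _ hx v hv γ s rfl hγ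
  exact ((hasDerivAt_snd (hasDerivAt_snd hγ)).pairing
    (hasDerivAt_fst (hasDerivAt_snd hγ))).congr_deriv (sphSystem_dilation hd hinv hx hv)

theorem sphSystem_tot_eq {μ : ℝ} {t : ℝ} {x y : ESph} (hf : (sphSystem h μ).Flow t x y) :
    tot y.2.1 = tot x.2.1 := by
  refine Flow.conserved_complex (f := fun x : ESph => tot x.2.1) ?_ hf
  rintro _ hx v hv γ s rfl hγ
  refine (hasDerivAt_tot (hasDerivAt_fst (hasDerivAt_snd hγ))).congr_deriv ?_
  refine tot_eq_zero_of_pairing fun c => ?_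
  have h1 := hv (0, (0, diagL c))
  rw [fderiv_ham_eq_zero (S := sphSystem h μ) (hd _ hx) (hasDerivAt_line (γ s) (0, (0, diagL c)))
    (by simp) fun t => ?_] at h1
  · have h2 : canonicalFormSph v (0, (0, diagL c)) = 0 := h1
    simpa [canonicalFormSph, canonicalForm, pairing] using h2
  · refine Eq.trans ?_ (hinv 1 one_ne_zero (t * c) (γ s))
    change h _ = _
    congr 1
    refine Prod.ext ?_ (Prod.ext (funext fun j => ?_) (funext fun j => ?_)) <;>
      simp [sphAction, diagL_apply]

theorem sphSystem_flow_sphAction {μ : ℝ} {k : ℂ} (hk : k ≠ 0) (c : ℂ) {t : ℝ} {x y : ESph}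
    (hf : (sphSystem h μ).Flow t x y) :
    (sphSystem h μ).Flow t (sphAction k c x) (sphAction k c y) := by
  have hk' : ((starRingEnd ℂ) k)⁻¹ ≠ 0 := inv_ne_zero (by simpa using hk)
  refine Flow.map_symmetry (S := sphSystem h μ) _ (hasFDerivAt_sphAction k c) ?_ (canonicalFormSph_scaling hk)
    (hinv k hk c) (fun z hz => ⟨hz.1, fun j => mul_ne_zero hk (hz.2 j)⟩) hd hf
  exact Function.surjective_id.prodMap ((mulL_surjective hk).prodMap (mulL_surjective hk'))

end Sph

/-! ### The quotient flows -/

/-- The scaling cancels, and a translation adds a multiple of the sum of the X's. Hence translations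
preserve the level of ⟨Y,X⟩ once that sum is zero. -/
theorem pairing_sphAction {k : ℂ} (hk : k ≠ 0) (c : ℂ) (z : ESph) :
    pairing (sphAction k c z).2.2 (sphAction k c z).2.1 =
      pairing z.2.2 z.2.1 + (starRingEnd ℂ) c * k * tot z.2.1 := by
  simp only [pairing, sphAction, tot, Finset.mul_sum, ← Finset.sum_add_distrib]
  refine Finset.sum_congr rfl fun j _ => ?_
  simp only [map_add, map_div₀, Complex.conj_conj]
  field_simp

theorem tot_mul (u : ℂ) (X : C3) : tot (fun j => u * X j) = u * tot X := by
  simp [tot, Finset.mul_sum]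

theorem sphAction_zero (k : ℂ) (z : ESph) :
    sphAction k 0 z = (z.1, (fun j => k * z.2.1 j, fun j => z.2.2 j / (starRingEnd ℂ) k)) := by
  simp [sphAction]

theorem relAction_zero (u : ℂ) (x : E6) :
    relAction u 0 x = (fun j => u * x.1 j, fun j => u * x.2 j) := by
  simp [relAction]

theorem hasQuotientFlow_sphSystem {h : ESph → ℝ} (μ : ℝ)
    (hd : ∀ z ∈ sphPhase, DifferentiableAt ℝ h z)
    (hinv : ∀ k : ℂ, k ≠ 0 → ∀ c z, h (sphAction k c z) = h z) :
    (sphSystem h μ).HasQuotientFlow where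
  level_subset _ hx := hx.1
  saturated := by
    rintro x y ⟨hx, hx'⟩ ⟨k, hk, rfl⟩
    refine ⟨⟨hx.1, fun j => mul_ne_zero hk (hx.2 j)⟩, ?_⟩
    rw [← sphAction_zero, pairing_sphAction hk, hx']
    simp
  invariant := by
    rintro t x y hx hf
    refine ⟨?_, (sphSystem_pairing_eq hd hinv hf).trans hx.2⟩
    obtain ⟨γ, I, -, -, -, ht, hsol, -, rfl⟩ := hf
    exact (hsol t ht).1
  orbits := by
    rintro t x _ y - ⟨k, hk, rfl⟩ hf
    refine ⟨sphAction k 0 y, ⟨k, hk, sphAction_zero k y⟩, ?_⟩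
    rw [← sphAction_zero]
    exact sphSystem_flow_sphAction hd hinv hk 0 hf

theorem hasQuotientFlow_sphTransSystem {h : ESph → ℝ} (μ : ℝ)
    (hd : ∀ z ∈ sphPhase, DifferentiableAt ℝ h z)
    (hinv : ∀ k : ℂ, k ≠ 0 → ∀ c z, h (sphAction k c z) = h z) :
    (sphTransSystem h μ).HasQuotientFlow where
  level_subset _ hx := hx.1
  saturated := by
    rintro x y ⟨hx, hx', hx''⟩ ⟨k, c, hk, rfl⟩
    refine ⟨⟨hx.1, fun j => mul_ne_zero hk (hx.2 j)⟩, ?_, ?_⟩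
    · refine (pairing_sphAction hk c x).trans ?_
      rw [hx', hx'', mul_zero, add_zero]
    · exact (tot_mul k x.2.1).trans (by rw [hx'', mul_zero])
  invariant := by
    rintro t x y hx hf
    -- `sphTransSystem` and `sphSystem` share form, phase space and Hamiltonian, so their flows
    -- coincide by definition and the conservation laws apply as they are.
    refine ⟨?_, (sphSystem_pairing_eq (μ := μ) hd hinv hf).trans hx.2.1,
      (sphSystem_tot_eq (μ := μ) hd hinv hf).trans hx.2.2⟩
    obtain ⟨γ, I, -, -, -, ht, hsol, -, rfl⟩ := hf
    exact (hsol t ht).1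
  orbits := by
    rintro t x _ y - ⟨k, c, hk, rfl⟩ hf
    exact ⟨sphAction k c y, ⟨k, c, hk, rfl⟩,
      sphSystem_flow_sphAction (μ := μ) hd hinv hk c hf⟩

/-- Rotations of the relative vectors and translations of the relative momenta:
`(Q, P) ↦ (u Q, u P + (c, c, c))` with `|u| = 1`. -/
def orbitRelTranslation : Setoid E6 where
  r x y := ∃ u c : ℂ, ‖u‖ = 1 ∧ y = relAction u c x
  iseqv := by
    refine ⟨fun x => ⟨1, 0, by simp, by simp [relAction]⟩, ?_, ?_⟩
    · rintro x y ⟨u, c, hu, rfl⟩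
      have h0 : u ≠ 0 := by rintro rfl; simp at hu
      refine ⟨u⁻¹, -(u⁻¹ * c), by simp [hu], ?_⟩
      ext j
      · simp only [relAction]; field_simp
      · simp only [relAction]; field_simp; ring
    · rintro x y z ⟨u, c, hu, rfl⟩ ⟨v, d, hv, rfl⟩
      refine ⟨v * u, v * c + d, by simp [hu, hv], ?_⟩
      ext j <;> simp only [relAction] <;> ring

/-- The Hamiltonian `H_rel` at angular momentum `μ` and `Q₁₂ + Q₃₁ + Q₂₃ = 0`, to be reduced by
rotations and translations of the momenta. -/
def relTransSystem (m : Fin 3 → ℝ) (μ : ℝ) : ReductionData E6 where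
  form := canonicalForm
  phase := {x | ∀ j, x.1 j ≠ 0}
  ham := hamRel m
  level := {x | (∀ j, x.1 j ≠ 0) ∧ angMom x.1 x.2 = μ ∧ tot x.1 = 0}
  orbit := orbitRelTranslation

theorem hamRel_rotation {u : ℂ} (hu : ‖u‖ = 1) (x : E6) :
    hamRel m ((mulL u).prodMap (mulL u) x) = hamRel m x := by
  rw [← hamRel_relAction hu 0 x, relAction_zero]; rfl

theorem hamBody_rotation {u : ℂ} (hu : ‖u‖ = 1) (x : E6) :
    hamBody m ((mulL u).prodMap (mulL u) x) = hamBody m x := by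
  rw [← hamBody_bodyAction hu 0 x]
  congr 1
  simp [bodyAction]; rfl

theorem differentiableAt_hamRel {y : E6} (hy : y ∈ relPhase) :
    DifferentiableAt ℝ (hamRel m) y :=
  (contDiffAt_hamRel (k := 1) hy).differentiableAt (by simp)

theorem differentiableAt_hamBody {y : E6} (hy : y ∈ bodyPhase) :
    DifferentiableAt ℝ (hamBody m) y :=
  (contDiffAt_hamBody (k := 1) hy).differentiableAt (by simp)

theorem relSystem_flow_relAction {μ : ℝ} {u : ℂ} (hu : ‖u‖ = 1) (c : ℂ) {t : ℝ} {x y : E6}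
    (hf : (relSystem m μ).Flow t x y) :
    (relSystem m μ).Flow t (relAction u c x) (relAction u c y) := by
  have h0 : u ≠ 0 := by rintro rfl; simp at hu
  exact Flow.map_symmetry (S := relSystem m μ) _ (hasFDerivAt_relAction u c)
    ((mulL_surjective h0).prodMap (mulL_surjective h0)) (canonicalForm_rotation hu)
    (hamRel_relAction hu c) (fun x hx j => mul_ne_zero h0 (hx j))
    (fun x hx => differentiableAt_hamRel hx) hf

theorem pairing_relAction {u : ℂ} (hu : ‖u‖ = 1) (c : ℂ) (x : E6) :
    pairing (relAction u c x).2 (relAction u c x).1 =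
      pairing x.2 x.1 + (starRingEnd ℂ) c * u * tot x.1 := by
  have h := conj_mul_self_of_norm_one hu
  simp only [pairing, relAction, tot, Finset.mul_sum, ← Finset.sum_add_distrib]
  refine Finset.sum_congr rfl fun j _ => ?_
  simp only [map_add, map_mul]
  linear_combination ((starRingEnd ℂ) (x.2 j) * x.1 j) * h

theorem hasQuotientFlow_relSystem (m : Fin 3 → ℝ) (μ : ℝ) :
    (relSystem m μ).HasQuotientFlow where
  level_subset _ hx := hx.1
  saturated := by
    rintro x y ⟨hx, hx'⟩ ⟨u, hu, rfl⟩
    have h0 : u ≠ 0 := by rintro rfl; simp at hu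
    refine ⟨fun j => mul_ne_zero h0 (hx j), ?_⟩
    rw [← hx', angMom_eq, angMom_eq, ← relAction_zero, pairing_relAction hu]
    simp
  invariant := by
    rintro t x y hx hf
    refine ⟨?_, (Flow.angMom_eq rfl (fun x hx => differentiableAt_hamRel hx)
      (fun u hu x => hamRel_rotation hu x) hf).trans hx.2⟩
    obtain ⟨γ, I, -, -, -, ht, hsol, -, rfl⟩ := hf
    exact (hsol t ht).1
  orbits := by
    rintro t x _ y - ⟨u, hu, rfl⟩ hf
    refine ⟨relAction u 0 y, ⟨u, hu, relAction_zero u y⟩, ?_⟩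
    rw [← relAction_zero]
    exact relSystem_flow_relAction hu 0 hf

theorem hasQuotientFlow_relTransSystem (m : Fin 3 → ℝ) (μ : ℝ) :
    (relTransSystem m μ).HasQuotientFlow where
  level_subset _ hx := hx.1
  saturated := by
    rintro x y ⟨hx, hx', hx''⟩ ⟨u, c, hu, rfl⟩
    have h0 : u ≠ 0 := by rintro rfl; simp at hu
    refine ⟨fun j => mul_ne_zero h0 (hx j), ?_, (tot_mul u x.1).trans (by rw [hx'', mul_zero])⟩
    rw [← hx', angMom_eq, angMom_eq, pairing_relAction hu, hx'', mul_zero, add_zero]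
  invariant := by
    rintro t x y hx hf
    refine ⟨?_, (Flow.angMom_eq rfl (fun x hx => differentiableAt_hamRel hx)
      (fun u hu x => hamRel_rotation hu x) hf).trans hx.2.1,
      (relSystem_tot_eq μ hf).trans hx.2.2⟩
    obtain ⟨γ, I, -, -, -, ht, hsol, -, rfl⟩ := hf
    exact (hsol t ht).1
  orbits := by
    rintro t x _ y - ⟨u, c, hu, rfl⟩ hf
    exact ⟨relAction u c y, ⟨u, c, hu, rfl⟩, relSystem_flow_relAction (μ := μ) hu c hf⟩

theorem pairing_bodyAction {u : ℂ} (hu : ‖u‖ = 1) (c : ℂ) (x : E6) :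
    pairing (bodyAction u c x).2 (bodyAction u c x).1 =
      pairing x.2 x.1 + (starRingEnd ℂ) (u * tot x.2) * c := by
  have h := conj_mul_self_of_norm_one hu
  simp only [pairing, bodyAction, tot, Finset.mul_sum, Finset.sum_mul, map_sum,
    ← Finset.sum_add_distrib]
  refine Finset.sum_congr rfl fun j _ => ?_
  simp only [map_mul]
  linear_combination ((starRingEnd ℂ) (x.2 j) * x.1 j) * h

theorem bodyAction_mem {u : ℂ} (hu : ‖u‖ = 1) (c : ℂ) {x : E6} (hx : x ∈ bodyPhase) :
    bodyAction u c x ∈ bodyPhase := fun i j hij => by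
  have h0 : u ≠ 0 := by rintro rfl; simp at hu
  simpa [bodyAction, h0] using hx i j hij

theorem hasQuotientFlow_bodySystem (m : Fin 3 → ℝ) (μ : ℝ) :
    (bodySystem m μ).HasQuotientFlow where
  level_subset _ hx := hx.1
  saturated := by
    rintro x y ⟨hx, hx', hx''⟩ ⟨u, c, hu, rfl⟩
    refine ⟨bodyAction_mem hu c hx, (tot_mul u x.2).trans (by rw [hx', mul_zero]), ?_⟩
    rw [← hx'', angMom_eq, angMom_eq]
    have := pairing_bodyAction hu c x
    rw [hx', mul_zero, map_zero, zero_mul, add_zero] at this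
    rw [← this]; rfl
  invariant := by
    rintro t x y hx hf
    refine ⟨?_, (bodySystem_tot_eq μ hf).trans hx.2.1,
      (Flow.angMom_eq rfl (fun x hx => differentiableAt_hamBody hx)
        (fun u hu x => hamBody_rotation hu x) hf).trans hx.2.2⟩
    obtain ⟨γ, I, -, -, -, ht, hsol, -, rfl⟩ := hf
    exact (hsol t ht).1
  orbits := by
    rintro t x _ y - ⟨u, c, hu, rfl⟩ hf
    have h0 : u ≠ 0 := by rintro rfl; simp at hu
    refine ⟨bodyAction u c y, ⟨u, c, hu, rfl⟩, ?_⟩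
    exact hf.map_symmetry _ (hasFDerivAt_bodyAction u c)
      ((mulL_surjective h0).prodMap (mulL_surjective h0)) (canonicalForm_rotation hu)
      (hamBody_bodyAction hu c) (fun x hx => bodyAction_mem hu c hx)
      (fun x hx => differentiableAt_hamBody hx)

/-! ### The Hamiltonians in spherical variables -/

/-- The covector moment `m₃ Y₁₂ + m₂ Y₃₁ + m₁ Y₂₃`. -/
def massMoment (m : Fin 3 → ℝ) (Y : C3) : ℂ := m 2 * Y 0 + m 1 * Y 1 + m 0 * Y 2

/-- The part of `H_sph - hamSphExplicit` which is linear in `p_r`, divided by `p_r / r`. -/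
def crossTerm (m : Fin 3 → ℝ) (z : ESph) : ℝ :=
  (pairing z.2.2 z.2.1).re -
    ((starRingEnd ℂ) (massMoment m z.2.2) * tot z.2.1).re / totalMass m

theorem totalMass_eq : totalMass m = m 0 + m 1 + m 2 := Fin.sum_univ_three _

/-- The identity `kinPolar_massDual` for a single real coordinate; it is applied to real and
imaginary parts separately. -/
theorem real_cross (hm : ∀ i, 0 < m i) (x y : Fin 3 → ℝ) :
    (m 0 * m 1 / (m 0 + m 1 + m 2) * x 0 - m 2 * m 0 / (m 0 + m 1 + m 2) * x 1) * (y 0 - y 1) /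
        m 0 +
      (m 1 * m 2 / (m 0 + m 1 + m 2) * x 2 - m 0 * m 1 / (m 0 + m 1 + m 2) * x 0) * (y 2 - y 0) /
        m 1 +
      (m 2 * m 0 / (m 0 + m 1 + m 2) * x 1 - m 1 * m 2 / (m 0 + m 1 + m 2) * x 2) * (y 1 - y 2) /
        m 2 =
      x 0 * y 0 + x 1 * y 1 + x 2 * y 2 -
        (m 2 * y 0 + m 1 * y 1 + m 0 * y 2) * (x 0 + x 1 + x 2) / (m 0 + m 1 + m 2) := by
  have h0 := (hm 0).ne'
  have h1 := (hm 1).ne'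
  have h2 := (hm 2).ne'
  have hs : m 0 + m 1 + m 2 ≠ 0 := (add_pos (add_pos (hm 0) (hm 1)) (hm 2)).ne'
  field_simp
  ring

/-- The polar form of `2 K`. -/
def kinPolar (m : Fin 3 → ℝ) (P P' : C3) : ℝ :=
  ((P 0 - P 1).re * (P' 0 - P' 1).re + (P 0 - P 1).im * (P' 0 - P' 1).im) / m 0 +
    ((P 2 - P 0).re * (P' 2 - P' 0).re + (P 2 - P 0).im * (P' 2 - P' 0).im) / m 1 +
    ((P 1 - P 2).re * (P' 1 - P' 2).re + (P 1 - P 2).im * (P' 1 - P' 2).im) / m 2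

theorem norm_sq_eq_re_im (z : ℂ) : ‖z‖ ^ 2 = z.re * z.re + z.im * z.im := by
  rw [← Complex.normSq_eq_norm_sq, Complex.normSq_apply]

theorem kinRel_eq_kinPolar (P : C3) : kinRel m P = kinPolar m P P / 2 := by
  simp only [kinRel, kinPolar, norm_sq_eq_re_im]
  ring

theorem kinRel_smul_add_smul (a b : ℝ) (P P' : C3) :
    kinRel m (a • P + b • P') =
      a ^ 2 * kinRel m P + a * b * kinPolar m P P' + b ^ 2 * kinRel m P' := by
  simp only [kinRel_eq_kinPolar, kinPolar]
  simp
  ring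

/-- On vectors X of sum zero the form 2K inverts the duality X ↦ X*, so its value on X* and Y is the
evaluation of Y on X. Off that subspace there is a correction linear in the sum. -/
theorem kinPolar_massDual (hm : ∀ i, 0 < m i) (X Y : C3) :
    kinPolar m (massDual m X) Y = (pairing Y X).re -
      ((starRingEnd ℂ) (massMoment m Y) * tot X).re / totalMass m := by
  have h1 := real_cross hm (fun j => (X j).re) (fun j => (Y j).re)
  have h2 := real_cross hm (fun j => (X j).im) (fun j => (Y j).im)
  simp only [kinPolar, massDual, pairMass, pairing, tot, massMoment, Fin.sum_univ_three,
    totalMass_eq]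
  simp [-Complex.ofReal_div, -Complex.ofReal_mul]
  linear_combination h1 + h2

theorem massMoment_massDual (X : C3) :
    massMoment m (massDual m X) = ((m 0 * m 1 * m 2 / totalMass m : ℝ) : ℂ) * tot X := by
  simp only [massMoment, massDual, pairMass, tot, Fin.sum_univ_three]
  simp
  ring

/-- Put Y = X* in the polar formula. The moment of X* is itself a multiple of the sum of the X's, so
the correction is quadratic in that sum. -/
theorem kinRel_massDual (hm : ∀ i, 0 < m i) (X : C3) :
    kinRel m (massDual m X) = (massNorm m X ^ 2 -
      m 0 * m 1 * m 2 / totalMass m ^ 2 * ((tot X).re ^ 2 + (tot X).im ^ 2)) / 2 := by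
  rw [kinRel_eq_kinPolar, kinPolar_massDual hm, massMoment_massDual, massNorm_sq hm]
  simp [-Complex.ofReal_div]
  ring

theorem potRel_smul (a : ℝ) (Q : C3) : potRel m (a • Q) = |a|⁻¹ * potRel m Q := by
  have := potRel_mul (m := m) a Q
  rw [Complex.norm_real, Real.norm_eq_abs] at this
  rw [← this]; rfl

/-- Expand K on a combination of X* and Y. The mixed term gives `crossTerm`, which vanishes on the
constraint set; the defect in the p_r² term is quadratic in the sum of the X's and so vanishes there
to second order. -/
theorem hamSph_eq (hm : ∀ i, 0 < m i) {z : ESph} (hz : z ∈ sphPhase) :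
    hamSph m z = hamSphExplicit m z + z.1.2 / z.1.1 * crossTerm m z -
      z.1.2 ^ 2 / massNorm m z.2.1 ^ 2 * (m 0 * m 1 * m 2 / totalMass m ^ 2 / 2) *
        ((tot z.2.1).re ^ 2 + (tot z.2.1).im ^ 2) := by
  have hn := massNorm_pos hm hz.2
  have hr := hz.1
  have hn' := hn.ne'
  have hr' := hr.ne'
  have ht := (totalMass_pos hm).ne'
  simp only [hamSph, hamRel, sphToRel, kinRel_smul_add_smul, potRel_smul, kinPolar_massDual hm,
    kinRel_massDual hm, abs_of_pos (div_pos hr hn), hamSphExplicit, shapePot, crossTerm]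
  field_simp
  ring

theorem crossTerm_eq_zero {z : ESph} (h0 : (pairing z.2.2 z.2.1).re = 0) (ht : tot z.2.1 = 0) :
    crossTerm m z = 0 := by
  simp [crossTerm, h0, ht]

theorem hamSphExplicit_eq_hamSph (hm : ∀ i, 0 < m i) {z : ESph} (hz : z ∈ sphPhase)
    (h0 : (pairing z.2.2 z.2.1).re = 0) (ht : tot z.2.1 = 0) :
    hamSphExplicit m z = hamSph m z := by
  rw [hamSph_eq hm hz, crossTerm_eq_zero h0 ht, ht]; simp

theorem fderiv_hamSph (hm : ∀ i, 0 < m i) {z : ESph} (hz : z ∈ sphPhase) (w : ESph) :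
    fderiv ℝ (hamSph m) z w =
      fderiv ℝ (hamRel m) (sphToRel m z) (fderiv ℝ (sphToRel m) z w) := by
  have h1 := (differentiableAt_hamRel (m := m) (sphToRel_mem hm hz)).hasFDerivAt.comp z
    ((contDiffAt_sphToRel hm (k := 1) hz).differentiableAt (by simp)).hasFDerivAt
  exact congrArg (fun L => L w) h1.fderiv

theorem differentiableAt_hamSph (hm : ∀ i, 0 < m i) {z : ESph} (hz : z ∈ sphPhase) :
    DifferentiableAt ℝ (hamSph m) z :=
  (contDiffAt_hamSph hm (k := 1) hz).differentiableAt (by simp)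

theorem differentiableAt_hamSphExplicit (hm : ∀ i, 0 < m i) {z : ESph} (hz : z ∈ sphPhase) :
    DifferentiableAt ℝ (hamSphExplicit m) z :=
  (contDiffAt_hamSphExplicit hm (k := 1) hz).differentiableAt (by simp)

/-- On the reduced level the differentials of `hamSph` and `hamSphExplicit` differ by
differentials of the conserved quantities. -/
theorem fderiv_hamSph_eq (hm : ∀ i, 0 < m i) {z : ESph} (hz : z ∈ sphPhase)
    (h0 : (pairing z.2.2 z.2.1).re = 0) (ht : tot z.2.1 = 0) (w : ESph) :
    fderiv ℝ (hamSph m) z w = fderiv ℝ (hamSphExplicit m) z w + z.1.2 / z.1.1 *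
      (dilationDeriv z w -
        ((starRingEnd ℂ) (massMoment m z.2.2) * tot w.2.1).re / totalMass m) := by
  have hS := hasDerivAt_comp_line (differentiableAt_hamSph hm hz) w
  have hE := hasDerivAt_comp_line (differentiableAt_hamSphExplicit hm hz) w
  have hr : DifferentiableAt ℝ (fun z : ESph => z.1.2 / z.1.1) z :=
    (ContDiffAt.div (n := 1) (f := fun z : ESph => z.1.2) (g := fun z : ESph => z.1.1)
      (by fun_prop) (by fun_prop) hz.1.ne').differentiableAt (by simp)
  have hn : DifferentiableAt ℝ (fun z : ESph => z.1.2 ^ 2 / massNorm m z.2.1 ^ 2 *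
      (m 0 * m 1 * m 2 / totalMass m ^ 2 / 2)) z := by
    have hn : ContDiffAt ℝ 1 (fun z : ESph => massNorm m z.2.1) z :=
      (contDiffAt_massNorm hm hz.2).comp z (f := fun z : ESph => z.2.1) (by fun_prop)
    have hp : ContDiffAt ℝ 1 (fun z : ESph => z.1.2 ^ 2) z := by fun_prop
    exact ((hp.div (hn.pow 2) (pow_ne_zero 2 (massNorm_pos hm hz.2).ne')).mul
      contDiffAt_const).differentiableAt (by simp)
  have hr := hasDerivAt_comp_line hr w
  have hn := hasDerivAt_comp_line hn w
  have hX : HasDerivAt (fun t : ℝ => (z + t • w).2.1) w.2.1 0 :=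
    hasDerivAt_fst (hasDerivAt_snd (hasDerivAt_line z w))
  have hY : HasDerivAt (fun t : ℝ => (z + t • w).2.2) w.2.2 0 :=
    hasDerivAt_snd (hasDerivAt_snd (hasDerivAt_line z w))
  have hYj := hasDerivAt_pi.1 hY
  have hT := hasDerivAt_tot hX
  have hM : HasDerivAt (fun t : ℝ => massMoment m (z + t • w).2.2) (massMoment m w.2.2) 0 :=
    (((hYj 0).const_mul (m 2 : ℂ)).add ((hYj 1).const_mul (m 1 : ℂ))).add
      ((hYj 2).const_mul (m 0 : ℂ))
  have hMc := Complex.conjCLE.hasFDerivAt.comp_hasDerivAt (0 : ℝ) hM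
  have hC := (hasDerivAt_re (hY.pairing hX)).sub
    ((hasDerivAt_re (hMc.mul hT)).div_const (totalMass m))
  have hQ := ((hasDerivAt_re hT).pow 2).add ((hasDerivAt_im hT).pow 2)
  have hR := (hE.add (hr.mul hC)).sub (hn.mul hQ)
  have hU := hR.congr_of_eventuallyEq
    ((eventually_line_mem isOpen_sphPhase hz w).mono fun t ht => hamSph_eq hm ht)
  refine (hS.unique hU).trans ?_
  -- At `z` the cross term and the sum of the X's are zero. So derivatives of the coefficients and
  -- of the moment drop out, as does the quadratic term; p_r/r times the rest of the derivative of
  -- the cross term remains.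
  simp [ht, h0, dilationDeriv]

/-! ### Transport of Hamiltonian vectors -/

/-- The infinitesimal translations of the relative momenta. -/
def relTranslation : ℂ →L[ℝ] E6 := (0 : ℂ →L[ℝ] C3).prod diagL

theorem relTranslation_apply (c : ℂ) : relTranslation c = (0, diagL c) := rfl

theorem add_relTranslation (x : E6) (c : ℂ) : x + relTranslation c = relAction 1 c x := by
  refine Prod.ext (funext fun j => ?_) (funext fun j => ?_) <;>
    simp [relTranslation_apply, diagL_apply, relAction]

theorem canonicalForm_add_relTranslation (v w : E6) (c : ℂ) :
    canonicalForm (v + relTranslation c) w =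
      canonicalForm v w - ((starRingEnd ℂ) c * tot w.1).re := by
  simp only [canonicalForm, relTranslation_apply, Prod.fst_add, Prod.snd_add, pairing_add_left,
    add_zero, pairing_diagL_left, Complex.add_re]
  ring

/-- The infinitesimal translations of the momenta `Y_ij`. -/
def sphTranslation : ℂ →L[ℝ] ESph :=
  (0 : ℂ →L[ℝ] ℝ × ℝ).prod ((0 : ℂ →L[ℝ] C3).prod diagL)

theorem sphTranslation_apply (c : ℂ) : sphTranslation c = (0, (0, diagL c)) := rfl

theorem add_sphTranslation (z : ESph) (c : ℂ) : z + sphTranslation c = sphAction 1 c z := by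
  refine Prod.ext ?_ (Prod.ext (funext fun j => ?_) (funext fun j => ?_)) <;>
    simp [sphTranslation_apply, diagL_apply, sphAction]

theorem canonicalFormSph_add_sphTranslation (v w : ESph) (c : ℂ) :
    canonicalFormSph (v + sphTranslation c) w =
      canonicalFormSph v w - ((starRingEnd ℂ) c * tot w.2.1).re := by
  simp only [canonicalFormSph, canonicalForm, sphTranslation_apply, Prod.fst_add, Prod.snd_add,
    pairing_add_left, add_zero, pairing_diagL_left, Complex.add_re]
  ring

theorem isHamiltonianVector_add_relTranslation (μ : ℝ) {x v : E6} (c : ℂ)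
    (h : (relSystem m μ).IsHamiltonianVector x v) :
    (relSystem m μ).IsHamiltonianVector (x + relTranslation c) v := by
  intro w
  have h1 := fderiv_comp_add_right (𝕜 := ℝ) (f := hamRel m) (x := x) (relTranslation c)
  have h2 : (fun x => hamRel m (x + relTranslation c)) = hamRel m := funext fun x => by
    rw [add_relTranslation, hamRel_relAction (by simp)]
  rw [h2] at h1
  rw [h w]
  change fderiv ℝ (hamRel m) x w = fderiv ℝ (hamRel m) (x + relTranslation c) w
  rw [h1]

theorem isHamiltonianVector_add_sphTranslation {h : ESph → ℝ} (μ : ℝ)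
    (hinv : ∀ k : ℂ, k ≠ 0 → ∀ c z, h (sphAction k c z) = h z) {x v : ESph} (c : ℂ)
    (hv : (sphSystem h μ).IsHamiltonianVector x v) :
    (sphSystem h μ).IsHamiltonianVector (x + sphTranslation c) v := by
  intro w
  have h1 := fderiv_comp_add_right (𝕜 := ℝ) (f := h) (x := x) (sphTranslation c)
  have h2 : (fun x => h (x + sphTranslation c)) = h := funext fun x => by
    rw [add_sphTranslation, hinv _ one_ne_zero]
  rw [h2] at h1
  rw [hv w]
  change fderiv ℝ h x w = fderiv ℝ h (x + sphTranslation c) w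
  rw [h1]

/-- Lifts of vectors along `sphToRel` that are tangent to the levels of `Re ⟨Y, X⟩`. -/
theorem exists_fderiv_sphToRel_eq (hm : ∀ i, 0 < m i) {z : ESph} (hz : z ∈ sphPhase)
    (h0 : (pairing z.2.2 z.2.1).re = 0) (w' : E6) :
    ∃ w, fderiv ℝ (sphToRel m) z w = w' ∧ dilationDeriv z w = 0 := by
  have hρ : 0 < z.1.1 / massNorm m z.2.1 := div_pos hz.1 (massNorm_pos hm hz.2)
  have hy := sphToRel_mem hm hz
  -- The scaling by |X|/r is chosen so that the section passes through `z` itself; its derivative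
  -- provides the lift.
  have hs := isLocalSection_realScaling (inv_pos.2 hρ) (isLocalSection_relToSph hm hy)
  have hH : realScaling (z.1.1 / massNorm m z.2.1)⁻¹ (relToSph m (sphToRel m z)) = z := by
    rw [relToSph_sphToRel hm hz h0, realScaling_realScaling, inv_mul_cancel₀ hρ.ne',
      realScaling_one]
  have h1 := hs.fderiv_right_inv hm hy w'
  have h2 := hs.dilationDeriv_eq_zero hy w'
  rw [hH] at h1 h2
  exact ⟨_, h1, h2⟩

/-- Test vectors are lifted inside the kernel of d Re⟨Y,X⟩, and `v` lies in that kernel by scaling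
invariance. Both correction terms of the pulled-back form then vanish. -/
theorem isHamiltonianVector_sphToRel (hm : ∀ i, 0 < m i) (μ : ℝ) {z v : ESph}
    (hz : z ∈ sphPhase) (h0 : (pairing z.2.2 z.2.1).re = 0)
    (hv : (sphSystem (hamSph m) μ).IsHamiltonianVector z v) :
    (relSystem m μ).IsHamiltonianVector (sphToRel m z) (fderiv ℝ (sphToRel m) z v) := by
  intro w'
  obtain ⟨w, rfl, hw⟩ := exists_fderiv_sphToRel_eq hm hz h0 w'
  have hvd : dilationDeriv z v = 0 := by
    have := sphSystem_dilation (fun z hz => differentiableAt_hamSph hm hz)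
      (fun k hk c z => hamSph_sphAction hk c z) hz hv
    simpa [dilationDeriv] using congrArg Complex.re this
  have h1 : canonicalFormSph v w = fderiv ℝ (hamSph m) z w := hv w
  have h2 := canonicalForm_fderiv_sphToRel hm hz v w
  rw [hw, hvd, h1, fderiv_hamSph hm hz, mul_zero, zero_mul, add_zero, sub_zero] at h2
  exact h2

/-- Here the test vector is arbitrary and need not preserve Re⟨Y,X⟩; the correction vanishes because
log(r/|X|) is constant on this section. -/
theorem isHamiltonianVector_relToSph (hm : ∀ i, 0 < m i) (μ : ℝ) {y v : E6} (hy : y ∈ relPhase)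
    (hv : (relSystem m μ).IsHamiltonianVector y v) :
    (sphSystem (hamSph m) μ).IsHamiltonianVector (relToSph m y) (fderiv ℝ (relToSph m) y v) := by
  intro w
  have h1 := (isLocalSection_relToSph hm hy).canonicalFormSph_fderiv hm hy v w
  have h2 : canonicalForm v (fderiv ℝ (sphToRel m) (relToSph m y) w) =
    fderiv ℝ (hamRel m) y (fderiv ℝ (sphToRel m) (relToSph m y) w) := hv _
  rw [logRatioDeriv_relToSph hm hy, zero_mul, sub_zero, h2] at h1
  refine h1.trans ?_
  change _ = fderiv ℝ (hamSph m) (relToSph m y) w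
  rw [fderiv_hamSph hm (relToSph_mem hm hy), sphToRel_relToSph hm hy]

theorem tot_fderiv_sphToRel (hm : ∀ i, 0 < m i) {z : ESph} (hz : z ∈ sphPhase)
    (ht : tot z.2.1 = 0) (w : ESph) :
    tot (fderiv ℝ (sphToRel m) z w).1 = (z.1.1 / massNorm m z.2.1 : ℝ) * tot w.2.1 := by
  have h : ∀ (a b : ℝ) (X Y : C3), tot (a • X + b • Y) = a * tot X + b * tot Y := by
    intro a b X Y
    simp [tot, Finset.mul_sum, Finset.sum_add_distrib]
  rw [fderiv_sphToRel hm hz]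
  simp only [sphToRelDeriv]
  rw [h, ht, mul_zero, zero_add]

/-- The translation gauge of `sphToRel` for the explicit Hamiltonian. -/
def relGauge (m : Fin 3 → ℝ) (z : ESph) : ℂ :=
  (z.1.2 / z.1.1 / totalMass m * (massNorm m z.2.1 / z.1.1) : ℝ) * massMoment m z.2.2

/-- On test vectors in the kernel of d Re⟨Y,X⟩ the differentials of the two Hamiltonians differ only
by a term in the sum of dX, which is the contraction of ω with a momentum translation. F multiplies
that sum by r/|X|, whence the factor |X|/r in `relGauge`. -/
theorem isHamiltonianVector_sphToRel_explicit (hm : ∀ i, 0 < m i) (μ : ℝ) {z v : ESph}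
    (hz : z ∈ sphPhase) (h0 : (pairing z.2.2 z.2.1).re = 0) (ht : tot z.2.1 = 0)
    (hv : (sphSystem (hamSphExplicit m) μ).IsHamiltonianVector z v) :
    (relSystem m μ).IsHamiltonianVector (sphToRel m z)
      (fderiv ℝ (sphToRel m) z v + relTranslation (relGauge m z)) := by
  intro w'
  obtain ⟨w, rfl, hw⟩ := exists_fderiv_sphToRel_eq hm hz h0 w'
  have hvd : dilationDeriv z v = 0 := by
    have := sphSystem_dilation (fun z hz => differentiableAt_hamSphExplicit hm hz)
      (fun k hk c z => hamSphExplicit_sphAction hk c z) hz hv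
    simpa [dilationDeriv] using congrArg Complex.re this
  have h1 : canonicalFormSph v w = fderiv ℝ (hamSphExplicit m) z w := hv w
  have h2 := canonicalForm_fderiv_sphToRel hm hz v w
  have h3 := fderiv_hamSph_eq hm hz h0 ht w
  rw [fderiv_hamSph hm hz, hw] at h3
  rw [hw, hvd, h1] at h2
  have h4 : canonicalForm (fderiv ℝ (sphToRel m) z v + relTranslation (relGauge m z))
      (fderiv ℝ (sphToRel m) z w) =
      fderiv ℝ (hamRel m) (sphToRel m z) (fderiv ℝ (sphToRel m) z w) := by
    rw [canonicalForm_add_relTranslation, h2, h3, tot_fderiv_sphToRel hm hz ht, relGauge]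
    have hn := (massNorm_pos hm hz.2).ne'
    have hr := hz.1.ne'
    have hM := (totalMass_pos hm).ne'
    rw [map_mul, Complex.conj_ofReal]
    have e : ((z.1.2 / z.1.1 / totalMass m * (massNorm m z.2.1 / z.1.1) : ℝ) : ℂ) *
        (starRingEnd ℂ) (massMoment m z.2.2) *
        (((z.1.1 / massNorm m z.2.1 : ℝ) : ℂ) * tot w.2.1) =
        ((z.1.2 / z.1.1 / totalMass m : ℝ) : ℂ) *
          ((starRingEnd ℂ) (massMoment m z.2.2) * tot w.2.1) := by
      have e1 : z.1.2 / z.1.1 / totalMass m * (massNorm m z.2.1 / z.1.1) *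
        (z.1.1 / massNorm m z.2.1) = z.1.2 / z.1.1 / totalMass m := by field_simp
      conv_rhs => rw [← e1]
      push_cast; ring
    rw [e, Complex.re_ofReal_mul]
    ring
  exact h4

/-- The translation gauge of `relToSphUnit` for the explicit Hamiltonian. -/
def sphGauge (m : Fin 3 → ℝ) (z : ESph) : ℂ :=
  -((z.1.2 / z.1.1 / totalMass m : ℝ) * massMoment m z.2.2)

/-- The obstruction along d Re⟨Y,X⟩ has the coefficient p_r/r minus the derivative of log(r/|X|).
With |X| = 1 this is (p_r - r')/r, and the radial Hamilton equation r' = p_r makes it zero. A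
translation remains, compensated by `sphGauge`. -/
theorem isHamiltonianVector_relToSphUnit (hm : ∀ i, 0 < m i) (μ : ℝ) {y v : E6}
    (hy : y ∈ relPhase) (ht : tot y.1 = 0) (hv : (relSystem m μ).IsHamiltonianVector y v) :
    (sphSystem (hamSphExplicit m) μ).IsHamiltonianVector (relToSphUnit m y)
      (fderiv ℝ (relToSphUnit m) y v + sphTranslation (sphGauge m (relToSphUnit m y))) := by
  set z := relToSphUnit m y with hzdef
  set a := fderiv ℝ (relToSphUnit m) y v with ha
  have hz : z ∈ sphPhase := relToSphUnit_mem hm hy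
  have hzt : tot z.2.1 = 0 := by
    have : z.2.1 = fun j => ((massNorm m y.1)⁻¹ : ℝ) * y.1 j := by
      funext j; simp [hzdef, relToSphUnit, relToSph, realScaling]
    rw [this, tot_mul, ht, mul_zero]
  have h0 := (pairing_relToSphUnit hm hy).1
  have key : ∀ w, canonicalFormSph a w = fderiv ℝ (hamSphExplicit m) z w +
      (z.1.2 / z.1.1 - a.1.1 / z.1.1) * dilationDeriv z w -
      z.1.2 / z.1.1 * (((starRingEnd ℂ) (massMoment m z.2.2) * tot w.2.1).re / totalMass m) := by
    intro w
    have h1 := (isLocalSection_relToSphUnit hm hy).canonicalFormSph_fderiv hm hy v w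
    have h2 : canonicalForm v (fderiv ℝ (sphToRel m) z w) =
      fderiv ℝ (hamRel m) y (fderiv ℝ (sphToRel m) z w) := hv _
    have h3 := fderiv_hamSph_eq hm hz h0 hzt w
    rw [fderiv_hamSph hm hz, hzdef, sphToRel_relToSphUnit hm hy, ← hzdef] at h3
    rw [logRatioDeriv_relToSphUnit hm hy, h2, h3] at h1
    rw [h1]; ring
  -- Test `key` on the direction of p_r: the dilation and sum terms vanish there, the form returns
  -- the r-component of `a`, and the derivative of the explicit Hamiltonian is p_r.
  have hr : a.1.1 = z.1.2 := by
    have h1 := key ((0, 1), 0)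
    have h2 : fderiv ℝ (hamSphExplicit m) z ((0, 1), 0) = z.1.2 := by
      have h3 := hasDerivAt_comp_line (differentiableAt_hamSphExplicit hm hz) ((0, 1), 0)
      have h4 : HasDerivAt (fun t : ℝ => (z.1.2 + t) ^ 2 / 2 +
          (massNorm m z.2.1 ^ 2 / z.1.1 ^ 2 * kinRel m z.2.2 - shapePot m z.2.1 / z.1.1))
          z.1.2 0 := by
        have := ((((hasDerivAt_id (0 : ℝ)).const_add z.1.2).pow 2).div_const 2).add_const
          (massNorm m z.2.1 ^ 2 / z.1.1 ^ 2 * kinRel m z.2.2 - shapePot m z.2.1 / z.1.1)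
        refine this.congr_deriv ?_
        simp
      refine h3.unique (h4.congr_of_eventuallyEq (Filter.Eventually.of_forall fun t => ?_))
      simp [hamSphExplicit]
      ring
    rw [h2] at h1
    simpa [canonicalFormSph, canonicalForm, dilationDeriv, pairing, tot] using h1
  intro w
  have h4 : canonicalFormSph (a + sphTranslation (sphGauge m z)) w =
      fderiv ℝ (hamSphExplicit m) z w := by
    rw [canonicalFormSph_add_sphTranslation, key, hr, sphGauge, map_neg, map_mul,
      Complex.conj_ofReal, neg_mul, mul_assoc, Complex.neg_re, Complex.re_ofReal_mul]
    ring
  exact h4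

/-! ### Equivalences between spherical and relative variables -/

theorem dilationDeriv_eq_zero_of_curve {γ : ℝ → ESph} {v : ESph} {s : ℝ} (hγ : HasDerivAt γ v s)
    (h : ∀ t, (pairing (γ t).2.2 (γ t).2.1).re = 0) : dilationDeriv (γ s) v = 0 := by
  have h1 := hasDerivAt_re ((hasDerivAt_snd (hasDerivAt_snd hγ)).pairing
    (hasDerivAt_fst (hasDerivAt_snd hγ)))
  rw [funext h] at h1
  exact h1.unique (hasDerivAt_const _ _)

theorem orbitScaling_eq_sphAction (k : ℂ) (hk : k ≠ 0) (z : ESph) :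
    orbitScaling z (sphAction k 0 z) := ⟨k, hk, sphAction_zero k z⟩

theorem realScaling_eq_sphAction (a : ℝ) (z : ESph) : realScaling a z = sphAction a 0 z := by
  refine Prod.ext rfl (Prod.ext (funext fun j => ?_) (funext fun j => ?_))
  · simp [realScaling, sphAction]
  · simp [realScaling, sphAction, div_eq_inv_mul]

theorem massNorm_relAction {u : ℂ} (hu : ‖u‖ = 1) (c : ℂ) (y : E6) :
    massNorm m (relAction u c y).1 = massNorm m y.1 := by
  simp [relAction, massNorm_mul, hu]

theorem div_conj_of_norm_one {u : ℂ} (hu : ‖u‖ = 1) (x : ℂ) : x / (starRingEnd ℂ) u = u * x := by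
  have h := conj_mul_self_of_norm_one hu
  have h0 : (starRingEnd ℂ) u ≠ 0 := left_ne_zero_of_mul_eq_one h
  rw [div_eq_iff h0]
  linear_combination -x * h

/-- The hypothesis covers both uses: pure rotations (c = 0) anywhere, and arbitrary translations
where the Q's have sum zero, since then Re⟨P,Q⟩ is unchanged. -/
theorem relToSph_relAction {u : ℂ} (hu : ‖u‖ = 1) {c : ℂ} {y : E6} (h : c * tot y.1 = 0) :
    relToSph m (relAction u c y) = sphAction u c (relToSph m y) := by
  have h1 : (pairing (relAction u c y).2 (relAction u c y).1).re = (pairing y.2 y.1).re := by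
    rw [pairing_relAction hu]
    rcases mul_eq_zero.1 h with h | h <;> simp [h]
  simp only [relToSph, massNorm_relAction hu, h1]
  refine Prod.ext rfl (Prod.ext rfl (funext fun j => ?_))
  simp only [sphAction, div_conj_of_norm_one hu, Pi.sub_apply, Pi.smul_apply, Complex.real_smul,
    massDual]
  simp only [relAction]
  ring

/-- Normalizing |X| to 1 multiplies Y by |Q|, and so it multiplies the translation too. -/
theorem relToSphUnit_relAction {u : ℂ} (hu : ‖u‖ = 1) {c : ℂ} {y : E6}
    (h : tot y.1 = 0) :
    relToSphUnit m (relAction u c y) = sphAction u (massNorm m y.1 * c) (relToSphUnit m y) := by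
  rw [relToSphUnit, relToSph_relAction hu (by rw [h, mul_zero]), massNorm_relAction hu]
  simp only [relToSphUnit, realScaling, sphAction]
  refine Prod.ext rfl (Prod.ext (funext fun j => ?_) (funext fun j => ?_))
  · simp only [Pi.smul_apply, Complex.real_smul]; ring
  · simp only [Pi.smul_apply, Complex.real_smul, inv_inv]; ring

theorem isPartiallySymplectic_sphToRel (hm : ∀ i, 0 < m i) (μ : ℝ) :
    IsPartiallySymplectic (sphSystem (hamSph m) μ) (relSystem m μ) (sphToRel m) where
  smooth := ⟨sphPhase, isOpen_sphPhase, fun x hx => hx.1,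
    fun x hx => (contDiffAt_sphToRel hm hx).contDiffWithinAt⟩
  mapsTo z hz := by
    refine ⟨sphToRel_mem hm hz.1, ?_⟩
    rw [angMom_eq, pairing_sphToRel hm hz.1, hz.2]; simp
  equivariant := by
    rintro x hx _ hy ⟨k, hk, rfl⟩
    refine ⟨k / ‖k‖, norm_phase hk, ?_⟩
    rw [← sphAction_zero, sphToRel_sphAction hk, mul_zero, relAction_zero]
  symplectic := by
    rintro x hx v w ⟨γ, hγ, rfl, hγ'⟩ ⟨δ, hδ, hδ0, hδ'⟩
    -- Vectors tangent to the level annihilate d Re⟨Y,X⟩, so the correction to the pulled-back form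
    -- disappears on them.
    have h1 := dilationDeriv_eq_zero_of_curve hγ' fun t => ((pairing_eq_iff _ _ _).1 (hγ t).2).1
    have h2 := dilationDeriv_eq_zero_of_curve hδ' fun t => ((pairing_eq_iff _ _ _).1 (hδ t).2).1
    rw [hδ0] at h2
    have h3 := canonicalForm_fderiv_sphToRel hm hx.1 v w
    rw [h1, h2, mul_zero, zero_mul, add_zero, sub_zero] at h3
    exact h3

theorem isPartiallySymplectic_sphToRel_trans (hm : ∀ i, 0 < m i) (h : ESph → ℝ) (μ : ℝ) :
    IsPartiallySymplectic (sphTransSystem h μ) (relTransSystem m μ) (sphToRel m) where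
  smooth := ⟨sphPhase, isOpen_sphPhase, fun x hx => hx.1,
    fun x hx => (contDiffAt_sphToRel hm hx).contDiffWithinAt⟩
  mapsTo z hz := by
    refine ⟨sphToRel_mem hm hz.1, ?_, ?_⟩
    · rw [angMom_eq, pairing_sphToRel hm hz.1, hz.2.1]; simp
    · have := tot_mul ((z.1.1 / massNorm m z.2.1 : ℝ) : ℂ) z.2.1
      rw [hz.2.2, mul_zero] at this
      exact this
  equivariant := by
    rintro x hx _ hy ⟨k, c, hk, rfl⟩
    exact ⟨k / ‖k‖, _, norm_phase hk, sphToRel_sphAction hk c x⟩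
  symplectic := by
    rintro x hx v w ⟨γ, hγ, rfl, hγ'⟩ ⟨δ, hδ, hδ0, hδ'⟩
    have h1 := dilationDeriv_eq_zero_of_curve hγ' fun t =>
      ((pairing_eq_iff _ _ _).1 (hγ t).2.1).1
    have h2 := dilationDeriv_eq_zero_of_curve hδ' fun t =>
      ((pairing_eq_iff _ _ _).1 (hδ t).2.1).1
    rw [hδ0] at h2
    have h3 := canonicalForm_fderiv_sphToRel hm hx.1 v w
    rw [h1, h2, mul_zero, zero_mul, add_zero, sub_zero] at h3
    exact h3

theorem isPartiallySymplectic_relToSph (hm : ∀ i, 0 < m i) (μ : ℝ) :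
    IsPartiallySymplectic (relSystem m μ) (sphSystem (hamSph m) μ) (relToSph m) where
  smooth := ⟨relPhase, isOpen_relPhase, fun x hx => hx.1,
    fun x hx => (contDiffAt_relToSph hm hx).contDiffWithinAt⟩
  mapsTo y hy := by
    obtain ⟨h1, h2⟩ := pairing_relToSph hm hy.1
    refine ⟨relToSph_mem hm hy.1, (pairing_eq_iff _ _ _).2 ⟨h1, ?_⟩⟩
    rw [h2, ← hy.2, angMom_eq, neg_neg]
  equivariant := by
    rintro x hx _ hy ⟨u, hu, rfl⟩
    rw [← relAction_zero, relToSph_relAction hu (zero_mul _)]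
    exact orbitScaling_eq_sphAction u (by rintro rfl; simp at hu) _
  symplectic x hx v w _ _ :=
    (isLocalSection_relToSph hm hx.1).canonicalFormSph_fderiv_fderiv hm hx.1 v w

/-- A section of `sphToRel` that is equivariant on the level of `relTransSystem` is partially
symplectic. -/
theorem isPartiallySymplectic_section (hm : ∀ i, 0 < m i) (h : ESph → ℝ) (μ : ℝ) {H : E6 → ESph}
    (hs : ∀ y ∈ relPhase, IsLocalSection m H y)
    (hc : ∀ y ∈ relPhase, ContDiffAt ℝ (⊤ : ℕ∞) H y)
    (him : ∀ y ∈ relPhase, (pairing (H y).2.2 (H y).2.1).im = (pairing y.2 y.1).im)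
    (ht : ∀ y, tot y.1 = 0 → tot (H y).2.1 = 0)
    (he : ∀ y ∈ relPhase, tot y.1 = 0 → ∀ u c : ℂ, ‖u‖ = 1 →
      ∃ c', H (relAction u c y) = sphAction u c' (H y)) :
    IsPartiallySymplectic (relTransSystem m μ) (sphTransSystem h μ) H where
  smooth := ⟨relPhase, isOpen_relPhase, fun x hx => hx.1,
    fun x hx => (hc x hx).contDiffWithinAt⟩
  mapsTo y hy := by
    refine ⟨(hs y hy.1).mem, (pairing_eq_iff _ _ _).2 ⟨(hs y hy.1).dilation y hy.1, ?_⟩,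
      ht y hy.2.2⟩
    rw [him y hy.1, ← hy.2.1, angMom_eq, neg_neg]
  equivariant := by
    rintro x hx _ hy ⟨u, c, hu, rfl⟩
    obtain ⟨c', hc'⟩ := he x hx.1 hx.2.2 u c hu
    exact ⟨u, c', by rintro rfl; simp at hu, hc'⟩
  symplectic x hx v w _ _ := (hs x hx.1).canonicalFormSph_fderiv_fderiv hm hx.1 v w

theorem differentiableAt_sphToRel (hm : ∀ i, 0 < m i) {z : ESph} (hz : z ∈ sphPhase) :
    DifferentiableAt ℝ (sphToRel m) z :=
  (contDiffAt_sphToRel hm (k := 1) hz).differentiableAt (by simp)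

theorem sphSystem_hamSph_hasQuotientFlow (hm : ∀ i, 0 < m i) (μ : ℝ) :
    (sphSystem (hamSph m) μ).HasQuotientFlow :=
  hasQuotientFlow_sphSystem μ (fun _ hz => differentiableAt_hamSph hm hz)
    fun _ hk c z => hamSph_sphAction hk c z

theorem sphTransSystem_hamSph_hasQuotientFlow (hm : ∀ i, 0 < m i) (μ : ℝ) :
    (sphTransSystem (hamSph m) μ).HasQuotientFlow :=
  hasQuotientFlow_sphTransSystem μ (fun _ hz => differentiableAt_hamSph hm hz)
    fun _ hk c z => hamSph_sphAction hk c z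

theorem sphTransSystem_hamSphExplicit_hasQuotientFlow (hm : ∀ i, 0 < m i) (μ : ℝ) :
    (sphTransSystem (hamSphExplicit m) μ).HasQuotientFlow :=
  hasQuotientFlow_sphTransSystem μ (fun _ hz => differentiableAt_hamSphExplicit hm hz)
    fun _ hk c z => hamSphExplicit_sphAction hk c z

theorem hamSph_relToSph (hm : ∀ i, 0 < m i) {y : E6} (hy : y ∈ relPhase) :
    hamSph m (relToSph m y) = hamRel m y := by rw [hamSph, sphToRel_relToSph hm hy]

/-- Reduction by complex scaling is equivalent to reduction by rotations. -/
theorem equivalent_sphSystem_relSystem (hm : ∀ i, 0 < m i) (μ : ℝ) :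
    (sphSystem (hamSph m) μ).Equivalent (relSystem m μ) := by
  have hS := sphSystem_hamSph_hasQuotientFlow hm μ
  have hR := hasQuotientFlow_relSystem m μ
  refine equivalent_of_flow hS hR (isPartiallySymplectic_sphToRel hm μ)
    (isPartiallySymplectic_relToSph hm μ) (fun x hx => ?_) (fun y hy => ?_) (fun x hx => rfl)
    (fun y hy => hamSph_relToSph hm hy.1) (fun t x hx y hf => ?_) (fun t x hx y hf => ?_)
  · rw [relToSph_sphToRel hm hx.1 ((pairing_eq_iff _ _ _).1 hx.2).1, realScaling_eq_sphAction]
    exact Setoid.symm' _ (orbitScaling_eq_sphAction _ (by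
      exact_mod_cast (div_pos hx.1.1 (massNorm_pos hm hx.1.2)).ne') _)
  · rw [sphToRel_relToSph hm hy.1]
  · refine ⟨_, Setoid.refl' _ _, Flow.map_of_level hS
      (fun z hz => differentiableAt_sphToRel hm hz.1) (fun z hz => sphToRel_mem hm hz.1)
      (fun z hz v hv => ?_) hx hf⟩
    exact isHamiltonianVector_sphToRel hm μ hz.1 ((pairing_eq_iff _ _ _).1 hz.2).1 hv
  · refine ⟨_, Setoid.refl' _ _, Flow.map_of_level hR
      (fun z hz => (isLocalSection_relToSph hm hz.1).differentiableAt)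
      (fun z hz => relToSph_mem hm hz.1) (fun z hz v hv => ?_) hx hf⟩
    exact isHamiltonianVector_relToSph hm μ hz.1 hv

/-- Reduction by complex scaling and translations is equivalent to reduction of `relTransSystem`. -/
theorem equivalent_sphTransSystem_relTransSystem (hm : ∀ i, 0 < m i) (μ : ℝ) :
    (sphTransSystem (hamSph m) μ).Equivalent (relTransSystem m μ) := by
  have hS := sphTransSystem_hamSph_hasQuotientFlow hm μ
  have hR := hasQuotientFlow_relTransSystem m μ
  refine equivalent_of_flow (G := relToSph m) hS hR (isPartiallySymplectic_sphToRel_trans hm _ μ)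
    (isPartiallySymplectic_section hm _ μ (fun y hy => isLocalSection_relToSph hm hy)
      (fun y hy => contDiffAt_relToSph hm hy) (fun y hy => (pairing_relToSph hm hy).2)
      (fun y ht => ht) fun y hy ht u c hu =>
        ⟨c, relToSph_relAction hu (by rw [ht, mul_zero])⟩)
    (fun x hx => ?_) (fun y hy => ?_) (fun x hx => rfl)
    (fun y hy => hamSph_relToSph hm hy.1) (fun t x hx y hf => ?_) (fun t x hx y hf => ?_)
  · rw [relToSph_sphToRel hm hx.1 ((pairing_eq_iff _ _ _).1 hx.2.1).1, realScaling_eq_sphAction]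
    exact Setoid.symm' _ ⟨_, 0, by
      exact_mod_cast (div_pos hx.1.1 (massNorm_pos hm hx.1.2)).ne', rfl⟩
  · rw [sphToRel_relToSph hm hy.1]
  · refine ⟨_, Setoid.refl' _ _, Flow.map_of_level hS
      (fun z hz => differentiableAt_sphToRel hm hz.1) (fun z hz => sphToRel_mem hm hz.1)
      (fun z hz v hv => ?_) hx hf⟩
    exact isHamiltonianVector_sphToRel hm μ hz.1 ((pairing_eq_iff _ _ _).1 hz.2.1).1 hv
  · refine ⟨_, Setoid.refl' _ _, Flow.map_of_level hR
      (fun z hz => (isLocalSection_relToSph hm hz.1).differentiableAt)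
      (fun z hz => relToSph_mem hm hz.1) (fun z hz v hv => ?_) hx hf⟩
    exact isHamiltonianVector_relToSph hm μ hz.1 hv

theorem continuous_massMoment : Continuous (massMoment m) := by
  unfold massMoment; fun_prop

theorem continuousOn_massNorm (hm : ∀ i, 0 < m i) :
    ContinuousOn (fun z : ESph => massNorm m z.2.1) sphPhase := fun z hz =>
  ((contDiffAt_massNorm hm (k := 1) hz.2).continuousAt.comp (f := fun z : ESph => z.2.1)
    (by fun_prop)).continuousWithinAt

theorem continuousOn_relGauge (hm : ∀ i, 0 < m i) : ContinuousOn (relGauge m) sphPhase := by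
  have hr : ContinuousOn (fun z : ESph => z.1.1) sphPhase := by fun_prop
  have hp : ContinuousOn (fun z : ESph => z.1.2) sphPhase := by fun_prop
  have h0 : ∀ z ∈ sphPhase, z.1.1 ≠ 0 := fun z hz => hz.1.ne'
  have hM : ContinuousOn (fun z : ESph => massMoment m z.2.2) sphPhase :=
    (continuous_massMoment.comp (by fun_prop)).continuousOn
  exact (Complex.continuous_ofReal.comp_continuousOn
    (((hp.div hr h0).div_const _).mul ((continuousOn_massNorm hm).div hr h0))).mul hM

theorem continuousOn_sphGauge : ContinuousOn (sphGauge m) sphPhase := by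
  have hr : ContinuousOn (fun z : ESph => z.1.1) sphPhase := by fun_prop
  have hp : ContinuousOn (fun z : ESph => z.1.2) sphPhase := by fun_prop
  have h0 : ∀ z ∈ sphPhase, z.1.1 ≠ 0 := fun z hz => hz.1.ne'
  have hM : ContinuousOn (fun z : ESph => massMoment m z.2.2) sphPhase :=
    (continuous_massMoment.comp (by fun_prop)).continuousOn
  exact ((Complex.continuous_ofReal.comp_continuousOn ((hp.div hr h0).div_const _)).mul hM).neg

theorem tot_relToSphUnit {y : E6} (ht : tot y.1 = 0) : tot (relToSphUnit m y).2.1 = 0 := by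
  have := tot_mul (((massNorm m y.1)⁻¹ : ℝ) : ℂ) y.1
  rw [ht, mul_zero] at this
  exact this

/-- Reduction of the explicit Hamiltonian by complex scaling and translations is equivalent to
reduction of `relTransSystem`. -/
theorem equivalent_sphTransSystem_explicit_relTransSystem (hm : ∀ i, 0 < m i) (μ : ℝ) :
    (sphTransSystem (hamSphExplicit m) μ).Equivalent (relTransSystem m μ) := by
  have hS := sphTransSystem_hamSphExplicit_hasQuotientFlow hm μ
  have hR := hasQuotientFlow_relTransSystem m μ
  refine equivalent_of_flow (G := relToSphUnit m) hS hR
    (isPartiallySymplectic_sphToRel_trans hm _ μ)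
    (isPartiallySymplectic_section hm _ μ (fun y hy => isLocalSection_relToSphUnit hm hy)
      (fun y hy => contDiffAt_relToSphUnit hm hy) (fun y hy => (pairing_relToSphUnit hm hy).2)
      (fun y ht => tot_relToSphUnit ht) fun y hy ht u c hu =>
        ⟨_, relToSphUnit_relAction hu ht⟩)
    (fun x hx => ?_) (fun y hy => ?_)
    (fun x hx => (hamSphExplicit_eq_hamSph hm hx.1 ((pairing_eq_iff _ _ _).1 hx.2.1).1
      hx.2.2).symm) (fun y hy => ?_) (fun t x hx y hf => ?_) (fun t x hx y hf => ?_)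
  · have hρ := div_pos hx.1.1 (massNorm_pos hm hx.1.2)
    have hn := inv_pos.2 (massNorm_pos hm (sphToRel_mem hm hx.1))
    rw [relToSphUnit, relToSph_sphToRel hm hx.1 ((pairing_eq_iff _ _ _).1 hx.2.1).1,
      realScaling_realScaling, realScaling_eq_sphAction]
    exact Setoid.symm' _ ⟨_, 0, by exact_mod_cast (mul_pos hn hρ).ne', rfl⟩
  · rw [sphToRel_relToSphUnit hm hy.1]
  · change hamSphExplicit m (relToSphUnit m y) = hamRel m y
    rw [hamSphExplicit_eq_hamSph hm (relToSphUnit_mem hm hy.1) (pairing_relToSphUnit hm hy.1).1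
      (tot_relToSphUnit hy.2.2), hamSph, sphToRel_relToSphUnit hm hy.1]
  · obtain ⟨c, hc⟩ := Flow.map_gauge (S₁ := sphTransSystem (hamSphExplicit m) μ)
      (S₂ := relTransSystem m μ) (Φ := sphToRel m) relTranslation (relGauge m) hS
      (fun z hz => differentiableAt_sphToRel hm hz.1) (fun z hz => sphToRel_mem hm hz.1)
      ((continuousOn_relGauge hm).mono fun z hz => hz.1)
      (fun z hz v hv => isHamiltonianVector_sphToRel_explicit hm μ hz.1
        ((pairing_eq_iff _ _ _).1 hz.2.1).1 hz.2.2 hv)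
      (fun x hx c j => by simpa [relTranslation_apply] using hx j)
      (fun x hx c v hv => isHamiltonianVector_add_relTranslation μ c hv) hx hf
    -- The accumulated gauge is a group element, so it is invisible in the quotient.
    exact ⟨_, ⟨1, c, by simp, add_relTranslation _ _⟩, hc⟩
  · obtain ⟨c, hc⟩ := Flow.map_gauge (S₁ := relTransSystem m μ)
      (S₂ := sphTransSystem (hamSphExplicit m) μ) (Φ := relToSphUnit m) sphTranslation
      (fun y => sphGauge m (relToSphUnit m y)) hR
      (fun z hz => (isLocalSection_relToSphUnit hm hz.1).differentiableAt)
      (fun z hz => relToSphUnit_mem hm hz.1)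
      (continuousOn_sphGauge.comp
        (fun z hz => (isLocalSection_relToSphUnit hm
          hz.1).differentiableAt.continuousAt.continuousWithinAt)
        fun z hz => relToSphUnit_mem hm hz.1)
      (fun z hz v hv => isHamiltonianVector_relToSphUnit hm μ hz.1 hz.2.2 hv)
      (fun x hx c => by simpa [sphTranslation_apply, sphTransSystem] using hx)
      (fun x hx c v hv => isHamiltonianVector_add_sphTranslation μ
        (fun k hk c z => hamSphExplicit_sphAction hk c z) c hv) hx hf
    exact ⟨_, ⟨1, c, one_ne_zero, add_sphTranslation _ _⟩, hc⟩

/-! ### Relative variables and the variables of the three bodies -/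

/-- The relative positions `(q₁ - q₂, q₃ - q₁, q₂ - q₃)`. -/
def differences (q : C3) : C3 := ![q 0 - q 1, q 2 - q 0, q 1 - q 2]

/-- The momenta of the bodies, transpose of `differences`. -/
def bodyMomenta (P : C3) : C3 := ![P 0 - P 1, P 2 - P 0, P 1 - P 2]

/-- The positions with center of mass `0`. -/
def centeredPositions (m : Fin 3 → ℝ) (Q : C3) : C3 :=
  ![(m 1 * Q 0 - m 2 * Q 1) / totalMass m, (m 2 * Q 2 - m 0 * Q 0) / totalMass m,
    (m 0 * Q 1 - m 1 * Q 2) / totalMass m]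

/-- Relative momenta, transpose of `centeredPositions`. -/
def relativeMomenta (m : Fin 3 → ℝ) (p : C3) : C3 :=
  ![(m 1 * p 0 - m 0 * p 1) / totalMass m, (m 0 * p 2 - m 2 * p 0) / totalMass m,
    (m 2 * p 1 - m 1 * p 2) / totalMass m]

/-- From relative variables to the variables of the bodies. -/
def relToBody (m : Fin 3 → ℝ) : E6 →L[ℝ] E6 :=
  LinearMap.toContinuousLinearMap
    { toFun := fun x => (centeredPositions m x.1, bodyMomenta x.2)
      map_add' := fun x y => by
        refine Prod.ext (funext fun j => ?_) (funext fun j => ?_) <;> fin_cases j <;>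
          simp [centeredPositions, bodyMomenta] <;> ring
      map_smul' := fun a x => by
        refine Prod.ext (funext fun j => ?_) (funext fun j => ?_) <;> fin_cases j <;>
          simp [centeredPositions, bodyMomenta] <;> ring }

/-- From the variables of the bodies to relative variables. -/
def bodyToRel (m : Fin 3 → ℝ) : E6 →L[ℝ] E6 :=
  LinearMap.toContinuousLinearMap
    { toFun := fun x => (differences x.1, relativeMomenta m x.2)
      map_add' := fun x y => by
        refine Prod.ext (funext fun j => ?_) (funext fun j => ?_) <;> fin_cases j <;>
          simp [differences, relativeMomenta] <;> ring
      map_smul' := fun a x => by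
        refine Prod.ext (funext fun j => ?_) (funext fun j => ?_) <;> fin_cases j <;>
          simp [differences, relativeMomenta] <;> ring }

theorem relToBody_apply (x : E6) :
    relToBody m x = (centeredPositions m x.1, bodyMomenta x.2) := rfl

theorem bodyToRel_apply (x : E6) :
    bodyToRel m x = (differences x.1, relativeMomenta m x.2) := rfl

theorem pairing_bodyMomenta (P q : C3) : pairing (bodyMomenta P) q = pairing P (differences q) := by
  simp only [pairing, Fin.sum_univ_three, bodyMomenta, differences]
  simp
  ring

theorem pairing_relativeMomenta (p Q : C3) :
    pairing (relativeMomenta m p) Q = pairing p (centeredPositions m Q) := by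
  simp only [pairing, Fin.sum_univ_three, relativeMomenta, centeredPositions]
  simp
  ring

/-- The momentum maps are the transposes of the position maps. Neither linear map is invertible, but
adjointness together with being inverse modulo translations takes the place of being symplectic. -/
theorem canonicalForm_bodyToRel (v w : E6) :
    canonicalForm (bodyToRel m v) w = canonicalForm v (relToBody m w) := by
  simp only [canonicalForm, bodyToRel_apply, relToBody_apply, pairing_bodyMomenta,
    pairing_relativeMomenta]

theorem canonicalForm_swap (v w : E6) : canonicalForm v w = -canonicalForm w v := by
  simp only [canonicalForm]; ring

theorem canonicalForm_relToBody (v w : E6) :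
    canonicalForm (relToBody m v) w = canonicalForm v (bodyToRel m w) := by
  rw [canonicalForm_swap, ← canonicalForm_bodyToRel, canonicalForm_swap, neg_neg]

/-- The vector `s / m (m₃, m₂, m₁)`. -/
def massShift (m : Fin 3 → ℝ) : ℂ →L[ℝ] C3 :=
  ContinuousLinearMap.pi fun j =>
    (![m 2, m 1, m 0] j / totalMass m) • ContinuousLinearMap.id ℝ ℂ

theorem massShift_apply (s : ℂ) (j : Fin 3) :
    massShift m s j = (![m 2, m 1, m 0] j / totalMass m : ℝ) * s := rfl

theorem totalMass_complex_ne_zero (hm : ∀ i, 0 < m i) : (m 0 + m 1 + m 2 : ℂ) ≠ 0 := by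
  have := (totalMass_pos hm).ne'
  rw [totalMass_eq] at this
  exact_mod_cast this

/-- In this and the next three lemmas each composite is the identity up to a term that either
vanishes on the zero-sum constraint or is a translation (c,c,c). -/
theorem differences_centeredPositions (hm : ∀ i, 0 < m i) (Q : C3) :
    differences (centeredPositions m Q) = Q - massShift m (tot Q) := by
  have h := totalMass_complex_ne_zero hm
  funext j
  rw [Pi.sub_apply, massShift_apply, tot, Fin.sum_univ_three]
  fin_cases j <;> simp [differences, centeredPositions, totalMass_eq] <;> field_simp <;> ring

theorem bodyMomenta_relativeMomenta (hm : ∀ i, 0 < m i) (p : C3) :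
    bodyMomenta (relativeMomenta m p) =
      fun j => p j - m j / totalMass m * tot p := by
  have h := totalMass_complex_ne_zero hm
  funext j
  rw [tot, Fin.sum_univ_three]
  fin_cases j <;> simp [bodyMomenta, relativeMomenta, totalMass_eq] <;> field_simp <;> ring

theorem centeredPositions_differences (hm : ∀ i, 0 < m i) (q : C3) :
    centeredPositions m (differences q) =
      q + diagL (-((m 0 * q 0 + m 1 * q 1 + m 2 * q 2) / totalMass m)) := by
  have h := totalMass_complex_ne_zero hm
  funext j
  rw [Pi.add_apply, diagL_apply]
  fin_cases j <;> simp [differences, centeredPositions, totalMass_eq] <;> field_simp <;> ring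

theorem relativeMomenta_bodyMomenta (hm : ∀ i, 0 < m i) (P : C3) :
    relativeMomenta m (bodyMomenta P) = P + diagL (-(massMoment m P / totalMass m)) := by
  have h := totalMass_complex_ne_zero hm
  funext j
  rw [Pi.add_apply, diagL_apply]
  fin_cases j <;> simp [bodyMomenta, relativeMomenta, totalMass_eq, massMoment] <;> field_simp <;>
    ring

theorem tot_differences (q : C3) : tot (differences q) = 0 := by
  simp [tot, Fin.sum_univ_three, differences]

theorem tot_bodyMomenta (P : C3) : tot (bodyMomenta P) = 0 := by
  simp [tot, Fin.sum_univ_three, bodyMomenta]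

theorem bodyToRel_relToBody (hm : ∀ i, 0 < m i) {x : E6} (hx : tot x.1 = 0) :
    bodyToRel m (relToBody m x) = x + relTranslation (-(massMoment m x.2 / totalMass m)) := by
  rw [relToBody_apply, bodyToRel_apply, differences_centeredPositions hm,
    relativeMomenta_bodyMomenta hm, hx, map_zero, sub_zero]
  exact Prod.ext (add_zero _).symm rfl

/-- The infinitesimal translations of the positions. -/
def bodyTranslation : ℂ →L[ℝ] E6 := diagL.prod (0 : ℂ →L[ℝ] C3)

theorem bodyTranslation_apply (c : ℂ) : bodyTranslation c = (diagL c, 0) := rfl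

theorem add_bodyTranslation (x : E6) (c : ℂ) : x + bodyTranslation c = bodyAction 1 c x := by
  refine Prod.ext (funext fun j => ?_) (funext fun j => ?_) <;>
    simp [bodyTranslation_apply, diagL_apply, bodyAction]

theorem relToBody_bodyToRel (hm : ∀ i, 0 < m i) {x : E6} (hx : tot x.2 = 0) :
    ∃ c, relToBody m (bodyToRel m x) = x + bodyTranslation c := by
  refine ⟨-((m 0 * x.1 0 + m 1 * x.1 1 + m 2 * x.1 2) / totalMass m), ?_⟩
  rw [relToBody_apply, bodyToRel_apply, centeredPositions_differences hm,
    bodyMomenta_relativeMomenta hm, hx]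
  refine Prod.ext rfl ?_
  simp [bodyTranslation_apply]

theorem mem_bodyPhase_iff (x : E6) : x ∈ bodyPhase ↔ ∀ j, differences x.1 j ≠ 0 := by
  constructor
  · intro h j
    fin_cases j
    · exact sub_ne_zero.2 (h 0 1 (by decide))
    · exact sub_ne_zero.2 (h 2 0 (by decide))
    · exact sub_ne_zero.2 (h 1 2 (by decide))
  · intro h
    have h0 : x.1 0 ≠ x.1 1 := sub_ne_zero.1 (h 0)
    have h1 : x.1 2 ≠ x.1 0 := sub_ne_zero.1 (h 1)
    have h2 : x.1 1 ≠ x.1 2 := sub_ne_zero.1 (h 2)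
    intro i j hij
    fin_cases i <;> fin_cases j <;> first | exact absurd rfl hij | assumption | (symm; assumption)

theorem relToBody_mem (hm : ∀ i, 0 < m i) {x : E6} (hx : x ∈ relPhase) (ht : tot x.1 = 0) :
    relToBody m x ∈ bodyPhase := by
  rw [mem_bodyPhase_iff, relToBody_apply, differences_centeredPositions hm, ht, map_zero, sub_zero]
  exact hx

theorem bodyToRel_mem {x : E6} (hx : x ∈ bodyPhase) : bodyToRel m x ∈ relPhase :=
  (mem_bodyPhase_iff x).1 hx

theorem pairing_relToBody (hm : ∀ i, 0 < m i) {x : E6} (ht : tot x.1 = 0) :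
    pairing (relToBody m x).2 (relToBody m x).1 = pairing x.2 x.1 := by
  rw [relToBody_apply, pairing_bodyMomenta, differences_centeredPositions hm, ht, map_zero,
    sub_zero]

theorem pairing_bodyToRel (hm : ∀ i, 0 < m i) {x : E6} (ht : tot x.2 = 0) :
    pairing (bodyToRel m x).2 (bodyToRel m x).1 = pairing x.2 x.1 := by
  rw [bodyToRel_apply, ← pairing_bodyMomenta, bodyMomenta_relativeMomenta hm, ht]
  simp

theorem relToBody_relAction (u c : ℂ) (x : E6) :
    relToBody m (relAction u c x) = bodyAction u 0 (relToBody m x) := by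
  refine Prod.ext (funext fun j => ?_) (funext fun j => ?_) <;> fin_cases j <;>
    simp [relToBody_apply, relAction, bodyAction, centeredPositions, bodyMomenta] <;> ring

theorem bodyToRel_bodyAction (u c : ℂ) (x : E6) :
    bodyToRel m (bodyAction u c x) = relAction u 0 (bodyToRel m x) := by
  refine Prod.ext (funext fun j => ?_) (funext fun j => ?_) <;> fin_cases j <;>
    simp [bodyToRel_apply, relAction, bodyAction, differences, relativeMomenta] <;> ring

/-! ### The Hamiltonians -/

theorem hamBody_eq (x : E6) :
    hamBody m x = (‖x.2 0‖ ^ 2 / (2 * m 0) + ‖x.2 1‖ ^ 2 / (2 * m 1) + ‖x.2 2‖ ^ 2 / (2 * m 2)) -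
      potRel m (differences x.1) := by
  simp [hamBody, potRel, Fin.sum_univ_three, pairMass, differences]

/-- Positions of bodies see only the part of Q of sum zero. The discrepancy with `hamRel` is of
first order in the sum of the Q's, and it is what forces a gauge in `isHamiltonianVector_bodyToRel`.
-/
theorem hamBody_relToBody (hm : ∀ i, 0 < m i) (x : E6) :
    hamBody m (relToBody m x) = hamRel m (x.1 - massShift m (tot x.1), x.2) := by
  rw [hamBody_eq, relToBody_apply, differences_centeredPositions hm]
  rfl

theorem real_kinetic (hm : ∀ i, 0 < m i) (p : Fin 3 → ℝ) :
    (p 0 - m 0 / (m 0 + m 1 + m 2) * (p 0 + p 1 + p 2)) ^ 2 / (2 * m 0) +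
      (p 1 - m 1 / (m 0 + m 1 + m 2) * (p 0 + p 1 + p 2)) ^ 2 / (2 * m 1) +
      (p 2 - m 2 / (m 0 + m 1 + m 2) * (p 0 + p 1 + p 2)) ^ 2 / (2 * m 2) =
    p 0 ^ 2 / (2 * m 0) + p 1 ^ 2 / (2 * m 1) + p 2 ^ 2 / (2 * m 2) -
      (p 0 + p 1 + p 2) ^ 2 / (2 * (m 0 + m 1 + m 2)) := by
  have h0 := (hm 0).ne'
  have h1 := (hm 1).ne'
  have h2 := (hm 2).ne'
  have hs : m 0 + m 1 + m 2 ≠ 0 := (add_pos (add_pos (hm 0) (hm 1)) (hm 2)).ne'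
  field_simp
  ring

/-- König's decomposition: relative momenta lose the kinetic energy of the centre of mass. This is
quadratic in the total momentum, so it does not affect differentials at total momentum zero. -/
theorem hamRel_bodyToRel (hm : ∀ i, 0 < m i) (x : E6) :
    hamRel m (bodyToRel m x) = hamBody m x -
      ((tot x.2).re ^ 2 + (tot x.2).im ^ 2) / (2 * totalMass m) := by
  have hK : kinRel m (relativeMomenta m x.2) =
      (‖bodyMomenta (relativeMomenta m x.2) 0‖ ^ 2 / (2 * m 0) +
        ‖bodyMomenta (relativeMomenta m x.2) 1‖ ^ 2 / (2 * m 1) +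
        ‖bodyMomenta (relativeMomenta m x.2) 2‖ ^ 2 / (2 * m 2)) := rfl
  have h1 := real_kinetic hm fun j => (x.2 j).re
  have h2 := real_kinetic hm fun j => (x.2 j).im
  have he : ∀ j, (x.2 j - m j / totalMass m * tot x.2 : ℂ) =
      x.2 j - ((m j / totalMass m : ℝ) : ℂ) * tot x.2 := fun j => by push_cast; rfl
  rw [hamBody_eq, hamRel, bodyToRel_apply]
  dsimp only
  rw [hK, bodyMomenta_relativeMomenta hm]
  simp only [he, norm_sq_eq_re_im, Complex.sub_re, Complex.sub_im, Complex.re_ofReal_mul,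
    Complex.im_ofReal_mul]
  simp only [tot, Fin.sum_univ_three, Complex.add_re, Complex.add_im, totalMass_eq]
  linear_combination h1 + h2

theorem hamBody_relToBody_of_tot (hm : ∀ i, 0 < m i) {x : E6} (ht : tot x.1 = 0) :
    hamBody m (relToBody m x) = hamRel m x := by
  rw [hamBody_relToBody hm, ht, map_zero, sub_zero]

theorem hamRel_bodyToRel_of_tot (hm : ∀ i, 0 < m i) {x : E6} (ht : tot x.2 = 0) :
    hamRel m (bodyToRel m x) = hamBody m x := by
  rw [hamRel_bodyToRel hm, ht]; simp

theorem fderiv_hamRel_bodyToRel (hm : ∀ i, 0 < m i) {y : E6} (hy : y ∈ bodyPhase)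
    (ht : tot y.2 = 0) (w : E6) :
    fderiv ℝ (hamRel m) (bodyToRel m y) (bodyToRel m w) = fderiv ℝ (hamBody m) y w := by
  have h1 := ((differentiableAt_hamRel (m := m)
    (bodyToRel_mem (m := m) hy)).hasFDerivAt.comp y (bodyToRel m).hasFDerivAt)
  have h2 := hasDerivAt_comp_line h1.differentiableAt w
  have hT := hasDerivAt_tot (hasDerivAt_snd (hasDerivAt_line y w))
  have hQ := (((hasDerivAt_re hT).pow 2).add ((hasDerivAt_im hT).pow 2)).div_const (2 * totalMass m)
  have hR := (hasDerivAt_comp_line (differentiableAt_hamBody (m := m) hy) w).sub hQ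
  have h3 := h2.unique (hR.congr_of_eventuallyEq
    (Filter.Eventually.of_forall fun t => hamRel_bodyToRel hm _))
  rw [h1.fderiv] at h3
  refine h3.trans ?_
  simp [ht]

theorem fderiv_hamBody_relToBody (hm : ∀ i, 0 < m i) {x : E6} (hx : x ∈ relPhase)
    (ht : tot x.1 = 0) (w : E6) :
    fderiv ℝ (hamBody m) (relToBody m x) (relToBody m w) =
      fderiv ℝ (hamRel m) x (w - (massShift m (tot w.1), 0)) := by
  have h1 := hasDerivAt_comp_line ((differentiableAt_hamBody (m := m)
    (relToBody_mem hm hx ht)).hasFDerivAt.comp x (relToBody m).hasFDerivAt).differentiableAt w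
  rw [((differentiableAt_hamBody (m := m)
    (relToBody_mem hm hx ht)).hasFDerivAt.comp x (relToBody m).hasFDerivAt).fderiv] at h1
  have h2 := hasDerivAt_comp_line (differentiableAt_hamRel (m := m) hx)
    (w - (massShift m (tot w.1), 0))
  refine h1.unique (h2.congr_of_eventuallyEq (Filter.Eventually.of_forall fun t => ?_))
  refine (hamBody_relToBody hm _).trans ?_
  have h3 : tot (x + t • w).1 = t • tot w.1 := by
    have : tot (x.1 + t • w.1) = tot x.1 + t • tot w.1 := by
      simp [tot, Finset.sum_add_distrib, Finset.mul_sum]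
    rw [ht, zero_add] at this
    exact this
  rw [h3, map_smul]
  congr 1
  refine Prod.ext ?_ ?_
  · simp [smul_sub, add_sub_assoc]
  · simp

theorem fderiv_hamRel_add_relTranslation (x : E6) (c : ℂ) :
    fderiv ℝ (hamRel m) (x + relTranslation c) = fderiv ℝ (hamRel m) x := by
  rw [← fderiv_comp_add_right]
  congr 1
  funext x
  rw [add_relTranslation, hamRel_relAction (by simp)]

theorem fderiv_hamBody_add_bodyTranslation (x : E6) (c : ℂ) :
    fderiv ℝ (hamBody m) (x + bodyTranslation c) = fderiv ℝ (hamBody m) x := by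
  rw [← fderiv_comp_add_right]
  congr 1
  funext x
  rw [add_bodyTranslation, hamBody_bodyAction (by simp)]

/-! ### Transport of Hamiltonian vectors -/

/-- By adjointness, testing on w amounts to testing `v` on `bodyToRel m w`. No gauge appears,
because the Hamiltonians agree to first order at total momentum zero. -/
theorem isHamiltonianVector_relToBody (hm : ∀ i, 0 < m i) (μ : ℝ) {x v : E6}
    (hx : x ∈ relPhase) (ht : tot x.1 = 0) (hv : (relSystem m μ).IsHamiltonianVector x v) :
    (bodySystem m μ).IsHamiltonianVector (relToBody m x) (relToBody m v) := by
  intro w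
  have h1 : canonicalForm v (bodyToRel m w) = fderiv ℝ (hamRel m) x (bodyToRel m w) := hv _
  have h2 := fderiv_hamRel_bodyToRel hm (relToBody_mem hm hx ht) (tot_bodyMomenta x.2) w
  rw [bodyToRel_relToBody hm ht, fderiv_hamRel_add_relTranslation, ← h1,
    ← canonicalForm_relToBody] at h2
  exact h2

/-- The translation gauge of `bodyToRel`. -/
def bodyGauge (m : Fin 3 → ℝ) (x : E6) : ℂ :=
  -⟨fderiv ℝ (hamRel m) x (massShift m 1, 0), fderiv ℝ (hamRel m) x (massShift m Complex.I, 0)⟩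

/-- The gauge represents the real linear functional s ↦ dH(`massShift m s`, 0) by the real inner
product of ℂ; its two coordinates are the values at 1 and i. -/
theorem bodyGauge_spec (x : E6) (s : ℂ) :
    ((starRingEnd ℂ) (bodyGauge m x) * s).re = -fderiv ℝ (hamRel m) x (massShift m s, 0) := by
  have h : ((massShift m s, 0) : E6) =
      s.re • (massShift m 1, 0) + s.im • (massShift m Complex.I, 0) := by
    refine Prod.ext ?_ ?_
    · have : s = s.re • (1 : ℂ) + s.im • Complex.I := by simp
      conv_lhs => rw [this]
      simp only [map_add, map_smul]
      rfl
    · simp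
  rw [h, map_add, map_smul, map_smul]
  simp [bodyGauge]
  ring

/-- The test vector w may leave the zero-sum subspace. The resulting defect of dH depends only on
the sum of the position part of w, hence is the contraction of ω with a momentum translation. -/
theorem isHamiltonianVector_bodyToRel (hm : ∀ i, 0 < m i) (μ : ℝ) {y v : E6}
    (hy : y ∈ bodyPhase) (ht : tot y.2 = 0) (hv : (bodySystem m μ).IsHamiltonianVector y v) :
    (relSystem m μ).IsHamiltonianVector (bodyToRel m y)
      (bodyToRel m v + relTranslation (bodyGauge m (bodyToRel m y))) := by
  intro w
  have h1 : canonicalForm v (relToBody m w) = fderiv ℝ (hamBody m) y (relToBody m w) := hv _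
  obtain ⟨c, hc⟩ := relToBody_bodyToRel hm ht
  have h2 := fderiv_hamBody_relToBody hm (bodyToRel_mem (m := m) hy) (tot_differences y.1) w
  rw [hc, fderiv_hamBody_add_bodyTranslation, map_sub] at h2
  have h3 : canonicalForm (bodyToRel m v + relTranslation (bodyGauge m (bodyToRel m y))) w =
      fderiv ℝ (hamRel m) (bodyToRel m y) w := by
    rw [canonicalForm_add_relTranslation, canonicalForm_bodyToRel, h1, h2, bodyGauge_spec]
    ring
  exact h3

theorem continuousOn_bodyGauge : ContinuousOn (bodyGauge m) relPhase := by
  have h : ContDiffOn ℝ 1 (hamRel m) relPhase := fun x hx =>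
    (contDiffAt_hamRel hx).contDiffWithinAt
  have h1 := h.continuousOn_fderiv_of_isOpen isOpen_relPhase le_rfl
  have h2 : ∀ v, ContinuousOn (fun x => fderiv ℝ (hamRel m) x v) relPhase := fun v =>
    h1.clm_apply continuousOn_const
  have h3 : bodyGauge m = fun x =>
      -(((fderiv ℝ (hamRel m) x (massShift m 1, 0) : ℝ) : ℂ) +
        (fderiv ℝ (hamRel m) x (massShift m Complex.I, 0) : ℝ) * Complex.I) := by
    funext x
    rw [bodyGauge, Complex.mk_eq_add_mul_I]
  rw [h3]
  exact ((Complex.continuous_ofReal.comp_continuousOn (h2 _)).add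
    ((Complex.continuous_ofReal.comp_continuousOn (h2 _)).mul continuousOn_const)).neg

/-! ### Equivalence of relative and absolute variables -/

theorem isPartiallySymplectic_relToBody (hm : ∀ i, 0 < m i) (μ : ℝ) :
    IsPartiallySymplectic (relTransSystem m μ) (bodySystem m μ) (relToBody m) where
  smooth := ⟨Set.univ, isOpen_univ, Set.subset_univ _, (relToBody m).contDiff.contDiffOn⟩
  mapsTo x hx := by
    refine ⟨relToBody_mem hm hx.1 hx.2.2, tot_bodyMomenta _, ?_⟩
    rw [← hx.2.1, angMom_eq, angMom_eq, pairing_relToBody hm hx.2.2]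
  equivariant := by
    rintro x hx _ hy ⟨u, c, hu, rfl⟩
    exact ⟨u, 0, hu, relToBody_relAction u c x⟩
  symplectic := by
    have key : ∀ x v, (relTransSystem m μ).IsTangent x v → tot v.1 = 0 := by
      rintro x v ⟨γ, hγ, rfl, hγ'⟩
      have h1 := hasDerivAt_tot (hasDerivAt_fst hγ')
      rw [show (fun t => tot (γ t).1) = fun _ => 0 from funext fun t => (hγ t).2.2] at h1
      exact h1.unique (hasDerivAt_const _ _)
    intro x hx v w hv hw
    rw [ContinuousLinearMap.fderiv]
    change canonicalForm (relToBody m v) (relToBody m w) = canonicalForm v w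
    -- Adjointness leaves ω(v + translation, w), and the translation pairs to zero with `w`, whose
    -- position part has sum zero.
    rw [← canonicalForm_bodyToRel, bodyToRel_relToBody hm (key x v hv),
      canonicalForm_add_relTranslation, key x w hw, mul_zero, Complex.zero_re, sub_zero]

theorem canonicalForm_add_bodyTranslation (v w : E6) (c : ℂ) :
    canonicalForm (v + bodyTranslation c) w =
      canonicalForm v w + ((starRingEnd ℂ) (tot w.2) * c).re := by
  simp only [canonicalForm, bodyTranslation_apply, Prod.fst_add, Prod.snd_add, pairing_add_right,
    add_zero, pairing_diagL_right, Complex.add_re]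
  ring

theorem isPartiallySymplectic_bodyToRel (hm : ∀ i, 0 < m i) (μ : ℝ) :
    IsPartiallySymplectic (bodySystem m μ) (relTransSystem m μ) (bodyToRel m) where
  smooth := ⟨Set.univ, isOpen_univ, Set.subset_univ _, (bodyToRel m).contDiff.contDiffOn⟩
  mapsTo x hx := by
    refine ⟨bodyToRel_mem (m := m) hx.1, ?_, tot_differences _⟩
    rw [← hx.2.2, angMom_eq, angMom_eq, pairing_bodyToRel hm hx.2.1]
  equivariant := by
    rintro x hx _ hy ⟨u, c, hu, rfl⟩
    exact ⟨u, 0, hu, bodyToRel_bodyAction u c x⟩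
  symplectic := by
    have key : ∀ x v, (bodySystem m μ).IsTangent x v → tot v.2 = 0 := by
      rintro x v ⟨γ, hγ, rfl, hγ'⟩
      have h1 := hasDerivAt_tot (hasDerivAt_snd hγ')
      rw [show (fun t => tot (γ t).2) = fun _ => 0 from funext fun t => (hγ t).2.1] at h1
      exact h1.unique (hasDerivAt_const _ _)
    intro x hx v w hv hw
    obtain ⟨c, hc⟩ := relToBody_bodyToRel hm (key x v hv)
    rw [ContinuousLinearMap.fderiv]
    change canonicalForm (bodyToRel m v) (bodyToRel m w) = canonicalForm v w
    rw [← canonicalForm_relToBody, hc, canonicalForm_add_bodyTranslation, key x w hw, map_zero,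
      zero_mul, Complex.zero_re, add_zero]

/-- The reduced three-body problem in relative and in absolute variables. -/
theorem equivalent_relTransSystem_bodySystem (hm : ∀ i, 0 < m i) (μ : ℝ) :
    (relTransSystem m μ).Equivalent (bodySystem m μ) := by
  have hR := hasQuotientFlow_relTransSystem m μ
  have hB := hasQuotientFlow_bodySystem m μ
  refine equivalent_of_flow hR hB (isPartiallySymplectic_relToBody hm μ)
    (isPartiallySymplectic_bodyToRel hm μ) (fun x hx => ?_) (fun y hy => ?_)
    (fun x hx => hamBody_relToBody_of_tot hm hx.2.2)
    (fun y hy => hamRel_bodyToRel_of_tot hm hy.2.1) (fun t x hx y hf => ?_)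
    (fun t x hx y hf => ?_)
  · rw [bodyToRel_relToBody hm hx.2.2]
    exact Setoid.symm' _ ⟨1, _, by simp, add_relTranslation _ _⟩
  · obtain ⟨c, hc⟩ := relToBody_bodyToRel hm hy.2.1
    rw [hc]
    exact Setoid.symm' _ ⟨1, c, by simp, add_bodyTranslation _ _⟩
  · refine ⟨_, Setoid.refl' _ _, Flow.map_of_level hR
      (fun z hz => (relToBody m).differentiableAt)
      (fun z hz => relToBody_mem hm hz.1 hz.2.2) (fun z hz v hv => ?_) hx hf⟩
    rw [ContinuousLinearMap.fderiv]
    exact isHamiltonianVector_relToBody hm μ hz.1 hz.2.2 hv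
  · obtain ⟨c, hc⟩ := Flow.map_gauge (S₁ := bodySystem m μ)
      (S₂ := relTransSystem m μ) (Φ := bodyToRel m) relTranslation
      (fun y => bodyGauge m (bodyToRel m y)) hB
      (fun z hz => (bodyToRel m).differentiableAt) (fun z hz => bodyToRel_mem (m := m) hz.1)
      (continuousOn_bodyGauge.comp (bodyToRel m).continuous.continuousOn
        fun z hz => bodyToRel_mem (m := m) hz.1)
      (fun z hz v hv => by
        rw [ContinuousLinearMap.fderiv]
        exact isHamiltonianVector_bodyToRel hm μ hz.1 hz.2.1 hv)
      (fun x hx c j => by simpa [relTranslation_apply] using hx j)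
      (fun x hx c v hv => isHamiltonianVector_add_relTranslation μ c hv) hx hf
    exact ⟨_, ⟨1, c, by simp, add_relTranslation _ _⟩, hc⟩

end PlanarThreeBody

end

theorem mainTheorem4 (m : Fin 3 → ℝ) (hm : ∀ i, 0 < m i) (μ : ℝ) :
    -- reduction of `H_sph` by complex scaling
    ((PlanarThreeBody.sphSystem (PlanarThreeBody.hamSph m) μ).HasQuotientFlow ∧
      (PlanarThreeBody.relSystem m μ).HasQuotientFlow ∧
      (PlanarThreeBody.sphSystem (PlanarThreeBody.hamSph m) μ).Equivalent
        (PlanarThreeBody.relSystem m μ)) ∧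
    -- reduction of `H_sph` by complex scaling and momentum translations
    ((PlanarThreeBody.sphTransSystem (PlanarThreeBody.hamSph m) μ).HasQuotientFlow ∧
      (PlanarThreeBody.bodySystem m μ).HasQuotientFlow ∧
      (PlanarThreeBody.sphTransSystem (PlanarThreeBody.hamSph m) μ).Equivalent
        (PlanarThreeBody.bodySystem m μ)) ∧
    -- the explicit expression agrees with `H_sph` on the second level and may replace it there
    (Set.EqOn (PlanarThreeBody.hamSphExplicit m) (PlanarThreeBody.hamSph m)
        (PlanarThreeBody.sphTransSystem (PlanarThreeBody.hamSph m) μ).level ∧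
      (PlanarThreeBody.sphSystem (PlanarThreeBody.hamSphExplicit m) μ).HasQuotientFlow ∧
      (PlanarThreeBody.sphTransSystem (PlanarThreeBody.hamSphExplicit m) μ).HasQuotientFlow ∧
      (PlanarThreeBody.sphTransSystem (PlanarThreeBody.hamSphExplicit m) μ).Equivalent
        (PlanarThreeBody.bodySystem m μ)) := by
  -- Parts 2 and 3 share this second half of the passage through `relTransSystem`.
  have hB := PlanarThreeBody.equivalent_relTransSystem_bodySystem hm μ
  refine ⟨⟨PlanarThreeBody.sphSystem_hamSph_hasQuotientFlow hm μ,
      PlanarThreeBody.hasQuotientFlow_relSystem m μ,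
      PlanarThreeBody.equivalent_sphSystem_relSystem hm μ⟩,
    ⟨PlanarThreeBody.sphTransSystem_hamSph_hasQuotientFlow hm μ,
      PlanarThreeBody.hasQuotientFlow_bodySystem m μ,
      (PlanarThreeBody.equivalent_sphTransSystem_relTransSystem hm μ).trans hB⟩,
    fun z hz => ?_, ?_, PlanarThreeBody.sphTransSystem_hamSphExplicit_hasQuotientFlow hm μ,
    (PlanarThreeBody.equivalent_sphTransSystem_explicit_relTransSystem hm μ).trans hB⟩
  · exact PlanarThreeBody.hamSphExplicit_eq_hamSph hm hz.1
      ((PlanarThreeBody.pairing_eq_iff _ _ _).1 hz.2.1).1 hz.2.2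
  · exact PlanarThreeBody.hasQuotientFlow_sphSystem μ
      (fun _ hz => PlanarThreeBody.differentiableAt_hamSphExplicit hm hz)
      fun _ hk c z => PlanarThreeBody.hamSphExplicit_sphAction hk c z
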